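/- Let $\mathfrak g$ be a split real semisimple Lie algebra with Killing form $\kappa$, split Cartan subalgebra $\mathfrak h$, simple roots $\alpha_1,\dots,\alpha_l$ and root vectors $E_\alpha\in\mathfrak g_\alpha$ with $\kappa(E_\alpha,E_{-\alpha})=1$. Let $(\cdot,\cdot)$ be the form on $\mathfrak h^*$ induced by $\kappa$, $d_i=\tfrac12(\alpha_i,\alpha_i)$, $\alpha_i^\vee\in\mathfrak h$ the simple co-roots, $A_{ij}=\alpha_j(\alpha_i^\vee)$ the Cartan matrix, and $P_i\in\mathfrak h$ the elements with $\kappa(P_i,\alpha_j^\vee)=\delta_{ij}$. Put $$R_{12}=\sum_{\alpha>0}\bigl(E_\alpha\otimes E_{-\alpha}-E_{-\alpha}\otimes E_\alpha\bigr),\qquad H_{12}=\sum_{i=1}^l P_i\otimes\alpha_i^\vee .$$ Let $G$ be a real linear Lie group with Lie algebra $\mathfrak g$ (embedded in matrices by a faithful representation of $\mathfrak g$), $M$ a Poisson manifold, $\gamma\neq0$ real, $q=e^{-i\gamma}$, and let $U:M\to G$ be a smooth map that satisfies the Sklyanin bracket $\{U_1,U_2\}=\gamma[R_{12},U_1U_2]$.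 Extend $\{\cdot,\cdot\}$ complex-bilinearly to complex-valued smooth functions. Let $\beta_1,\dots,\beta_N$ be an ordering of the positive roots such that, if $i<j$ and $\beta_i+\beta_j$ is a root, then $\beta_i+\beta_j=\beta_k$ with $i<k<j$. Suppose that $U=M^-DM^+$ on $M$, where $$D=\exp\Bigl(i\gamma\sum_{i=1}^l Q^H_iP_i\Bigr),\qquad M^{\pm}=\prod_{k=1}^N\exp\bigl(\pm i\gamma A_{\pm\beta_k}Q^E_{\pm\beta_k}E_{\pm\beta_k}\bigr)$$ (products in increasing order of $k$), with $D$, $M^\pm$ smooth, complex-valued smooth functions $Q^H_i$, $Q^E_{\alpha}$ (the charges) and non-zero complex constants $A_\alpha$. For elements $x,y$ of weights $\lambda,\mu$ in the root lattice set $\{x,y\}_{q^{\pm1}}=\{x,y\}\pm\gamma(\lambda,\mu)xy$, which has weight $\lambda+\mu$; here $Q^E_\alpha$ has weight $\alpha$. Poisson subalgebras are taken over $\mathbb C$ and with unit. Then the following hold. 1. $\{D_1,D_2\}=0$, $\{D_1,M^\pm_2\}=\pm\gamma D_1[H_{12},M^\pm_2]$, $\{M^+_1,M^-_2\}=0$,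 and $\{M^\pm_1,M^\pm_2\}=\gamma\bigl([R_{12},M^\pm_1M^\pm_2]\mp M^\pm_1H_{12}M^\pm_2\pm M^\pm_2H_{12}M^\pm_1\bigr)$. 2. (Algebras $\mathscr U_q(\mathfrak n_\pm)$.) For each sign, the Poisson subalgebra $\mathscr A_\pm$ generated by the $Q^E_{\pm\alpha}$, $\alpha>0$, is generated by the $e_i=Q^E_{\pm\alpha_i}$, and these satisfy the $q^{\pm1}$-Poisson-Serre relations: for $i\ne j$, $$\{\dots\{\{e_j,e_i\}_{q^{\pm1}},e_i\}_{q^{\pm1}}\dots,e_i\}_{q^{\pm1}}=0,\qquad \{e_i,\dots\{e_i,\{e_i,e_j\}_{q^{\pm1}}\}_{q^{\pm1}}\dots\}_{q^{\pm1}}=0,$$ with $1-A_{ij}$ occurrences of $e_i$ in each. Every element of $\mathscr A_+$ Poisson-commutes with every element of $\mathscr A_-$. 3. (Algebras $\mathscr U_q(\mathfrak b_\pm)$.) $\{Q^H_i,Q^H_j\}=0$, and for every positive root $\alpha$ $$i\{Q^H_i,Q^E_\alpha\}=\alpha(\alpha_i^\vee)Q^E_\alpha,\qquad i\{Q^H_i,Q^E_{-\alpha}\}=\alpha(\alpha_i^\vee)Q^E_{-\alpha}.$$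 Hence, for each sign, the Poisson subalgebra generated by all $Q^H_i$ and all $Q^E_{\pm\alpha}$, $\alpha>0$, is generated by $h_i=\pm Q^H_i$ and $e_i=Q^E_{\pm\alpha_i}$, which satisfy the relations $\{h_i,h_j\}=0$, $i\{h_i,e_j\}=\pm A_{ij}e_j$ and the $q^{\pm1}$-Poisson-Serre relations of $\mathscr U_q(\mathfrak b_\pm)$. The Poisson subalgebra generated by all charges is generated by the $Q^H_i$ and $Q^E_{\pm\alpha_i}$. 4. (Split reality conditions.) $|q|=1$. If at every point of $M$ the matrix $i\gamma\sum_iQ^H_iP_i$ is the principal logarithm of $D$ (its eigenvalues have imaginary part in $(-\pi,\pi)$; this is so when it lies in the real Cartan subalgebra $\mathfrak h$), then $\overline{Q^H_i}=-Q^H_i$ for all $i$. For every root $\alpha$ with $A_\alpha$ real, $\overline{Q^E_\alpha}=-Q^E_\alpha$. In particular $\overline{Q^E_{\pm\alpha_i}}=-Q^E_{\pm\alpha_i}$ if $-\pi\le\gamma d_i\le\pi$ and $A_{\pm\alpha_i}$ is normalised by $A_{\pm\alpha_i}^2=4\sin(\gamma d_i)/\gamma$. -/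

import Mathlib

open scoped Manifold ContDiff Kronecker

noncomputable section

namespace SklyaninCharges

/-! ### Poisson brackets -/

/-- A Poisson bracket on a commutative `k`-algebra. -/
structure PoissonBracket (k A : Type*) [CommRing k] [CommRing A] [Algebra k A] where
  br : A →ₗ[k] A →ₗ[k] A
  self_eq_zero : ∀ f, br f f = 0
  leibniz : ∀ f g h, br f (g * h) = br f g * h + g * br f h
  jacobi : ∀ f g h, br f (br g h) + br g (br h f) + br h (br f g) = 0

/-- The Poisson subalgebra generated by a set: the smallest subalgebra (with unit) that contains
the set and is closed under the Poisson bracket. -/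
def PoissonBracket.generated {k A : Type*} [CommRing k] [CommRing A] [Algebra k A]
    (P : PoissonBracket k A) (S : Set A) : Subalgebra k A :=
  sInf {B | S ⊆ B ∧ ∀ f ∈ B, ∀ g ∈ B, P.br f g ∈ B}

section Functions

variable {EM : Type*} [NormedAddCommGroup EM] [NormedSpace ℝ EM] {HM : Type*} [TopologicalSpace HM]

/-- Real-valued smooth functions on `M`. -/
abbrev SmoothR (I : ModelWithCorners ℝ EM HM) (M : Type*) [TopologicalSpace M]
    [ChartedSpace HM M] : Type _ := C^∞⟮I, M; 𝓘(ℝ, ℝ), ℝ⟯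

/-- Complex-valued smooth functions on `M`. -/
abbrev SmoothC (I : ModelWithCorners ℝ EM HM) (M : Type*) [TopologicalSpace M]
    [ChartedSpace HM M] : Type _ := C^∞⟮I, M; 𝓘(ℝ, ℂ), ℂ⟯

instance : ContMDiffRing 𝓘(ℝ, ℂ) ∞ ℂ :=
  { instNormedSpaceLieAddGroup with
    contMDiff_mul := by
      rw [contMDiff_iff]
      refine ⟨continuous_mul, fun x y => ?_⟩
      simp only [mfld_simps, chartAt_self_eq]
      rw [contDiffOn_univ]
      exact contDiff_mul }

variable {I : ModelWithCorners ℝ EM HM} {M : Type*} [TopologicalSpace M] [ChartedSpace HM M]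

instance : Algebra ℂ (SmoothC I M) where
  smul c f := ⟨fun m => c * f m, contMDiff_const.mul f.contMDiff⟩
  algebraMap :=
    { toFun := fun c => ⟨fun _ => c, contMDiff_const⟩
      map_one' := rfl
      map_mul' := fun _ _ => rfl
      map_zero' := rfl
      map_add' := fun _ _ => rfl }
  commutes' c f := by ext m; exact mul_comm c (f m)
  smul_def' _ _ := rfl

/-- Real part of a complex-valued smooth function. -/
def reFun (f : SmoothC I M) : SmoothR I M :=
  ⟨fun m => (f m).re, Complex.reCLM.contMDiff.comp f.contMDiff⟩

/-- Imaginary part of a complex-valued smooth function. -/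
def imFun (f : SmoothC I M) : SmoothR I M :=
  ⟨fun m => (f m).im, Complex.imCLM.contMDiff.comp f.contMDiff⟩

/-- The function `f + i g`. -/
def ofReIm (f g : SmoothR I M) : SmoothC I M :=
  ⟨fun m => (f m : ℂ) + Complex.I * (g m : ℂ),
    (Complex.ofRealCLM.contMDiff.comp f.contMDiff).add
      (contMDiff_const.mul (Complex.ofRealCLM.contMDiff.comp g.contMDiff))⟩

theorem reFun_add (f g : SmoothC I M) : reFun (f + g) = reFun f + reFun g := by
  ext m; exact Complex.add_re (f m) (g m)

theorem imFun_add (f g : SmoothC I M) : imFun (f + g) = imFun f + imFun g := by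
  ext m; exact Complex.add_im (f m) (g m)

theorem reFun_smul (c : ℂ) (f : SmoothC I M) :
    reFun (c • f) = c.re • reFun f - c.im • imFun f := by
  ext m; exact Complex.mul_re c (f m)

theorem imFun_smul (c : ℂ) (f : SmoothC I M) :
    imFun (c • f) = c.re • imFun f + c.im • reFun f := by
  ext m; exact Complex.mul_im c (f m)

theorem reFun_mul (f g : SmoothC I M) :
    reFun (f * g) = reFun f * reFun g - imFun f * imFun g := by
  ext m; exact Complex.mul_re (f m) (g m)

theorem imFun_mul (f g : SmoothC I M) :
    imFun (f * g) = reFun f * imFun g + imFun f * reFun g := by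
  ext m; exact Complex.mul_im (f m) (g m)

theorem reFun_ofReIm (f g : SmoothR I M) : reFun (ofReIm f g) = f := by
  ext m
  change ((f m : ℂ) + Complex.I * (g m : ℂ)).re = f m
  simp

theorem imFun_ofReIm (f g : SmoothR I M) : imFun (ofReIm f g) = g := by
  ext m
  change ((f m : ℂ) + Complex.I * (g m : ℂ)).im = g m
  simp

theorem smoothC_ext {f g : SmoothC I M} (h : reFun f = reFun g) (h' : imFun f = imFun g) :
    f = g := by
  ext m
  exact Complex.ext (congrArg (fun k : SmoothR I M => k m) h)
    (congrArg (fun k : SmoothR I M => k m) h')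

theorem PoissonBracket.skew {k A : Type*} [CommRing k] [CommRing A] [Algebra k A]
    (P : PoissonBracket k A) (f g : A) : P.br f g = -P.br g f := by
  have h := P.self_eq_zero (f + g)
  simp only [map_add, LinearMap.add_apply, P.self_eq_zero, zero_add, add_zero] at h
  exact eq_neg_of_add_eq_zero_right h

/-- The `ℂ`-bilinear extension of a Poisson bracket to complex-valued functions:
`{a + i b, c + i d} = {a, c} - {b, d} + i ({a, d} + {b, c})`. -/
def PoissonBracket.complexify (P : PoissonBracket ℝ (SmoothR I M)) :
    PoissonBracket ℂ (SmoothC I M) where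
  br := LinearMap.mk₂ ℂ
    (fun f g => ofReIm (P.br (reFun f) (reFun g) - P.br (imFun f) (imFun g))
      (P.br (reFun f) (imFun g) + P.br (imFun f) (reFun g)))
    (fun f f' g => by
      apply smoothC_ext <;>
        simp only [reFun_add, imFun_add, reFun_ofReIm, imFun_ofReIm, map_add,
          LinearMap.add_apply] <;> abel)
    (fun c f g => by
      apply smoothC_ext <;>
        simp only [reFun_smul, imFun_smul, reFun_ofReIm, imFun_ofReIm, map_add, map_sub, map_smul,
          LinearMap.add_apply, LinearMap.sub_apply, LinearMap.smul_apply] <;> module)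
    (fun f g g' => by
      apply smoothC_ext <;>
        simp only [reFun_add, imFun_add, reFun_ofReIm, imFun_ofReIm, map_add] <;> abel)
    (fun c f g => by
      apply smoothC_ext <;>
        simp only [reFun_smul, imFun_smul, reFun_ofReIm, imFun_ofReIm, map_add, map_sub,
          map_smul] <;> module)
  self_eq_zero f := by
    apply smoothC_ext
    · simp only [LinearMap.mk₂_apply, reFun_ofReIm, P.self_eq_zero, sub_self]
      ext m; simp [reFun]
    · simp only [LinearMap.mk₂_apply, imFun_ofReIm]
      rw [P.skew (imFun f), add_neg_cancel]
      ext m; simp [imFun]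
  leibniz f g h := by
    apply smoothC_ext <;>
      simp only [LinearMap.mk₂_apply, reFun_add, imFun_add, reFun_mul, imFun_mul, reFun_ofReIm,
        imFun_ofReIm, map_add, map_sub, P.leibniz] <;> ring
  jacobi f g h := by
    have J := P.jacobi
    have J' : ∀ a b c, P.br a (P.br b c) = -P.br b (P.br c a) - P.br c (P.br a b) := fun a b c => by
      linear_combination J a b c
    apply smoothC_ext
    · simp only [LinearMap.mk₂_apply, reFun_add, reFun_ofReIm, imFun_ofReIm, map_add, map_sub]
      rw [show reFun (0 : SmoothC I M) = 0 by ext m; simp [reFun]]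
      linear_combination J (reFun f) (reFun g) (reFun h) - J (reFun f) (imFun g) (imFun h)
        - J (imFun f) (reFun g) (imFun h) - J (imFun f) (imFun g) (reFun h)
    · simp only [LinearMap.mk₂_apply, imFun_add, reFun_ofReIm, imFun_ofReIm, map_add, map_sub]
      rw [show imFun (0 : SmoothC I M) = 0 by ext m; simp [imFun]]
      linear_combination J (reFun f) (reFun g) (imFun h) + J (reFun f) (imFun g) (reFun h)
        + J (imFun f) (reFun g) (reFun h) - J (imFun f) (imFun g) (imFun h)

end Functions

/-! ### Tensor notation for matrices of functions -/

/-- The matrix of brackets `{X₁, Y₂}`, with `((a, c), (b, d))` entry `{X a b, Y c d}`. -/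
def tensorBracket {k A n : Type*} [CommRing k] [CommRing A] [Algebra k A]
    (P : PoissonBracket k A) (X Y : Matrix n n A) : Matrix (n × n) (n × n) A :=
  Matrix.of fun p r => P.br (X p.1 r.1) (Y p.2 r.2)

/-- `X₁ = X ⊗ 1`. -/
def inFirst {A n : Type*} [CommRing A] [Fintype n] [DecidableEq n] (X : Matrix n n A) :
    Matrix (n × n) (n × n) A := X ⊗ₖ (1 : Matrix n n A)

/-- `X₂ = 1 ⊗ X`. -/
def inSecond {A n : Type*} [CommRing A] [Fintype n] [DecidableEq n] (X : Matrix n n A) :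
    Matrix (n × n) (n × n) A := (1 : Matrix n n A) ⊗ₖ X

/-! ### The split semisimple Lie algebra -/

section LieData

open LieAlgebra LieAlgebra.IsKilling

variable {g : Type*} [LieRing g] [LieAlgebra ℝ g] [Module.Finite ℝ g] [IsKilling ℝ g]
  {H : LieSubalgebra ℝ g} [H.IsCartanSubalgebra] [LieModule.IsTriangularizable ℝ H g]

/-- The bilinear form `(·, ·)` on the dual of the Cartan subalgebra induced by the Killing form. -/
def rootForm (lam mu : Module.Dual ℝ H) : ℝ :=
  killingForm ℝ g ((cartanEquivDual H).symm lam : g) ((cartanEquivDual H).symm mu : g)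

/-- The linear form on the Cartan subalgebra given by a root. -/
def rootVec (α : H.root) : Module.Dual ℝ H := (rootSystem H).root α

/-- The opposite of a root. -/
def negRoot (α : H.root) : H.root := ⟨-α.1, by
  simpa only [LieSubalgebra.root, Finset.mem_filter, Finset.mem_univ, true_and,
    LieModule.Weight.isNonZero_neg] using α.2⟩

/-- `d_i = (α_i, α_i) / 2`. -/
def symm_d (α : H.root) : ℝ := rootForm (rootVec α) (rootVec α) / 2

/-- A choice of root vectors, normalised by `κ(E_α, E_{-α}) = 1`. -/
structure IsCartanWeyl (E : H.root → g) : Prop where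
  mem : ∀ α : H.root, E α ∈ rootSpace H α.1
  norm_eq : ∀ α : H.root, killingForm ℝ g (E α) (E (negRoot α)) = 1

variable (b : (rootSystem H).Base)

/-- The simple root `α_i`. -/
def simpleRoot (i : b.support) : H.root := i.1

/-- The simple co-root `α_i^∨`. -/
def simpleCoroot (i : b.support) : H := coroot (simpleRoot b i).1

/-- The Cartan matrix `A_{ij} = α_j(α_i^∨)`. -/
def cartanEntry (i j : b.support) : ℤ := (rootSystem H).pairingIn ℤ j.1 i.1

/-- The fundamental weights, the basis dual to the simple co-roots. -/
def fundWeight (i : b.support) : Module.Dual ℝ H := b.toCoweightBasis.coord i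

/-- `P_i ∈ 𝔥`, the element which corresponds to the fundamental weight `ω_i` under the Killing
form. -/
def weightElt (i : b.support) : H := (cartanEquivDual H).symm (fundWeight b i)

/-- The set of positive roots. -/
abbrev PosRoot : Type _ := {α : H.root // b.IsPos α}

/-- A labelling `β_1, …, β_N` of the positive roots is a normal order if, whenever `i < j` and
`β_i + β_j` is a root, this root is `β_k` for some `i < k < j`. -/
def IsNormalOrder {N : ℕ} (β : Fin N ≃ PosRoot b) : Prop :=
  ∀ i j : Fin N, i < j → ∀ δ : H.root, rootVec δ = rootVec (β i).1 + rootVec (β j).1 →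
    ∃ k : Fin N, i < k ∧ k < j ∧ (β k).1 = δ

section Representation

variable {n : Type*} [Fintype n] [DecidableEq n] (ρ : g →ₗ[ℝ] Matrix n n ℝ)

/-- `ρ` is a faithful matrix representation of the Lie algebra. -/
structure IsFaithfulRep : Prop where
  map_lie : ∀ X Y : g, ρ ⁅X, Y⁆ = ρ X * ρ Y - ρ Y * ρ X
  injective : Function.Injective ρ

/-- The kernel `R₁₂ = ∑_{α > 0} (E_α ⊗ E_{-α} - E_{-α} ⊗ E_α)` of the standard split `R`-matrix
`π_{𝔫_+} - π_{𝔫_-}`, in the representation `ρ`. -/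
def rMatrix (E : H.root → g) : Matrix (n × n) (n × n) ℝ :=
  open Classical in
  ∑ α : PosRoot b, (ρ (E α.1) ⊗ₖ ρ (E (negRoot α.1)) - ρ (E (negRoot α.1)) ⊗ₖ ρ (E α.1))

/-- The Cartan part `H₁₂ = ∑_i P_i ⊗ α_i^∨` of the quadratic Casimir, written in bases of `𝔥` that
are dual to each other for the Killing form, in the representation `ρ`. -/
def cartanTensor : Matrix (n × n) (n × n) ℝ :=
  ∑ i : b.support, ρ (weightElt b i : g) ⊗ₖ ρ (simpleCoroot b i : g)

/-- `G` is a linear Lie group whose Lie algebra is `ρ(𝔤)`. -/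
def HasLieAlgebra (G : Subgroup (Matrix.GeneralLinearGroup n ℝ)) : Prop :=
  ∀ X : Matrix n n ℝ,
    (∀ t : ℝ, ∃ x ∈ G, (x : Matrix n n ℝ) = NormedSpace.exp (t • X)) ↔ X ∈ Set.range ρ

/-- `ρ(X)` as a complex matrix. -/
def rhoC (X : g) : Matrix n n ℂ := (ρ X).map ((↑) : ℝ → ℂ)

/-- `Z = i γ ∑_i Q^H_i P_i`. -/
def cartanExponent (γ : ℝ) (QH : b.support → ℂ) : Matrix n n ℂ :=
  ∑ i : b.support, (Complex.I * (γ : ℂ) * QH i) • rhoC ρ (weightElt b i : g)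

/-- A matrix is a principal logarithm (of its exponential) if its eigenvalues have imaginary part
in `(-π, π)`. -/
def IsPrincipalLog (Z : Matrix n n ℂ) : Prop := ∀ z ∈ spectrum ℂ Z, |z.im| < Real.pi

/-- The ordered product `∏_k exp(s i γ A_k Q_k E_k)`. -/
def orderedProduct {N : ℕ} (γ s : ℝ) (A Q : Fin N → ℂ) (E : Fin N → g) : Matrix n n ℂ :=
  (List.ofFn fun k : Fin N =>
    NormedSpace.exp (((s : ℂ) * Complex.I * (γ : ℂ) * A k * Q k) • rhoC ρ (E k))).prod

end Representation

/-! ### `q`-deformed Poisson algebras -/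

section Relations

variable {A : Type*} [CommRing A] [Algebra ℂ A]

/-- The `q`-bracket, with `q = exp(-i s)`, of elements of given weights,
`{x, y}_q = {x, y} + s (λ, μ) x y` for `x` of weight `λ` and `y` of weight `μ`; the result has
weight `λ + μ`. -/
def qBracket (P : PoissonBracket ℂ A) (s : ℝ) (x y : Module.Dual ℝ H × A) :
    Module.Dual ℝ H × A :=
  (x.1 + y.1, P.br x.2 y.2 + ((s * rootForm x.1 y.1 : ℝ) : ℂ) • (x.2 * y.2))

/-- `{{…{e_j, e_i}_q, …, e_i}_q, e_i}_q` with `1 - A_{ij}` entries `e_i`. -/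
def serreRight (P : PoissonBracket ℂ A) (s : ℝ) (e : b.support → A) (i j : b.support) : A :=
  ((fun x => qBracket P s x (rootVec (simpleRoot b i), e i))^[(1 - cartanEntry b i j).toNat]
    (rootVec (simpleRoot b j), e j)).2

/-- `{e_i, {e_i, …, {e_i, e_j}_q …}_q}_q` with `1 - A_{ij}` entries `e_i`. -/
def serreLeft (P : PoissonBracket ℂ A) (s : ℝ) (e : b.support → A) (i j : b.support) : A :=
  ((fun x => qBracket P s (rootVec (simpleRoot b i), e i) x)^[(1 - cartanEntry b i j).toNat]
    (rootVec (simpleRoot b j), e j)).2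

/-- The elements `e_i` generate the Poisson subalgebra `B` and satisfy the defining relations of
`U_q(𝔫_+)` with `q = exp(-i s)`, the `q`-Poisson-Serre relations. With `q⁻¹` in place of `q`,
these are the relations of `U_q(𝔫_-)`. -/
structure SpansUqNilpotent (P : PoissonBracket ℂ A) (s : ℝ) (e : b.support → A)
    (B : Subalgebra ℂ A) : Prop where
  generates : P.generated (Set.range e) = B
  serre_right : ∀ i j, i ≠ j → serreRight b P s e i j = 0
  serre_left : ∀ i j, i ≠ j → serreLeft b P s e i j = 0

/-- The elements `h_i`, `e_i` generate the Poisson subalgebra `B` and satisfy the defining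
relations of the Borel algebra, with `q = exp(-i s)` and `σ = 1` for `𝔟_+`,
with `q⁻¹` in place of `q` and `σ = -1` for `𝔟_-`. -/
structure SpansUqBorel (P : PoissonBracket ℂ A) (s : ℝ) (σ : ℤ) (h e : b.support → A)
    (B : Subalgebra ℂ A) : Prop where
  generates : P.generated (Set.range h ∪ Set.range e) = B
  cartan_comm : ∀ i j, P.br (h i) (h j) = 0
  cartan_act : ∀ i j, Complex.I • P.br (h i) (e j) = ((σ * cartanEntry b i j : ℤ) : ℂ) • e j
  nilpotent : SpansUqNilpotent b P s e (P.generated (Set.range e))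

end Relations

end LieData

end SklyaninCharges

end

/-! Let `h₀` be the sum of the fundamental co-weights. Its adjoint action grades 𝔤 by height. In
homogeneous dual bases R₁₂, H₁₂ and the Casimir tensor Ω are sums of `w (deg) e ⊗ e'`, where `w` is
the sign, the indicator of 0 and the constant 1 respectively. Write the decomposition as u = m d p.

Brackets of the factors. For a derivation δ, m⁻¹ δu (dp)⁻¹ = m⁻¹ δm + δd d⁻¹ + d (δp p⁻¹) d⁻¹, with
terms in 𝔫₋, 𝔥 and 𝔫₊. Used in both tensor factors, this splits {u₁, u₂} into nine pieces in
independent spaces. The nine claimed values, normalised in the same way, lie in these spaces: R₁₂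
may be shifted by ±Ω, after which one leg is triangular, and Ω commutes with p₁p₂ and m₁m₂. The sums
agree, hence so do the pieces (`IsGauss.tensorBracket_eq`).

Simple exponents. Let a_i be the exponent in p of the simple root vector X_i, let Y_i be its dual
and t_i = [X_i, Y_i]. Contracting the first leg of {p₁, p₂}p₁⁻¹ with Y_i gives {a_i, p} = γ(2[Y_i,
p] + a_i(p t_i + t_i p)) (`IsTriangularProduct.map_br_simple`). Serre relations: let y be the
co-weight dual to α_j and F(η) = κ(y, pηp⁻¹), so that F(Y_j) = a_j. Since y commutes with Y_i and
t_i, {a_i, F(η)} is a combination of F([Y_i, η]) and a_i F(η), and the second term is exactly the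
one that the q-bracket removes. The nested q-brackets are thus multiples of F(ad(Y_i)^m Y_j), and
the Serre relations of 𝔤 make them vanish. Replacing p by p⁻¹ gives the other nesting. Generation:
compared in a suitable root direction, the same formula contains the exponent of a given non-simple
root linearly, and otherwise only exponents of lower height and their brackets with a_j
(`IsTriangularProduct.mem_of_simple_mem`). The factor m is treated in the same way with the grading
reversed.

Cartan charges. The brackets {d₁, p₂} and {d₁, m₂} show that Q^H_i acts on p and m by commutators
with a co-root, hence diagonally on their exponents (`IsTriangularProduct.br_eq_smul`).

Reality. Conjugation fixes u. Comparing mdp with its conjugate shows that m h₀ m⁻¹ and p⁻¹ h₀ p are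
real, and the exponents are recovered from these recursively in the height
(`IsTriangularProduct.mem_of_coef_mem`). Then d is real too, and two commuting principal logarithms
of one matrix coincide, which makes its exponents real. -/

open scoped Manifold ContDiff Kronecker

set_option linter.unusedSectionVars false
set_option linter.unusedSimpArgs false

noncomputable section

namespace SklyaninCharges

open LieAlgebra

/-! ### Gradings of a Lie algebra -/

section Grading

variable {g : Type*} [LieRing g] [LieAlgebra ℝ g]

/-- The eigenspaces of `ad h₀` for integral eigenvalues. -/
def gr (h₀ : g) (k : ℤ) : Submodule ℝ g := (LieAlgebra.ad ℝ g h₀).eigenspace (k : ℝ)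

theorem mem_gr {h₀ : g} {k : ℤ} {x : g} : x ∈ gr h₀ k ↔ ⁅h₀, x⁆ = (k : ℝ) • x := by
  simp [gr]

theorem mem_gr_neg {h₀ : g} {k : ℤ} {x : g} : x ∈ gr (-h₀) k ↔ x ∈ gr h₀ (-k) := by
  simp only [mem_gr, neg_lie, Int.cast_neg, neg_smul]
  exact neg_eq_iff_eq_neg

theorem lie_mem_gr {h₀ x y : g} {j k : ℤ} (hx : x ∈ gr h₀ j) (hy : y ∈ gr h₀ k) :
    ⁅x, y⁆ ∈ gr h₀ (j + k) := by
  rw [mem_gr] at *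
  rw [leibniz_lie, hx, hy, smul_lie, lie_smul, Int.cast_add, add_smul]

theorem ad_pow_mem_gr {h₀ x y : g} {j k : ℤ} (hx : x ∈ gr h₀ j) (hy : y ∈ gr h₀ k) (m : ℕ) :
    (LieAlgebra.ad ℝ g x ^ m) y ∈ gr h₀ (m * j + k) := by
  induction m with
  | zero => simpa using hy
  | succ m ih =>
    rw [pow_succ', Module.End.mul_apply, LieAlgebra.ad_apply]
    have e : ((m + 1 : ℕ) : ℤ) * j + k = j + (m * j + k) := by push_cast; ring
    rw [e]
    exact lie_mem_gr hx ih

theorem killingForm_lie_left (x y z : g) :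
    killingForm ℝ g ⁅x, y⁆ z = killingForm ℝ g x ⁅y, z⁆ :=
  LieModule.traceForm_apply_lie_apply ℝ g g x y z

theorem killingForm_symm (x y : g) : killingForm ℝ g x y = killingForm ℝ g y x :=
  LieModule.traceForm_comm ℝ g g x y

/-- Moving `ad h₀` across the invariant form gives `(j + k) κ(x, y) = 0`. -/
theorem killingForm_eq_zero_of_mem_gr {h₀ x y : g} {j k : ℤ} (hx : x ∈ gr h₀ j)
    (hy : y ∈ gr h₀ k) (hjk : j + k ≠ 0) : killingForm ℝ g x y = 0 := by
  rw [mem_gr] at hx hy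
  have h := killingForm_lie_left x h₀ y
  rw [← lie_skew, hx, hy, map_neg, map_smul, map_smul, LinearMap.neg_apply, LinearMap.smul_apply,
    smul_eq_mul, smul_eq_mul] at h
  have h' : ((j + k : ℤ) : ℝ) * killingForm ℝ g x y = 0 := by push_cast; linarith
  exact (mul_eq_zero.1 h').resolve_left (by exact_mod_cast hjk)

end Grading

/-! ### Matrices over a function algebra, and their filtration by degree. -/

section Matrices

variable {g : Type*} [LieRing g] [LieAlgebra ℝ g] {n : Type*} [Fintype n] [DecidableEq n]
  {R : Type*} [CommRing R] [Algebra ℝ R]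

/-- A real matrix representation, with values in the matrices over a real algebra `R`. -/
def rep (R : Type*) [CommRing R] [Algebra ℝ R] (ρ : g →ₗ[ℝ] Matrix n n ℝ) :
    g →ₗ[ℝ] Matrix n n R where
  toFun x := (ρ x).map (algebraMap ℝ R)
  map_add' x y := by ext; simp
  map_smul' c x := by
    ext a b
    change algebraMap ℝ R (ρ (c • x) a b) = c • algebraMap ℝ R (ρ x a b)
    rw [map_smul, Matrix.smul_apply, smul_eq_mul, map_mul, Algebra.smul_def]

theorem rep_apply (ρ : g →ₗ[ℝ] Matrix n n ℝ) (x : g) :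
    rep R ρ x = (ρ x).map (algebraMap ℝ R) := rfl

theorem rep_lie {ρ : g →ₗ[ℝ] Matrix n n ℝ} (hρ : IsFaithfulRep ρ) (x y : g) :
    rep R ρ ⁅x, y⁆ = rep R ρ x * rep R ρ y - rep R ρ y * rep R ρ x := by
  simp only [rep_apply, hρ.map_lie, ← Matrix.map_mul]
  ext
  simp only [Matrix.map_apply, Matrix.sub_apply, map_sub]

/-- The extension to matrices over `R` of a linear form on a Lie algebra of real matrices. -/
def coef (R : Type*) [CommRing R] [Algebra ℝ R] (ρ : g →ₗ[ℝ] Matrix n n ℝ) (φ : g →ₗ[ℝ] ℝ) :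
    Matrix n n R →ₗ[R] R where
  toFun X := ∑ a, ∑ b, X a b * algebraMap ℝ R (φ (ρ.leftInverse (Matrix.single a b 1)))
  map_add' X Y := by simp [add_mul, Finset.sum_add_distrib]
  map_smul' c X := by simp [Finset.mul_sum, mul_assoc]

/-- The left inverse of `ρ` makes `φ` a linear form on all real matrices, and such a form extends
entrywise to matrices over `R`. Only its values on the span of `ρ(𝔤)` matter later. -/
theorem coef_rep {ρ : g →ₗ[ℝ] Matrix n n ℝ} (hρ : IsFaithfulRep ρ) (φ : g →ₗ[ℝ] ℝ) (x : g) :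
    coef R ρ φ (rep R ρ x) = algebraMap ℝ R (φ x) := by
  have h : x = ρ.leftInverse (ρ x) :=
    (LinearMap.leftInverse_apply_of_inj (LinearMap.ker_eq_bot.2 hρ.injective) x).symm
  conv_rhs => rw [h, Matrix.matrix_eq_sum_single (ρ x)]
  simp only [map_sum, coef, LinearMap.coe_mk, AddHom.coe_mk, rep_apply, Matrix.map_apply]
  refine Finset.sum_congr rfl fun a _ => Finset.sum_congr rfl fun b _ => ?_
  rw [← map_mul, ← mul_one (ρ x a b), ← smul_eq_mul (ρ x a b) 1, ← Matrix.smul_single, map_smul,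
    map_smul, smul_eq_mul, smul_eq_mul, mul_one]

/-- The span of the images of the homogeneous elements of degree at least `k`. -/
def fil (S : Type*) [CommRing S] [Algebra S R] (r : g →ₗ[ℝ] Matrix n n R) (h₀ : g) (k : ℤ) :
    Submodule S (Matrix n n R) :=
  Submodule.span S {X | ∃ j, k ≤ j ∧ ∃ v ∈ gr h₀ j, r v = X}

section Fil

variable {S : Type*} [CommRing S] [Algebra S R] {r : g →ₗ[ℝ] Matrix n n R} {h₀ : g}

theorem rep_mem_fil {j k : ℤ} (hk : k ≤ j) {v : g} (hv : v ∈ gr h₀ j) : r v ∈ fil S r h₀ k :=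
  Submodule.subset_span ⟨j, hk, v, hv, rfl⟩

theorem fil_antitone {j k : ℤ} (h : k ≤ j) : fil S r h₀ j ≤ fil S r h₀ k :=
  Submodule.span_mono fun _ ⟨i, hi, v, hv, e⟩ => ⟨i, h.trans hi, v, hv, e⟩

theorem fil_le_fil (k : ℤ) {X : Matrix n n R} (hX : X ∈ fil S r h₀ k) : X ∈ fil R r h₀ k := by
  induction hX using Submodule.span_induction with
  | mem X h => exact Submodule.subset_span h
  | zero => exact zero_mem _
  | add X Y _ _ hX hY => exact add_mem hX hY
  | smul c X _ hX =>
    rw [← algebraMap_smul R c X]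
    exact Submodule.smul_mem _ _ hX

/-- The span over a subalgebra `S` serves as book-keeping: its elements have all their coefficients
in `S`. This is how statements such as "generated by simple exponents" or "fixed by conjugation" are
transported through conjugations. -/
theorem coef_mem_of_mem_fil {ρ : g →ₗ[ℝ] Matrix n n ℝ} (hρ : IsFaithfulRep ρ)
    (S : Subalgebra ℝ R) (φ : g →ₗ[ℝ] ℝ) {k : ℤ} {X : Matrix n n R}
    (hX : X ∈ fil S (rep R ρ) h₀ k) : coef R ρ φ X ∈ S := by
  induction hX using Submodule.span_induction with
  | mem X h =>
    obtain ⟨j, -, v, -, rfl⟩ := h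
    rw [coef_rep hρ]
    exact S.algebraMap_mem _
  | zero => rw [map_zero]; exact zero_mem _
  | add X Y _ _ hX hY => rw [map_add]; exact add_mem hX hY
  | smul c X _ hX =>
    rw [← algebraMap_smul R c X, map_smul]
    exact S.mul_mem c.2 hX

theorem coef_killing_eq_zero_of_mem_fil {ρ : g →ₗ[ℝ] Matrix n n ℝ} (hρ : IsFaithfulRep ρ)
    {k l : ℤ} {y : g} (hy : y ∈ gr h₀ l) (hkl : 0 < k + l) {X : Matrix n n R}
    (hX : X ∈ fil R (rep R ρ) h₀ k) : coef R ρ (killingForm ℝ g y) X = 0 := by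
  induction hX using Submodule.span_induction with
  | mem X h =>
    obtain ⟨j, hj, v, hv, rfl⟩ := h
    rw [coef_rep hρ, killingForm_eq_zero_of_mem_gr hy hv (by omega), map_zero]
  | zero => rw [map_zero]
  | add X Y _ _ hX hY => rw [map_add, hX, hY, add_zero]
  | smul c X _ hX => rw [map_smul, hX, smul_zero]

/-- The group of matrices whose adjoint action is unipotent for the filtration. -/
def unip (r : g →ₗ[ℝ] Matrix n n R) (h₀ : g) : Subgroup (Matrix n n R)ˣ where
  carrier := {u | ∀ k, ∀ v ∈ gr h₀ k, (u : Matrix n n R) * r v * (u⁻¹ : (Matrix n n R)ˣ) - r v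
      ∈ fil R r h₀ (k + 1) ∧
    ((u⁻¹ : (Matrix n n R)ˣ) : Matrix n n R) * r v * u - r v ∈ fil R r h₀ (k + 1)}
  one_mem' k v hv := by simp
  inv_mem' hu k v hv := by
    have := hu k v hv
    rw [inv_inv]
    exact ⟨this.2, this.1⟩
  mul_mem' := by
    have key : ∀ (u w u' w' : Matrix n n R),
        (∀ k, ∀ v ∈ gr h₀ k, u * r v * u' - r v ∈ fil R r h₀ (k + 1)) →
        (∀ k, ∀ v ∈ gr h₀ k, w * r v * w' - r v ∈ fil R r h₀ (k + 1)) →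
        ∀ k, ∀ v ∈ gr h₀ k, (u * w) * r v * (w' * u') - r v ∈ fil R r h₀ (k + 1) := by
      intro u w u' w' hu hw k v hv
      -- Conjugation by `u` preserves each step of the filtration, so it may be applied to the error
      -- term of `w`.
      have hF : ∀ X ∈ fil R r h₀ (k + 1), u * X * u' ∈ fil R r h₀ (k + 1) := by
        intro X hX
        induction hX using Submodule.span_induction with
        | mem X h =>
          obtain ⟨j, hj, v, hv, rfl⟩ := h
          have := add_mem (fil_antitone (by omega) (hu j v hv)) (rep_mem_fil (S := R) (r := r) hj hv)
          rwa [sub_add_cancel] at this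
        | zero => simp
        | add X Y _ _ hX hY => rw [mul_add, add_mul]; exact add_mem hX hY
        | smul c X _ hX => rw [mul_smul_comm, smul_mul_assoc]; exact Submodule.smul_mem _ _ hX
      have e : (u * w) * r v * (w' * u') - r v = u * (w * r v * w' - r v) * u'
          + (u * r v * u' - r v) := by noncomm_ring
      rw [e]
      exact add_mem (hF _ (hw k v hv)) (hu k v hv)
    intro u w hu hw k v hv
    rw [mul_inv_rev, Units.val_mul, Units.val_mul]
    exact ⟨key _ _ _ _ (fun k v hv => (hu k v hv).1) (fun k v hv => (hw k v hv).1) k v hv,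
      key _ _ _ _ (fun k v hv => (hw k v hv).2) (fun k v hv => (hu k v hv).2) k v hv⟩

theorem unip_conj_sub_mem {u : (Matrix n n R)ˣ} (hu : u ∈ unip r h₀) {k : ℤ} {X : Matrix n n R}
    (hX : X ∈ fil R r h₀ k) :
    (u : Matrix n n R) * X * (u⁻¹ : (Matrix n n R)ˣ) - X ∈ fil R r h₀ (k + 1) := by
  induction hX using Submodule.span_induction with
  | mem X h =>
    obtain ⟨j, hj, v, hv, rfl⟩ := h
    exact fil_antitone (by omega) (hu j v hv).1
  | zero => simp
  | add X Y _ _ hX hY =>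
    rw [mul_add, add_mul, add_sub_add_comm]; exact add_mem hX hY
  | smul c X _ hX =>
    rw [mul_smul_comm, smul_mul_assoc, ← smul_sub]; exact Submodule.smul_mem _ _ hX

theorem unip_conj_mem {u : (Matrix n n R)ˣ} (hu : u ∈ unip r h₀) {k : ℤ} {X : Matrix n n R}
    (hX : X ∈ fil R r h₀ k) :
    (u : Matrix n n R) * X * (u⁻¹ : (Matrix n n R)ˣ) ∈ fil R r h₀ k := by
  have := add_mem (fil_antitone (by omega) (unip_conj_sub_mem hu hX)) hX
  rwa [sub_add_cancel] at this

end Fil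

/-! ### Exponentials with coefficients in `R` -/

variable {k : Type*} [CommRing k] [Algebra k R]

/-- `x` has the formal properties of `exp(a X)`. -/
structure IsExpElt (P : PoissonBracket k R) (r : g →ₗ[ℝ] Matrix n n R) (a : R) (X : g)
    (x : (Matrix n n R)ˣ) : Prop where
  deriv : ∀ f, (x : Matrix n n R).map (P.br f) = P.br f a • (r X * x)
  conj : ∀ (K : ℕ) (v : g), (LieAlgebra.ad ℝ g X ^ K) v = 0 →
    (x : Matrix n n R) * r v * (x⁻¹ : (Matrix n n R)ˣ) = ∑ j ∈ Finset.range K,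
      (algebraMap ℝ R (j.factorial : ℝ)⁻¹ * a ^ j) • r ((LieAlgebra.ad ℝ g X ^ j) v)
  eig : ∀ (c : ℝ) (v : g), ⁅X, v⁆ = c • v →
    ∃ u : R, (x : Matrix n n R) * r v = u • (r v * (x : Matrix n n R))
  tensor : ∀ Ω, Commute (inFirst (r X) + inSecond (r X)) Ω →
    Commute (inFirst (x : Matrix n n R) * inSecond (x : Matrix n n R)) Ω

section Exp

variable {P : PoissonBracket k R} {r : g →ₗ[ℝ] Matrix n n R} {a : R} {X h₀ : g}
  {x : (Matrix n n R)ˣ}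

theorem IsExpElt.conj_of_lie_eq_zero (hx : IsExpElt P r a X x) {v : g} (hv : ⁅X, v⁆ = 0) :
    (x : Matrix n n R) * r v * (x⁻¹ : (Matrix n n R)ˣ) = r v := by
  simpa using hx.conj 1 v (by simpa using hv)

theorem IsExpElt.conj_of_lie_lie_eq_zero (hx : IsExpElt P r a X x) {v : g}
    (hv : ⁅X, ⁅X, v⁆⁆ = 0) :
    (x : Matrix n n R) * r v * (x⁻¹ : (Matrix n n R)ˣ) = r v + a • r ⁅X, v⁆ := by
  simpa [Finset.sum_range_succ] using hx.conj 2 v (by simpa [pow_two] using hv)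

/-- After the constant and the linear term of `exp(a ad X)`, every term applies `ad X` at least
twice and so raises the degree by at least `2 l`. -/
theorem IsExpElt.conj_sub_sub_mem (hx : IsExpElt P r a X x)
    (hn : IsNilpotent (LieAlgebra.ad ℝ g X)) {l : ℤ} (hl : 1 ≤ l) (hX : X ∈ gr h₀ l) {i : ℤ}
    {v : g} (hv : v ∈ gr h₀ i) :
    (x : Matrix n n R) * r v * (x⁻¹ : (Matrix n n R)ˣ) - r v - a • r ⁅X, v⁆
      ∈ fil R r h₀ (i + 2 * l) := by
  obtain ⟨K, hK⟩ := hn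
  -- The series is cut at `K + 2` rather than `K` so that its first two terms can always be split
  -- off.
  rw [hx.conj (K + 2) v (by rw [pow_add, hK, zero_mul, LinearMap.zero_apply]), Finset.sum_range_succ',
    Finset.sum_range_succ']
  simp only [zero_add, pow_zero, pow_one, Nat.factorial, Nat.cast_one, inv_one, map_one, one_mul,
    one_smul, Module.End.one_apply, add_sub_cancel_right, LieAlgebra.ad_apply, mul_one]
  refine Submodule.sum_mem _ fun j _ => Submodule.smul_mem _ _ ?_
  refine rep_mem_fil ?_ (ad_pow_mem_gr hX hv _)
  push_cast
  nlinarith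

theorem IsExpElt.conj_sub_mem (hx : IsExpElt P r a X x)
    (hn : IsNilpotent (LieAlgebra.ad ℝ g X)) {l : ℤ} (hl : 1 ≤ l) (hX : X ∈ gr h₀ l) {i : ℤ}
    {v : g} (hv : v ∈ gr h₀ i) :
    (x : Matrix n n R) * r v * (x⁻¹ : (Matrix n n R)ˣ) - r v ∈ fil R r h₀ (i + l) := by
  have h := add_mem (fil_antitone (by omega) (hx.conj_sub_sub_mem hn hl hX hv))
    (Submodule.smul_mem _ a (rep_mem_fil (S := R) (r := r) (k := i + l) (by omega)
      (lie_mem_gr hX hv)))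
  rwa [sub_add_cancel] at h

theorem IsExpElt.conj_mem_of_mem (hx : IsExpElt P r a X x)
    (hn : IsNilpotent (LieAlgebra.ad ℝ g X)) {l : ℤ} (hl : 1 ≤ l) (hX : X ∈ gr h₀ l) {i : ℤ}
    {Y : Matrix n n R} (hY : Y ∈ fil R r h₀ i) :
    (x : Matrix n n R) * Y * (x⁻¹ : (Matrix n n R)ˣ) - Y ∈ fil R r h₀ (i + l) := by
  induction hY using Submodule.span_induction with
  | mem X h =>
    obtain ⟨j, hj, v, hv, rfl⟩ := h
    exact fil_antitone (by omega) (hx.conj_sub_mem hn hl hX hv)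
  | zero => simp
  | add X Y _ _ hX hY =>
    rw [mul_add, add_mul, add_sub_add_comm]; exact add_mem hX hY
  | smul c X _ hX =>
    rw [mul_smul_comm, smul_mul_assoc, ← smul_sub]; exact Submodule.smul_mem _ _ hX

/-- The coefficients of the exponential series are the `a ^ j / j!`, which stay in `S`. -/
theorem IsExpElt.conj_mem_subalgebra (hx : IsExpElt P r a X x)
    (hn : IsNilpotent (LieAlgebra.ad ℝ g X)) {l : ℤ} (hl : 1 ≤ l) (hX : X ∈ gr h₀ l)
    {S : Subalgebra ℝ R} (ha : a ∈ S) {i : ℤ} {v : g} (hv : v ∈ gr h₀ i) :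
    (x : Matrix n n R) * r v * (x⁻¹ : (Matrix n n R)ˣ) - r v ∈ fil S r h₀ (i + l) := by
  obtain ⟨K, hK⟩ := hn
  rw [hx.conj (K + 1) v (by rw [pow_succ, hK, zero_mul, LinearMap.zero_apply]),
    Finset.sum_range_succ']
  simp only [pow_zero, Nat.factorial, Nat.cast_one, inv_one, map_one, one_mul,
    one_smul, Module.End.one_apply, add_sub_cancel_right]
  refine Submodule.sum_mem _ fun j _ => ?_
  have h := Submodule.smul_mem (fil S r h₀ (i + l))
    (⟨algebraMap ℝ R (((j + 1).factorial : ℝ))⁻¹ * a ^ (j + 1),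
      S.mul_mem (S.algebraMap_mem _) (S.pow_mem ha _)⟩ : S)
    (rep_mem_fil (r := r) (S := S) (k := i + l) (by push_cast; nlinarith)
      (ad_pow_mem_gr hX hv (j + 1)))
  exact h

theorem IsExpElt.conj_mem_subalgebra_of_mem (hx : IsExpElt P r a X x)
    (hn : IsNilpotent (LieAlgebra.ad ℝ g X)) {l : ℤ} (hl : 1 ≤ l) (hX : X ∈ gr h₀ l)
    {S : Subalgebra ℝ R} (ha : a ∈ S) {i : ℤ} {Y : Matrix n n R} (hY : Y ∈ fil S r h₀ i) :
    (x : Matrix n n R) * Y * (x⁻¹ : (Matrix n n R)ˣ) ∈ fil S r h₀ i := by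
  induction hY using Submodule.span_induction with
  | mem X h =>
    obtain ⟨j, hj, v, hv, rfl⟩ := h
    have := add_mem (fil_antitone (by omega) (hx.conj_mem_subalgebra hn hl hX ha hv))
      (rep_mem_fil (r := r) (S := S) hj hv)
    rwa [sub_add_cancel] at this
  | zero => simp
  | add X Y _ _ hX hY =>
    rw [mul_add, add_mul]; exact add_mem hX hY
  | smul c X _ hX =>
    rw [mul_smul_comm, smul_mul_assoc]; exact Submodule.smul_mem _ _ hX

theorem mem_unip_of_isExpElt (hx : IsExpElt P r a X x) (hx' : IsExpElt P r (-a) X x⁻¹)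
    (hn : IsNilpotent (LieAlgebra.ad ℝ g X)) {l : ℤ} (hl : 1 ≤ l) (hX : X ∈ gr h₀ l) :
    x ∈ unip r h₀ := by
  intro i v hv
  refine ⟨fil_antitone (by omega) (hx.conj_sub_mem hn hl hX hv), ?_⟩
  have := hx'.conj_sub_mem hn hl hX hv
  rw [inv_inv] at this
  exact fil_antitone (by omega) this

end Exp

end Matrices

/-! ### Ordered products of exponentials -/

section Products

variable {g : Type*} [LieRing g] [LieAlgebra ℝ g] {n : Type*} [Fintype n] [DecidableEq n]
  {R : Type*} [CommRing R] [Algebra ℝ R] {k : Type*} [CommRing k] [Algebra k R]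

/-- The logarithmic derivative of an ordered product of exponentials, as a function of the
derivatives `d` of the exponents. -/
def logDeriv {K : Type*} (r : g →ₗ[ℝ] Matrix n n R) (X : K → g) (x : K → (Matrix n n R)ˣ)
    (d : K → R) : List K → Matrix n n R
  | [] => 0
  | i :: l => d i • r (X i) + (x i : Matrix n n R) * logDeriv r X x d l *
      ((x i)⁻¹ : (Matrix n n R)ˣ)

theorem logDeriv_sub {K : Type*} (r : g →ₗ[ℝ] Matrix n n R) (X : K → g) (x : K → (Matrix n n R)ˣ)
    (d d' : K → R) (l : List K) :
    logDeriv r X x (d - d') l = logDeriv r X x d l - logDeriv r X x d' l := by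
  induction l with
  | nil => simp [logDeriv]
  | cons i l ih => rw [logDeriv, logDeriv, logDeriv, ih, Pi.sub_apply, sub_smul]; noncomm_ring

theorem map_br_mul (P : PoissonBracket k R) (f : R) (X Y : Matrix n n R) :
    (X * Y).map (P.br f) = X.map (P.br f) * Y + X * Y.map (P.br f) := by
  ext i j
  simp only [Matrix.map_apply, Matrix.mul_apply, Matrix.add_apply, map_sum, P.leibniz,
    Finset.sum_add_distrib]

theorem PoissonBracket.br_one (P : PoissonBracket k R) (f : R) : P.br f 1 = 0 := by
  have h := P.leibniz f 1 1
  simpa using h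

theorem PoissonBracket.br_algebraMap (P : PoissonBracket k R) (f : R) (c : k) :
    P.br f (algebraMap k R c) = 0 := by
  rw [Algebra.algebraMap_eq_smul_one, map_smul, P.br_one, smul_zero]

theorem map_br_one (P : PoissonBracket k R) (f : R) : (1 : Matrix n n R).map (P.br f) = 0 := by
  ext i j
  by_cases h : i = j
  · simp [h, P.br_one]
  · simp [h]

theorem map_br_list_prod {P : PoissonBracket k R} {r : g →ₗ[ℝ] Matrix n n R} {K : Type*}
    {X : K → g} {a : K → R} {x : K → (Matrix n n R)ˣ}
    (hx : ∀ i, IsExpElt P r (a i) (X i) (x i)) (f : R) (l : List K) :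
    ((l.map x).prod : Matrix n n R).map (P.br f) =
      logDeriv r X x (fun i => P.br f (a i)) l * ((l.map x).prod : (Matrix n n R)ˣ) := by
  induction l with
  | nil => simp [logDeriv, map_br_one]
  | cons i l ih =>
    rw [List.map_cons, List.prod_cons, Units.val_mul, map_br_mul, ih, (hx i).deriv, logDeriv]
    rw [add_mul]
    congr 1
    · rw [smul_mul_assoc, smul_mul_assoc, mul_assoc]
    · simp only [mul_assoc, Units.inv_mul_cancel_left]

/-- If every `X i` is an eigenvector of `ad v`, then `ad (X i)` kills `v` in two steps and each
single conjugation is linear in the exponent. The commutator of `v` with the product is thereby the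
logarithmic derivative of the product for the scaling `a i ↦ χ i • a i`, which can be compared with
that of a Poisson derivation. -/
theorem rep_sub_conj_list_prod {P : PoissonBracket k R} {r : g →ₗ[ℝ] Matrix n n R} {K : Type*}
    {X : K → g} {a : K → R} {x : K → (Matrix n n R)ˣ}
    (hx : ∀ i, IsExpElt P r (a i) (X i) (x i)) {v : g} {χ : K → ℝ} (hv : ∀ i, ⁅v, X i⁆ = χ i • X i)
    (l : List K) :
    r v - ((l.map x).prod : (Matrix n n R)ˣ) * r v * (((l.map x).prod)⁻¹ : (Matrix n n R)ˣ) =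
      logDeriv r X x (fun i => χ i • a i) l := by
  induction l with
  | nil => simp [logDeriv]
  | cons i l ih =>
    have hl : ⁅X i, v⁆ = -(χ i • X i) := by rw [← lie_skew, hv]
    have h : (x i : Matrix n n R) * r v * ((x i)⁻¹ : (Matrix n n R)ˣ) =
        r v - (χ i • a i) • r (X i) := by
      rw [(hx i).conj_of_lie_lie_eq_zero (by rw [hl]; simp), hl, map_neg, map_smul]
      rw [smul_neg, ← sub_eq_add_neg, smul_assoc, smul_comm]
    rw [logDeriv, ← ih, List.map_cons, List.prod_cons, mul_inv_rev, Units.val_mul, Units.val_mul,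
      mul_sub, sub_mul, h]
    noncomm_ring

/-- A family of exponentials of nilpotent homogeneous elements of positive degree. -/
structure IsExpFamily {K : Type*} (P : PoissonBracket k R) (r : g →ₗ[ℝ] Matrix n n R) (h₀ : g)
    (X : K → g) (ht : K → ℤ) (a : K → R) (x : K → (Matrix n n R)ˣ) : Prop where
  exp : ∀ i, IsExpElt P r (a i) (X i) (x i)
  exp_inv : ∀ i, IsExpElt P r (-a i) (X i) (x i)⁻¹
  nilp : ∀ i, IsNilpotent (LieAlgebra.ad ℝ g (X i))
  pos : ∀ i, 1 ≤ ht i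
  mem : ∀ i, X i ∈ gr h₀ (ht i)

namespace IsExpFamily

variable {K : Type*} {P : PoissonBracket k R} {r : g →ₗ[ℝ] Matrix n n R} {h₀ : g}
    {X : K → g} {ht : K → ℤ} {a : K → R} {x : K → (Matrix n n R)ˣ}

theorem mem_unip (F : IsExpFamily P r h₀ X ht a x) (i : K) : x i ∈ unip r h₀ :=
  mem_unip_of_isExpElt (F.exp i) (F.exp_inv i) (F.nilp i) (F.pos i) (F.mem i)

theorem prod_mem_unip (F : IsExpFamily P r h₀ X ht a x) (l : List K) :
    (l.map x).prod ∈ unip r h₀ :=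
  Subgroup.list_prod_mem _ fun y hy => by
    obtain ⟨i, -, rfl⟩ := List.mem_map.1 hy
    exact F.mem_unip i

/-- The common core of all recursions on the height. Factors of height at most `h` contribute only
to `W`. Those of height `h + 1` contribute linearly, since their second-order terms and their
interaction with the others have degree at least `μ + h + 2`. Higher factors disappear in that
remainder. -/
theorem conj_prod_mem (F : IsExpFamily P r h₀ X ht a x) {h μ : ℤ} (hh : 0 ≤ h) {v : g}
    (hv : v ∈ gr h₀ μ) (W : AddSubgroup (Matrix n n R))
    (hW : ∀ w ∈ W, w ∈ fil R r h₀ (μ + 1))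
    (hv' : ∀ i, ht i ≤ h →
      (x i : Matrix n n R) * r v * ((x i)⁻¹ : (Matrix n n R)ˣ) - r v ∈ W)
    (hW' : ∀ i, ht i ≤ h → ∀ w ∈ W,
      (x i : Matrix n n R) * w * ((x i)⁻¹ : (Matrix n n R)ˣ) ∈ W)
    (l : List K) :
    ((l.map x).prod : (Matrix n n R)ˣ) * r v * (((l.map x).prod)⁻¹ : (Matrix n n R)ˣ) - r v
      - (l.map fun i => if ht i = h + 1 then a i • r ⁅X i, v⁆ else 0).sum
      ∈ W ⊔ (fil R r h₀ (μ + h + 2)).toAddSubgroup := by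
  set M := W ⊔ (fil R r h₀ (μ + h + 2)).toAddSubgroup
  have hfM : ∀ {y}, y ∈ fil R r h₀ (μ + h + 2) → y ∈ M :=
    fun hy => AddSubgroup.mem_sup_right (Submodule.mem_toAddSubgroup _ |>.2 hy)
  have hsum : ∀ l : List K, (l.map fun i => if ht i = h + 1 then a i • r ⁅X i, v⁆ else 0).sum
      ∈ fil R r h₀ (μ + h + 1) := by
    intro l
    refine list_sum_mem fun y hy => ?_
    obtain ⟨i, -, rfl⟩ := List.mem_map.1 hy
    split_ifs with hi
    · exact Submodule.smul_mem _ _ (rep_mem_fil (by omega) (lie_mem_gr (F.mem i) hv))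
    · exact zero_mem _
  induction l with
  | nil => simp
  | cons i l ih =>
    set q := (l.map x).prod
    set s := (l.map fun i => if ht i = h + 1 then a i • r ⁅X i, v⁆ else 0).sum
    have hM : ∀ w ∈ M, (x i : Matrix n n R) * w * ((x i)⁻¹ : (Matrix n n R)ˣ) ∈ M := by
      intro w hw
      obtain ⟨w₁, h₁, w₂, h₂, rfl⟩ := AddSubgroup.mem_sup.1 hw
      rw [mul_add, add_mul]
      refine add_mem ?_ (hfM (unip_conj_mem (F.mem_unip i) h₂))
      by_cases hi : ht i ≤ h
      · exact AddSubgroup.mem_sup_left (hW' i hi w₁ h₁)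
      -- A factor of height above `h` moves `W`, of degree at least `μ + 1`, only by terms of degree
      -- at least `μ + h + 2`.
      · have := (F.exp i).conj_mem_of_mem (F.nilp i) (F.pos i) (F.mem i) (hW w₁ h₁)
        have h3 := add_mem (hfM (fil_antitone (by omega) this)) (AddSubgroup.mem_sup_left h₁)
        rwa [sub_add_cancel] at h3
    have h1 : (x i : Matrix n n R) * r v * ((x i)⁻¹ : (Matrix n n R)ˣ) - r v -
        (if ht i = h + 1 then a i • r ⁅X i, v⁆ else 0) ∈ M := by
      split_ifs with hi
      · refine hfM (fil_antitone ?_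
          ((F.exp i).conj_sub_sub_mem (F.nilp i) (F.pos i) (F.mem i) hv))
        omega
      · rw [sub_zero]
        by_cases hi' : ht i ≤ h
        · exact AddSubgroup.mem_sup_left (hv' i hi')
        · refine hfM (fil_antitone ?_ ((F.exp i).conj_sub_mem (F.nilp i) (F.pos i) (F.mem i) hv))
          omega
    -- The linear terms already have degree at least `μ + h + 1`, so one more conjugation changes
    -- them within the remainder only.
    have h2 : (x i : Matrix n n R) * s * ((x i)⁻¹ : (Matrix n n R)ˣ) - s ∈ M :=
      hfM (fil_antitone (by omega) (unip_conj_sub_mem (F.mem_unip i) (hsum l)))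
    have h3 := add_mem (add_mem (hM _ ih) h1) h2
    rw [List.map_cons, List.prod_cons, mul_inv_rev, Units.val_mul, Units.val_mul, List.map_cons,
      List.sum_cons]
    convert h3 using 1
    noncomm_ring

theorem conj_prod_sub_sub_mem (F : IsExpFamily P r h₀ X ht a x) {μ : ℤ} {v : g}
    (hv : v ∈ gr h₀ μ) (l : List K) :
    ((l.map x).prod : (Matrix n n R)ˣ) * r v * (((l.map x).prod)⁻¹ : (Matrix n n R)ˣ) - r v
      - (l.map fun i => if ht i = 1 then a i • r ⁅X i, v⁆ else 0).sum
      ∈ fil R r h₀ (μ + 2) := by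
  have hp : ∀ i, ¬ ht i ≤ 0 := fun i => not_le.2 (lt_of_lt_of_le one_pos (F.pos i))
  have h := F.conj_prod_mem le_rfl hv ⊥ (by simp) (fun i hi => absurd hi (hp i))
    (fun i hi => absurd hi (hp i)) l
  rw [bot_sup_eq] at h
  simpa using h

/-- The form used in inductions: once the exponents up to height `h` lie in `S`, those of height `h
+ 1` are the only unknowns below degree `μ + h + 2`, and they enter linearly. -/
theorem conj_prod_mem_subalgebra (F : IsExpFamily P r h₀ X ht a x) {h μ : ℤ} (hh : 0 ≤ h) {v : g}
    (hv : v ∈ gr h₀ μ) (S : Subalgebra ℝ R) (ha : ∀ i, ht i ≤ h → a i ∈ S) (l : List K) :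
    ∃ w ∈ fil S r h₀ (μ + 1), ∃ y ∈ fil R r h₀ (μ + h + 2),
    ((l.map x).prod : (Matrix n n R)ˣ) * r v * (((l.map x).prod)⁻¹ : (Matrix n n R)ˣ) = r v
      + (l.map fun i => if ht i = h + 1 then a i • r ⁅X i, v⁆ else 0).sum + w + y := by
  have h := F.conj_prod_mem hh hv (fil S r h₀ (μ + 1)).toAddSubgroup
    (fun w hw => fil_le_fil _ hw)
    (fun i hi => fil_antitone (add_le_add_right (F.pos i) _)
      ((F.exp i).conj_mem_subalgebra (F.nilp i) (F.pos i) (F.mem i) (ha i hi) hv))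
    (fun i hi w hw =>
      (F.exp i).conj_mem_subalgebra_of_mem (F.nilp i) (F.pos i) (F.mem i) (ha i hi) hw) l
  obtain ⟨w, hw, y, hy, e⟩ := AddSubgroup.mem_sup.1 h
  refine ⟨w, hw, y, hy, ?_⟩
  rw [add_assoc, e]
  abel

/-- To leading degree the conjugations inside the logarithmic derivative act as the identity. -/
theorem logDeriv_sub_sum_mem (F : IsExpFamily P r h₀ X ht a x) {h : ℤ} {d : K → R}
    (hd : ∀ i, ht i < h → d i = 0) (l : List K) :
    logDeriv r X x d l - (l.map fun i => if ht i = h then d i • r (X i) else 0).sum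
      ∈ fil R r h₀ (h + 1) := by
  have hsum : ∀ l : List K, (l.map fun i => if ht i = h then d i • r (X i) else 0).sum
      ∈ fil R r h₀ h := by
    intro l
    refine list_sum_mem fun y hy => ?_
    obtain ⟨i, -, rfl⟩ := List.mem_map.1 hy
    split_ifs with hi
    · exact Submodule.smul_mem _ _ (rep_mem_fil hi.ge (F.mem i))
    · exact zero_mem _
  induction l with
  | nil => simp [logDeriv]
  | cons i l ih =>
    set s := (l.map fun i => if ht i = h then d i • r (X i) else 0).sum
    have h1 : d i • r (X i) - (if ht i = h then d i • r (X i) else 0) ∈ fil R r h₀ (h + 1) := by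
      split_ifs with hi
      · simp
      · rw [sub_zero]
        rcases lt_or_gt_of_ne hi with hi | hi
        · simp [hd i hi]
        · exact Submodule.smul_mem _ _ (rep_mem_fil (by omega) (F.mem i))
    have h2 := unip_conj_sub_mem (F.mem_unip i) (hsum l)
    have h3 := unip_conj_mem (F.mem_unip i) ih
    rw [logDeriv, List.map_cons, List.sum_cons]
    convert add_mem (add_mem h1 h2) h3 using 1
    noncomm_ring

/-- Factors of height above `h` affect the logarithmic derivative only in degrees above `h`; all
other contributions have coefficients in `S`. -/
theorem logDeriv_mem_subalgebra (F : IsExpFamily P r h₀ X ht a x) {h : ℤ} {d : K → R}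
    (S : Subalgebra ℝ R) (ha : ∀ i, ht i ≤ h → a i ∈ S) (hd : ∀ i, ht i ≤ h → d i ∈ S)
    (l : List K) :
    ∃ w ∈ fil S r h₀ 1, ∃ y ∈ fil R r h₀ (h + 1), logDeriv r X x d l = w + y := by
  induction l with
  | nil => exact ⟨0, zero_mem _, 0, zero_mem _, by simp [logDeriv]⟩
  | cons i l ih =>
    obtain ⟨w, hw, y, hy, e⟩ := ih
    have hy' := unip_conj_mem (F.mem_unip i) hy
    rw [logDeriv, e]
    by_cases hi : ht i ≤ h
    · refine ⟨d i • r (X i) + (x i : Matrix n n R) * w * ((x i)⁻¹ : (Matrix n n R)ˣ),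
        add_mem ?_ ((F.exp i).conj_mem_subalgebra_of_mem (F.nilp i) (F.pos i) (F.mem i)
          (ha i hi) hw), _, hy', by noncomm_ring⟩
      exact Submodule.smul_mem (fil S r h₀ 1) (⟨d i, hd i hi⟩ : S)
        (rep_mem_fil (F.pos i) (F.mem i))
    · have h1 := (F.exp i).conj_mem_of_mem (F.nilp i) (F.pos i) (F.mem i) (fil_le_fil _ hw)
      refine ⟨w, hw, d i • r (X i) +
        ((x i : Matrix n n R) * w * ((x i)⁻¹ : (Matrix n n R)ˣ) - w) +
          (x i : Matrix n n R) * y * ((x i)⁻¹ : (Matrix n n R)ˣ), ?_, by noncomm_ring⟩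
      exact add_mem (add_mem (Submodule.smul_mem _ _ (rep_mem_fil (by omega) (F.mem i)))
        (fil_antitone (by omega) h1)) hy'

end IsExpFamily

end Products

/-! ### The two tensor factors, and contraction of the first one. -/

section Legs

variable {n : Type*} [Fintype n] [DecidableEq n] {R : Type*} [CommRing R]

theorem inFirst_mul (X Y : Matrix n n R) : inFirst (X * Y) = inFirst X * inFirst Y := by
  rw [inFirst, inFirst, inFirst, ← Matrix.mul_kronecker_mul, one_mul]

theorem inSecond_mul (X Y : Matrix n n R) : inSecond (X * Y) = inSecond X * inSecond Y := by
  rw [inSecond, inSecond, inSecond, ← Matrix.mul_kronecker_mul, one_mul]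

theorem inFirst_mul_inSecond (X Y : Matrix n n R) : inFirst X * inSecond Y = X ⊗ₖ Y := by
  rw [inFirst, inSecond, ← Matrix.mul_kronecker_mul, one_mul, mul_one]

theorem inSecond_mul_inFirst (X Y : Matrix n n R) : inSecond Y * inFirst X = X ⊗ₖ Y := by
  rw [inFirst, inSecond, ← Matrix.mul_kronecker_mul, one_mul, mul_one]

theorem commute_inFirst_inSecond (X Y : Matrix n n R) : Commute (inFirst X) (inSecond Y) := by
  rw [Commute, SemiconjBy, inFirst_mul_inSecond, inSecond_mul_inFirst]

theorem inFirst_mul_kronecker (X Y Z : Matrix n n R) : inFirst X * (Y ⊗ₖ Z) = (X * Y) ⊗ₖ Z := by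
  rw [inFirst, ← Matrix.mul_kronecker_mul, one_mul]

theorem kronecker_mul_inFirst (X Y Z : Matrix n n R) : (Y ⊗ₖ Z) * inFirst X = (Y * X) ⊗ₖ Z := by
  rw [inFirst, ← Matrix.mul_kronecker_mul, mul_one]

theorem inSecond_mul_kronecker (X Y Z : Matrix n n R) : inSecond X * (Y ⊗ₖ Z) = Y ⊗ₖ (X * Z) := by
  rw [inSecond, ← Matrix.mul_kronecker_mul, one_mul]

theorem kronecker_mul_inSecond (X Y Z : Matrix n n R) : (Y ⊗ₖ Z) * inSecond X = Y ⊗ₖ (Z * X) := by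
  rw [inSecond, ← Matrix.mul_kronecker_mul, mul_one]

theorem sub_kronecker (X Y Z : Matrix n n R) : (X - Y) ⊗ₖ Z = X ⊗ₖ Z - Y ⊗ₖ Z := by
  ext
  simp [sub_mul]

theorem kronecker_sub (X Y Z : Matrix n n R) : Z ⊗ₖ (X - Y) = Z ⊗ₖ X - Z ⊗ₖ Y := by
  ext
  simp [mul_sub]

theorem inFirst_one : inFirst (1 : Matrix n n R) = 1 := Matrix.one_kronecker_one

theorem inSecond_one : inSecond (1 : Matrix n n R) = 1 := Matrix.one_kronecker_one

/-- `u ⊗ 1` as a unit. -/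
def unitFirst : (Matrix n n R)ˣ →* (Matrix (n × n) (n × n) R)ˣ :=
  Units.map { toFun := inFirst, map_one' := inFirst_one, map_mul' := inFirst_mul }

/-- `1 ⊗ u` as a unit. -/
def unitSecond : (Matrix n n R)ˣ →* (Matrix (n × n) (n × n) R)ˣ :=
  Units.map { toFun := inSecond, map_one' := inSecond_one, map_mul' := inSecond_mul }

theorem inFirst_mul_inv (u : (Matrix n n R)ˣ) :
    inFirst (u : Matrix n n R) * inFirst (u⁻¹ : (Matrix n n R)ˣ).val = 1 := by
  rw [← inFirst_mul, Units.mul_inv, inFirst_one]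

theorem inSecond_mul_inv (u : (Matrix n n R)ˣ) :
    inSecond (u : Matrix n n R) * inSecond (u⁻¹ : (Matrix n n R)ˣ).val = 1 := by
  rw [← inSecond_mul, Units.mul_inv, inSecond_one]

variable {g : Type*} [LieRing g] [LieAlgebra ℝ g] [Algebra ℝ R]

/-- The contraction of the first tensor factor with a linear form. -/
def legOne (R : Type*) [CommRing R] [Algebra ℝ R] (ρ : g →ₗ[ℝ] Matrix n n ℝ) (φ : g →ₗ[ℝ] ℝ) :
    Matrix (n × n) (n × n) R →ₗ[R] Matrix n n R where
  toFun T := Matrix.of fun c d => coef R ρ φ (Matrix.of fun a b => T (a, c) (b, d))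
  map_add' T T' := by
    ext c d
    simp only [Matrix.of_apply, Matrix.add_apply, ← map_add]
    rfl
  map_smul' z T := by
    ext c d
    simp only [Matrix.of_apply, Matrix.smul_apply, RingHom.id_apply, ← map_smul]
    rfl

theorem legOne_apply (ρ : g →ₗ[ℝ] Matrix n n ℝ) (φ : g →ₗ[ℝ] ℝ) (T : Matrix (n × n) (n × n) R)
    (c d : n) :
    legOne R ρ φ T c d = coef R ρ φ (Matrix.of fun a b => T (a, c) (b, d)) := rfl

theorem legOne_kronecker (ρ : g →ₗ[ℝ] Matrix n n ℝ) (φ : g →ₗ[ℝ] ℝ) (X Y : Matrix n n R) :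
    legOne R ρ φ (X ⊗ₖ Y) = coef R ρ φ X • Y := by
  ext c d
  rw [legOne_apply, Matrix.smul_apply, smul_eq_mul, mul_comm, ← smul_eq_mul, ← map_smul]
  congr 1
  ext a b
  simp [mul_comm]

theorem eq_sum_single_kronecker (T : Matrix (n × n) (n × n) R) :
    T = ∑ c, ∑ d, (Matrix.of fun a b => T (a, c) (b, d)) ⊗ₖ Matrix.single c d (1 : R) := by
  ext ⟨a, c⟩ ⟨b, d⟩
  simp [Matrix.sum_apply, Matrix.single_apply, ite_and]

theorem legOne_mul_inSecond (ρ : g →ₗ[ℝ] Matrix n n ℝ) (φ : g →ₗ[ℝ] ℝ)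
    (T : Matrix (n × n) (n × n) R) (Y : Matrix n n R) :
    legOne R ρ φ (T * inSecond Y) = legOne R ρ φ T * Y := by
  rw [eq_sum_single_kronecker T]
  simp only [Finset.sum_mul, map_sum, kronecker_mul_inSecond, legOne_kronecker, smul_mul_assoc]

theorem legOne_inSecond_mul (ρ : g →ₗ[ℝ] Matrix n n ℝ) (φ : g →ₗ[ℝ] ℝ)
    (T : Matrix (n × n) (n × n) R) (Y : Matrix n n R) :
    legOne R ρ φ (inSecond Y * T) = Y * legOne R ρ φ T := by
  rw [eq_sum_single_kronecker T]
  simp only [Finset.mul_sum, map_sum, inSecond_mul_kronecker, legOne_kronecker, mul_smul_comm]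

end Legs

/-! ### Dual bases and the invariant tensor -/

section Dual

variable {g : Type*} [LieRing g] [LieAlgebra ℝ g]

/-- Bases of homogeneous elements, dual to each other for the Killing form. -/
structure IsDualBasis {J : Type*} [Fintype J] (h₀ : g) (e e' : J → g) (deg : J → ℤ) : Prop where
  mem : ∀ j, e j ∈ gr h₀ (deg j)
  mem' : ∀ j, e' j ∈ gr h₀ (-deg j)
  sum_left : ∀ x, ∑ j, killingForm ℝ g x (e' j) • e j = x
  sum_right : ∀ x, ∑ j, killingForm ℝ g x (e j) • e' j = x

variable {n : Type*} [Fintype n] [DecidableEq n] {R : Type*} [CommRing R] [Algebra ℝ R]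
  {J : Type*} [Fintype J] {h₀ : g} {e e' : J → g} {deg : J → ℤ}

/-- The tensor `∑_j w(deg j) e_j ⊗ e'_j`. -/
def degTensor (r : g →ₗ[ℝ] Matrix n n R) (e e' : J → g) (deg : J → ℤ) (w : ℤ → ℝ) :
    Matrix (n × n) (n × n) R :=
  ∑ j, r (w (deg j) • e j) ⊗ₖ r (e' j)

theorem degTensor_add (r : g →ₗ[ℝ] Matrix n n R) (w w' : ℤ → ℝ) :
    degTensor r e e' deg (w + w') = degTensor r e e' deg w + degTensor r e e' deg w' := by
  simp only [degTensor, Pi.add_apply, add_smul, map_add, Matrix.add_kronecker,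
    Finset.sum_add_distrib]

theorem degTensor_neg (r : g →ₗ[ℝ] Matrix n n R) (w : ℤ → ℝ) :
    degTensor r e e' deg (-w) = -degTensor r e e' deg w := by
  rw [eq_neg_iff_add_eq_zero, ← degTensor_add]
  simp [degTensor]

/-- The weight of the Cartan part. -/
def wCartan (k : ℤ) : ℝ := if k = 0 then 1 else 0

/-- The weight of the `R`-matrix. -/
def wSign (k : ℤ) : ℝ := (Int.sign k : ℝ)

/-- The weight of the Casimir tensor. -/
def wOne (_ : ℤ) : ℝ := 1

/-- Contraction with `κ(y, ·)` turns the tensor back into an operator on 𝔤. The element `y` of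
degree `-m` pairs only with the basis elements of degree `m`, so the operator multiplies it by `w
m`. -/
theorem legOne_degTensor (hd : IsDualBasis h₀ e e' deg) {ρ : g →ₗ[ℝ] Matrix n n ℝ}
    (hρ : IsFaithfulRep ρ) {m : ℤ} {y : g} (hy : y ∈ gr h₀ (-m)) (w : ℤ → ℝ) :
    legOne R ρ (killingForm ℝ g y) (degTensor (rep R ρ) e e' deg w) = w m • rep R ρ y := by
  conv_rhs => rw [← hd.sum_right y]
  rw [degTensor, map_sum, map_sum, Finset.smul_sum]
  refine Finset.sum_congr rfl fun j _ => ?_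
  rw [legOne_kronecker, coef_rep hρ, map_smul, algebraMap_smul, map_smul, smul_eq_mul, smul_smul]
  by_cases h : deg j = m
  · rw [h]
  · rw [killingForm_eq_zero_of_mem_gr hy (hd.mem j) (by omega), mul_zero, mul_zero]

/-- Invariance of the Casimir tensor: expanded in the dual bases, the two halves of the commutator
cancel because `κ([x, a], b)` is antisymmetric in `a` and `b`. -/
theorem commute_degTensor_one (hd : IsDualBasis h₀ e e' deg) {ρ : g →ₗ[ℝ] Matrix n n ℝ}
    (hρ : IsFaithfulRep ρ) (x : g) :
    Commute (inFirst (rep R ρ x) + inSecond (rep R ρ x)) (degTensor (rep R ρ) e e' deg wOne) := by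
  set r := rep R ρ
  rw [Commute, SemiconjBy, ← sub_eq_zero]
  have h : (inFirst (r x) + inSecond (r x)) * degTensor r e e' deg wOne
      - degTensor r e e' deg wOne * (inFirst (r x) + inSecond (r x))
      = ∑ j, r ⁅x, e j⁆ ⊗ₖ r (e' j) + ∑ j, r (e j) ⊗ₖ r ⁅x, e' j⁆ := by
    simp only [degTensor, wOne, one_smul]
    rw [Finset.mul_sum, Finset.sum_mul, ← Finset.sum_sub_distrib, ← Finset.sum_add_distrib]
    refine Finset.sum_congr rfl fun j _ => ?_
    rw [add_mul, mul_add, inFirst_mul_kronecker, kronecker_mul_inFirst, inSecond_mul_kronecker,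
      kronecker_mul_inSecond, rep_lie hρ, rep_lie hρ, sub_kronecker, kronecker_sub]
    abel
  rw [h]
  have h1 : ∀ j, r ⁅x, e j⁆ = ∑ l, killingForm ℝ g ⁅x, e j⁆ (e' l) • r (e l) := fun j => by
    conv_lhs => rw [← hd.sum_left ⁅x, e j⁆]
    simp only [map_sum, map_smul]
  have h2 : ∀ j, r ⁅x, e' j⁆ = ∑ l, killingForm ℝ g ⁅x, e' j⁆ (e l) • r (e' l) := fun j => by
    conv_lhs => rw [← hd.sum_right ⁅x, e' j⁆]
    simp only [map_sum, map_smul]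
  have hk : ∀ (s : Finset J) (f : J → Matrix n n R) (Y : Matrix n n R),
      (∑ l ∈ s, f l) ⊗ₖ Y = ∑ l ∈ s, f l ⊗ₖ Y := fun s f Y => by
    ext ⟨a, c⟩ ⟨b, d⟩
    simp [Matrix.sum_apply, Finset.sum_mul]
  have hk' : ∀ (s : Finset J) (f : J → Matrix n n R) (Y : Matrix n n R),
      Y ⊗ₖ (∑ l ∈ s, f l) = ∑ l ∈ s, Y ⊗ₖ f l := fun s f Y => by
    ext ⟨a, c⟩ ⟨b, d⟩
    simp [Matrix.sum_apply, Finset.mul_sum]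
  simp only [h1, h2, hk, hk']
  rw [Finset.sum_comm, ← Finset.sum_add_distrib]
  refine Finset.sum_eq_zero fun l _ => ?_
  rw [← Finset.sum_add_distrib]
  refine Finset.sum_eq_zero fun j _ => ?_
  rw [Matrix.smul_kronecker, Matrix.kronecker_smul, ← add_smul]
  have : killingForm ℝ g ⁅x, e j⁆ (e' l) + killingForm ℝ g ⁅x, e' l⁆ (e j) = 0 := by
    rw [← lie_skew x (e j), map_neg, LinearMap.neg_apply, killingForm_lie_left,
      killingForm_symm _ (e j), neg_add_cancel]
  rw [this, zero_smul]

end Dual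

/-! ### Triangular products, and the Hamiltonian action of their simple exponents. -/

section Triangular

variable {g : Type*} [LieRing g] [LieAlgebra ℝ g]

/-- Positive root vectors `X`, with dual negative root vectors `Y`, of heights `ht`; the
simple roots are indexed by `s`. -/
structure IsTriangular {K ι : Type*} [DecidableEq K] (h₀ : g) (X Y : K → g) (ht : K → ℤ)
    (s : ι → K) : Prop where
  pos : ∀ i, 1 ≤ ht i
  mem_X : ∀ i, X i ∈ gr h₀ (ht i)
  mem_Y : ∀ i, Y i ∈ gr h₀ (-ht i)
  nilp : ∀ i, IsNilpotent (LieAlgebra.ad ℝ g (X i))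
  dual : ∀ i j, killingForm ℝ g (Y i) (X j) = if i = j then 1 else 0
  lie_X : ∀ h ∈ gr h₀ 0, ∀ i, ⁅h, X i⁆ = killingForm ℝ g h ⁅X i, Y i⁆ • X i
  lie_Y : ∀ h ∈ gr h₀ 0, ∀ i, ⁅h, Y i⁆ = -(killingForm ℝ g h ⁅X i, Y i⁆ • Y i)
  simple : ∀ i, ht i = 1 ↔ ∃ j, s j = i
  lower : ∀ i, ht i ≠ 1 → ∃ j l, ht l + 1 = ht i ∧ ∀ i', ht i' = ht i →
    (killingForm ℝ g (Y l) ⁅X i', Y (s j)⁆ ≠ 0 ↔ i' = i)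

namespace IsTriangular

variable {K ι : Type*} [DecidableEq K] {h₀ : g} {X Y : K → g} {ht : K → ℤ} {s : ι → K}

theorem h₀_mem : h₀ ∈ gr h₀ 0 := by simp [mem_gr]

theorem lie_mem_zero (T : IsTriangular h₀ X Y ht s) (i : K) : ⁅X i, Y i⁆ ∈ gr h₀ 0 := by
  have := lie_mem_gr (T.mem_X i) (T.mem_Y i)
  rwa [add_neg_cancel] at this

theorem lie_lie_eq_zero (T : IsTriangular h₀ X Y ht s) {h : g} (hh : h ∈ gr h₀ 0) (i : K) :
    ⁅h, ⁅X i, Y i⁆⁆ = 0 := by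
  rw [leibniz_lie, T.lie_X h hh, T.lie_Y h hh, lie_neg, smul_lie, lie_smul, add_neg_cancel]

end IsTriangular

variable {n : Type*} [Fintype n] [DecidableEq n] {R : Type*} [CommRing R] [Algebra ℝ R]
  {k : Type*} [Field k] [Algebra k R]
  {P : PoissonBracket k R} {ρ : g →ₗ[ℝ] Matrix n n ℝ} {N : ℕ} {ι : Type*}
  {h₀ : g} {X Y : Fin N → g} {ht : Fin N → ℤ} {s : ι → Fin N} {a : Fin N → R}
  {x : Fin N → (Matrix n n R)ˣ} {u : (Matrix n n R)ˣ}

/-- A product of exponentials `u = ∏ x_i` in the order of the indices. -/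
structure IsTriangularProduct (P : PoissonBracket k R) (ρ : g →ₗ[ℝ] Matrix n n ℝ) (h₀ : g)
    (X Y : Fin N → g) (ht : Fin N → ℤ) (s : ι → Fin N) (a : Fin N → R)
    (x : Fin N → (Matrix n n R)ˣ) (u : (Matrix n n R)ˣ) : Prop extends
    IsTriangular h₀ X Y ht s where
  faithful : IsFaithfulRep ρ
  exp : ∀ i, IsExpElt P (rep R ρ) (a i) (X i) (x i)
  exp_inv : ∀ i, IsExpElt P (rep R ρ) (-a i) (X i) (x i)⁻¹
  prod : u = (List.ofFn x).prod

theorem sum_map_finRange {M : Type*} [AddCommMonoid M] (f : Fin N → M) :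
    ((List.finRange N).map f).sum = ∑ i, f i := by
  rw [← List.ofFn_eq_map, List.sum_ofFn]

namespace IsTriangularProduct

variable (T : IsTriangularProduct P ρ h₀ X Y ht s a x u)

include T

theorem family : IsExpFamily P (rep R ρ) h₀ X ht a x :=
  ⟨T.exp, T.exp_inv, T.nilp, T.pos, T.mem_X⟩

theorem family_inv :
    IsExpFamily P (rep R ρ) h₀ X ht (fun i => -a i) (fun i => (x i)⁻¹) :=
  ⟨T.exp_inv, fun i => by rw [neg_neg, inv_inv]; exact T.exp i, T.nilp, T.pos, T.mem_X⟩

theorem eq_prod : u = ((List.finRange N).map x).prod := by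
  rw [T.prod, List.ofFn_eq_map]

theorem mem_unip : u ∈ unip (rep R ρ) h₀ := by
  rw [T.eq_prod]; exact T.family.prod_mem_unip _

theorem eq_prod_inv :
    u⁻¹ = (((List.finRange N).reverse).map fun i => (x i)⁻¹).prod := by
  rw [T.eq_prod, List.prod_inv_reverse, List.map_map, List.map_reverse]
  rfl

theorem map_br (f : R) : (u : Matrix n n R).map (P.br f) =
    logDeriv (rep R ρ) X x (fun i => P.br f (a i)) (List.finRange N) * u := by
  rw [T.eq_prod]
  exact map_br_list_prod T.exp f _

/-- When the derivatives of lower height vanish, the lowest part of the logarithmic derivative is `∑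
d j X j` over height `ht i`, and `Y i` picks out one summand. Everything higher pairs to zero with
`Y i`. -/
theorem coef_Y_logDeriv {d : Fin N → R} (i : Fin N) (hd : ∀ j, ht j < ht i → d j = 0) :
    coef R ρ (killingForm ℝ g (Y i))
      (logDeriv (rep R ρ) X x d (List.finRange N)) = d i := by
  have h := coef_killing_eq_zero_of_mem_fil T.faithful (T.mem_Y i) (by omega)
    (T.family.logDeriv_sub_sum_mem hd (List.finRange N))
  rw [map_sub, sub_eq_zero] at h
  rw [h, sum_map_finRange, map_sum, Finset.sum_eq_single i]
  · rw [if_pos rfl, map_smul, coef_rep T.faithful, T.dual, if_pos rfl, map_one, smul_eq_mul, mul_one]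
  · intro j _ hj
    split_ifs
    · rw [map_smul, coef_rep T.faithful, T.dual, if_neg hj.symm, map_zero, smul_zero]
    · rw [map_zero]
  · simp

/-- Induction on the height with `coef_Y_logDeriv`. In other words, the exponents are infinitesimal
coordinates on the group of triangular products. -/
theorem eq_zero_of_logDeriv_eq_zero {d : Fin N → R}
    (hd : logDeriv (rep R ρ) X x d (List.finRange N) = 0) (i : Fin N) :
    d i = 0 := by
  have key : ∀ m : ℕ, ∀ i, ht i = m → d i = 0 := by
    intro m
    induction m using Nat.strong_induction_on with
    | _ m ih =>
      intro i hi
      rw [← T.coef_Y_logDeriv i (d := d) fun j hj => ?_, hd, map_zero]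
      have := T.pos j
      exact ih (ht j).toNat (by omega) j (by omega)
  have := T.pos i
  exact key (ht i).toNat i (by omega)

theorem eq_of_logDeriv_eq {d d' : Fin N → R}
    (hd : logDeriv (rep R ρ) X x d (List.finRange N) =
      logDeriv (rep R ρ) X x d' (List.finRange N)) : d = d' := by
  funext i
  have := T.eq_zero_of_logDeriv_eq_zero (d := d - d') (by rw [logDeriv_sub, hd, sub_self]) i
  exact sub_eq_zero.1 this

theorem br_eq_zero_of_map_br {f : R} (h : (u : Matrix n n R).map (P.br f) = 0) (i : Fin N) :
    P.br f (a i) = 0 := by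
  rw [T.map_br] at h
  refine T.eq_zero_of_logDeriv_eq_zero (d := fun i => P.br f (a i)) ?_ i
  simpa using congrArg (· * ((u⁻¹ : (Matrix n n R)ˣ) : Matrix n n R)) h

/-- A derivation which acts on `u` as a commutator with a Cartan element acts diagonally on the
exponents. -/
theorem br_eq_smul {f : R} {c : k} {h : g} (hh : h ∈ gr h₀ 0)
    (hf : c • (u : Matrix n n R).map (P.br f) =
      rep R ρ h * u - u * rep R ρ h) (i : Fin N) :
    c • P.br f (a i) = killingForm ℝ g h ⁅X i, Y i⁆ • a i := by
  -- Both sides of `hf`, multiplied by `u⁻¹`, are logarithmic derivatives of the same product. Their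
  -- coefficients therefore agree.
  have h1 := rep_sub_conj_list_prod T.exp (v := h) (fun i => T.lie_X h hh i) (List.finRange N)
  rw [← T.eq_prod] at h1
  have h2 : logDeriv (rep R ρ) X x (fun i => c • P.br f (a i)) (List.finRange N) =
      c • logDeriv (rep R ρ) X x (fun i => P.br f (a i)) (List.finRange N) := by
    induction List.finRange N with
    | nil => simp [logDeriv]
    | cons j l ih => rw [logDeriv, logDeriv, ih, smul_add, smul_assoc]; simp
  have h3 := congrArg (· * ((u⁻¹ : (Matrix n n R)ˣ) : Matrix n n R)) hf
  simp only [T.map_br, ← smul_mul_assoc] at h3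
  rw [Units.mul_inv_cancel_right, ← h2, sub_mul, Units.mul_inv_cancel_right, h1] at h3
  exact congrFun (T.eq_of_logDeriv_eq h3) i

/-- The first components of the adjoint action. -/
theorem coef_simple_conj {j : ℤ} (hj : 0 ≤ j) {v : g} (hv : v ∈ gr h₀ j) (i : ι) :
    coef R ρ (killingForm ℝ g (Y (s i)))
      ((u : Matrix n n R) * rep R ρ v * (u⁻¹ : (Matrix n n R)ˣ)) =
    algebraMap ℝ R (killingForm ℝ g (Y (s i)) v)
      - algebraMap ℝ R (killingForm ℝ g ⁅X (s i), Y (s i)⁆ v) * a (s i) := by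
  have h1 : ht (s i) = 1 := (T.simple _).2 ⟨i, rfl⟩
  have h := coef_killing_eq_zero_of_mem_fil T.faithful (T.mem_Y (s i)) (by omega)
    (T.family.conj_prod_sub_sub_mem hv (List.finRange N))
  rw [← T.eq_prod, map_sub, map_sub, sub_sub, sub_eq_zero] at h
  rw [h, coef_rep T.faithful, sum_map_finRange, map_sum, sub_eq_add_neg]
  congr 1
  -- Only `j = 0` contributes: `Y (s i)` has degree `-1` and pairs with `[X l, v]` of degree `1 +
  -- j`. For `j > 0` the claimed value is zero as well, by degree.
  have hX : ∀ l, ht l = 1 → killingForm ℝ g (Y (s i)) ⁅X l, v⁆ =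
      if s i = l then -killingForm ℝ g ⁅X (s i), Y (s i)⁆ v else 0 := by
    intro l hl
    by_cases hj0 : j = 0
    · subst hj0
      rw [← lie_skew, T.lie_X v hv, map_neg, map_smul, T.dual, smul_eq_mul]
      split_ifs with e
      · rw [mul_one, e, killingForm_symm]
      · simp
    · rw [killingForm_eq_zero_of_mem_gr (T.mem_Y _) (lie_mem_gr (T.mem_X l) hv) (by omega)]
      rw [killingForm_eq_zero_of_mem_gr (T.lie_mem_zero (s i)) hv (by omega)]
      simp
  rw [Finset.sum_eq_single (s i)]
  · rw [if_pos h1, map_smul, coef_rep T.faithful, hX _ h1, if_pos rfl, smul_eq_mul, map_neg]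
    ring
  · intro l _ hl
    split_ifs with h2
    · rw [map_smul, coef_rep T.faithful, hX _ h2, if_neg hl.symm, map_zero, smul_zero]
    · rw [map_zero]
  · simp

variable {J : Type*} [Fintype J] {e e' : J → g} {deg : J → ℤ}

/-- In non-negative degrees, pairing with `Y (s i)` sees only the constant and the linear term of
the adjoint action. The contraction of the conjugated tensor is therefore known exactly, not just
modulo higher terms. -/
theorem legOne_conj_degTensor (hd : IsDualBasis h₀ e e' deg) (w : ℤ → ℝ)
    (hw : ∀ j, j < 0 → w j = 0) (i : ι) :
    legOne R ρ (killingForm ℝ g (Y (s i)))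
      (inFirst (u : Matrix n n R) * degTensor (rep R ρ) e e' deg w *
        inFirst ((u⁻¹ : (Matrix n n R)ˣ) : Matrix n n R)) =
    w 1 • rep R ρ (Y (s i))
      - a (s i) • w 0 • rep R ρ ⁅X (s i), Y (s i)⁆ := by
  have h1 : ht (s i) = 1 := (T.simple _).2 ⟨i, rfl⟩
  have hY := T.mem_Y (s i)
  rw [h1] at hY
  have ht0 := T.lie_mem_zero (s i)
  rw [← neg_zero] at ht0
  rw [← legOne_degTensor hd T.faithful hY w, ← legOne_degTensor hd T.faithful ht0 w]
  simp only [degTensor, Finset.mul_sum, Finset.sum_mul, map_sum, inFirst_mul_kronecker,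
    kronecker_mul_inFirst, legOne_kronecker, Finset.smul_sum]
  rw [← Finset.sum_sub_distrib]
  refine Finset.sum_congr rfl fun j _ => ?_
  by_cases hj : 0 ≤ deg j
  · rw [T.coef_simple_conj hj (Submodule.smul_mem _ _ (hd.mem j)), coef_rep T.faithful, coef_rep T.faithful,
      sub_smul, smul_smul, mul_comm (a (s i))]
  · rw [hw _ (not_le.1 hj)]
    simp

/-- The Hamiltonian action of the simple exponents. -/
theorem map_br_simple (hd : IsDualBasis h₀ e e' deg) {c : k}
    (hu : ∀ (Ω), Ω = degTensor (rep R ρ) e e' deg wOne →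
      Commute (inFirst (u : Matrix n n R) * inSecond (u : Matrix n n R)) Ω)
    (hb : tensorBracket P (u : Matrix n n R) u =
      c • (degTensor (rep R ρ) e e' deg wSign * (inFirst (u : Matrix n n R) *
          inSecond (u : Matrix n n R))
        - (inFirst (u : Matrix n n R) * inSecond (u : Matrix n n R)) *
          degTensor (rep R ρ) e e' deg wSign
        - inFirst (u : Matrix n n R) * degTensor (rep R ρ) e e' deg wCartan *
          inSecond (u : Matrix n n R)
        + inSecond (u : Matrix n n R) * degTensor (rep R ρ) e e' deg wCartan *
          inFirst (u : Matrix n n R))) (i : ι) :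
    (u : Matrix n n R).map (P.br (a (s i))) =
      c • ((2 : R) • (rep R ρ (Y (s i)) * u - u * rep R ρ (Y (s i)))
        + a (s i) • (u * rep R ρ ⁅X (s i), Y (s i)⁆ +
          rep R ρ ⁅X (s i), Y (s i)⁆ * u)) := by
  set r := rep R ρ
  set v : Matrix n n R := ((u⁻¹ : (Matrix n n R)ˣ) : Matrix n n R)
  set φ := killingForm ℝ g (Y (s i))
  set Hc := degTensor r e e' deg wCartan
  -- Adding the Casimir tensor does not change the commutator with `u₁u₂`. The sum has weight 2, 1,
  -- 0 in positive, zero and negative degree, so that its first leg has no negative part.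
  set Θ := degTensor r e e' deg (wSign + wOne) with hΘ
  have h1 : ht (s i) = 1 := (T.simple _).2 ⟨i, rfl⟩
  have hY := T.mem_Y (s i)
  rw [h1] at hY
  -- The first leg of `{u₁, u₂} u₁⁻¹` is a logarithmic derivative of `u`, whose coefficient at a
  -- simple root is the bracket with the simple exponent itself. The two signs from skew symmetry
  -- cancel.
  have hL : legOne R ρ φ (tensorBracket P (u : Matrix n n R) u * inFirst v) =
      (u : Matrix n n R).map (P.br (a (s i))) := by
    ext p q
    rw [legOne_apply]
    have : (Matrix.of fun a b => (tensorBracket P (u : Matrix n n R) u * inFirst v) (a, p) (b, q))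
        = -logDeriv r X x (fun i => P.br ((u : Matrix n n R) p q) (a i)) (List.finRange N) := by
      have h2 := congrArg (· * v) (T.map_br ((u : Matrix n n R) p q))
      simp only [v, Units.mul_inv_cancel_right] at h2
      rw [← h2, ← neg_mul]
      ext i j
      simp only [Matrix.of_apply, Matrix.mul_apply, Fintype.sum_prod_type, inFirst,
        Matrix.kroneckerMap_apply, tensorBracket, Matrix.neg_apply, Matrix.map_apply]
      refine Finset.sum_congr rfl fun l _ => ?_
      rw [Finset.sum_eq_single q]
      · rw [Matrix.one_apply_eq, mul_one, P.skew]
      · intro q' _ hq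
        rw [Matrix.one_apply_ne hq, mul_zero, mul_zero]
      · simp
    rw [this, map_neg, T.coef_Y_logDeriv (s i) fun j hj => absurd (T.pos j) (by omega),
      Matrix.map_apply, P.skew]
    simp
  have hc := commute_inFirst_inSecond (R := R) (n := n)
  have hv : inFirst (u : Matrix n n R) * inFirst v = 1 := inFirst_mul_inv u
  have hR : degTensor r e e' deg wSign = Θ - degTensor r e e' deg wOne := by
    rw [hΘ, degTensor_add, add_sub_cancel_right]
  have hΩ := hu _ rfl
  have hE : (degTensor r e e' deg wSign * (inFirst (u : Matrix n n R) * inSecond (u : Matrix n n R))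
        - (inFirst (u : Matrix n n R) * inSecond (u : Matrix n n R)) * degTensor r e e' deg wSign
        - inFirst (u : Matrix n n R) * Hc * inSecond (u : Matrix n n R)
        + inSecond (u : Matrix n n R) * Hc * inFirst (u : Matrix n n R)) * inFirst v
      = Θ * inSecond (u : Matrix n n R)
        - inSecond (u : Matrix n n R) * (inFirst (u : Matrix n n R) * Θ * inFirst v)
        - (inFirst (u : Matrix n n R) * Hc * inFirst v) * inSecond (u : Matrix n n R)
        + inSecond (u : Matrix n n R) * Hc := by
    have e1 : degTensor r e e' deg wSign *
        (inFirst (u : Matrix n n R) * inSecond (u : Matrix n n R))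
        - (inFirst (u : Matrix n n R) * inSecond (u : Matrix n n R)) * degTensor r e e' deg wSign
        = Θ * (inFirst (u : Matrix n n R) * inSecond (u : Matrix n n R))
        - (inFirst (u : Matrix n n R) * inSecond (u : Matrix n n R)) * Θ := by
      rw [hR, sub_mul, mul_sub, hΩ.eq]; abel
    rw [e1, (hc (u : Matrix n n R) (u : Matrix n n R)).eq]
    simp only [sub_mul, add_mul, mul_assoc, hv, mul_one, (hc v (u : Matrix n n R)).eq]
  rw [← hL, hb, smul_mul_assoc, hE]
  have hsm : ∀ Z, legOne R ρ φ (c • Z) = c • legOne R ρ φ Z := fun Z => by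
    rw [← algebraMap_smul R c Z, map_smul, algebraMap_smul]
  have hw : ∀ j : ℤ, j < 0 → (wSign + wOne) j = 0 := fun j hj => by
    simp [wSign, wOne, Int.sign_eq_neg_one_of_neg hj]
  have hw' : ∀ j : ℤ, j < 0 → wCartan j = 0 := fun j hj => by
    simp [wCartan, hj.ne]
  rw [hsm, map_add, map_sub, map_sub, legOne_mul_inSecond, legOne_inSecond_mul, legOne_mul_inSecond,
    legOne_inSecond_mul, T.legOne_conj_degTensor hd _ hw, T.legOne_conj_degTensor hd _ hw',
    legOne_degTensor hd T.faithful hY, legOne_degTensor hd T.faithful hY]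
  have w1 : (wSign + wOne) 1 = 2 := by norm_num [wSign, wOne]
  have w0 : (wSign + wOne) 0 = 1 := by norm_num [wSign, wOne]
  have w1' : wCartan 1 = 0 := by norm_num [wCartan]
  have w0' : wCartan 0 = 1 := by norm_num [wCartan]
  rw [w1, w0, w1', w0', two_smul R]
  simp only [two_smul, one_smul, zero_smul, mul_zero, zero_sub, add_zero]
  congr 1
  simp only [mul_sub, mul_add, add_mul, neg_mul, smul_add, mul_smul_comm, smul_mul_assoc]
  abel

end IsTriangularProduct

end Triangular

/-! ### Serre recursion, generation by simple exponents, and recovery of the exponents. -/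

section Charges

variable {g : Type*} [LieRing g] [LieAlgebra ℝ g]
  {n : Type*} [Fintype n] [DecidableEq n] {R : Type*} [CommRing R] [Algebra ℝ R]

/-- Invariance of the Killing form with coefficients in `R`. It is used with `[y, z] = 0`, when the
coefficient of the commutator vanishes. -/
theorem coef_commutator {ρ : g →ₗ[ℝ] Matrix n n ℝ} (hρ : IsFaithfulRep ρ) (y z : g) {h₀ : g}
    {j : ℤ} {Z : Matrix n n R} (hZ : Z ∈ fil R (rep R ρ) h₀ j) :
    coef R ρ (killingForm ℝ g y) (rep R ρ z * Z - Z * rep R ρ z) =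
      coef R ρ (killingForm ℝ g ⁅y, z⁆) Z := by
  induction hZ using Submodule.span_induction with
  | mem Z h =>
    obtain ⟨i, -, v, -, rfl⟩ := h
    rw [← rep_lie hρ, coef_rep hρ, coef_rep hρ, killingForm_lie_left]
  | zero => simp
  | add Z Z' _ _ h h' =>
    rw [mul_add, add_mul, add_sub_add_comm, map_add, h, h', map_add]
  | smul c Z _ h => rw [mul_smul_comm, smul_mul_assoc, ← smul_sub, map_smul, h, map_smul]

variable {k : Type*} [Field k] [Algebra k R] [Algebra ℝ k] [IsScalarTower ℝ k R]
  {P : PoissonBracket k R} {ρ : g →ₗ[ℝ] Matrix n n ℝ} {N : ℕ} {ι : Type*}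
  {h₀ : g} {X Y : Fin N → g} {ht : Fin N → ℤ} {s : ι → Fin N} {a : Fin N → R}
  {x : Fin N → (Matrix n n R)ˣ} {u : (Matrix n n R)ˣ}

theorem map_br_rep (P : PoissonBracket k R) (f : R) (z : g) :
    (rep R ρ z).map (P.br f) = 0 := by
  ext i j
  rw [rep_apply, Matrix.map_apply, Matrix.map_apply, IsScalarTower.algebraMap_apply ℝ k R,
    P.br_algebraMap, Matrix.zero_apply]

theorem map_br_inv (P : PoissonBracket k R) (f : R) (u : (Matrix n n R)ˣ) :
    ((u⁻¹ : (Matrix n n R)ˣ) : Matrix n n R).map (P.br f) =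
      -((u⁻¹ : (Matrix n n R)ˣ) * (u : Matrix n n R).map (P.br f) * (u⁻¹ : (Matrix n n R)ˣ)) := by
  have h := map_br_mul P f (u : Matrix n n R) ((u⁻¹ : (Matrix n n R)ˣ) : Matrix n n R)
  rw [Units.mul_inv, map_br_one] at h
  have h2 := congrArg (((u⁻¹ : (Matrix n n R)ˣ) : Matrix n n R) * ·) h
  simp only [mul_zero, mul_add, Units.inv_mul_cancel_left] at h2
  rw [eq_neg_iff_add_eq_zero, add_comm, mul_assoc]
  exact h2.symm

theorem coef_map_br (P : PoissonBracket k R) (f : R) (φ : g →ₗ[ℝ] ℝ) (Z : Matrix n n R) :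
    P.br f (coef R ρ φ Z) = coef R ρ φ (Z.map (P.br f)) := by
  simp only [coef, LinearMap.coe_mk, AddHom.coe_mk, map_sum, Matrix.map_apply, P.leibniz,
    IsScalarTower.algebraMap_apply ℝ k R, P.br_algebraMap, mul_zero, add_zero]

/-- The action of the `i`-th simple exponent on `u`. -/
def SimpleAction (P : PoissonBracket k R) (ρ : g →ₗ[ℝ] Matrix n n ℝ) (X Y : Fin N → g)
    (s : ι → Fin N) (a : Fin N → R) (u : (Matrix n n R)ˣ) (c : k) : Prop :=
  ∀ i, (u : Matrix n n R).map (P.br (a (s i))) =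
      c • ((2 : R) • (rep R ρ (Y (s i)) * u - u * rep R ρ (Y (s i)))
        + a (s i) • (u * rep R ρ ⁅X (s i), Y (s i)⁆ + rep R ρ ⁅X (s i), Y (s i)⁆ * u))

namespace IsTriangularProduct

/-- Raising `Y (s j)` from degree `-1` to degree 0 uses exactly one simple factor, and the Cartan
element `y` leaves only the factor of the same root. The order of the list is irrelevant to first
order; a permuted list covers the reversed product of inverses, that is `u⁻¹`. -/
theorem coef_conj_simple {x' : Fin N → (Matrix n n R)ˣ} {a' : Fin N → R}
    (T : IsTriangular h₀ X Y ht s) (hρ : IsFaithfulRep ρ)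
    (F : IsExpFamily P (rep R ρ) h₀ X ht a' x') {l : List (Fin N)}
    (hl : l.Perm (List.finRange N)) {y : g} (hy : y ∈ gr h₀ 0) (j : ι) :
    coef R ρ (killingForm ℝ g y) (((l.map x').prod : (Matrix n n R)ˣ) * rep R ρ (Y (s j)) *
      (((l.map x').prod)⁻¹ : (Matrix n n R)ˣ)) =
      killingForm ℝ g y ⁅X (s j), Y (s j)⁆ • a' (s j) := by
  have h1 : ht (s j) = 1 := (T.simple _).2 ⟨j, rfl⟩
  have hY := T.mem_Y (s j)
  have h := coef_killing_eq_zero_of_mem_fil hρ hy (by omega) (F.conj_prod_sub_sub_mem hY l)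
  rw [map_sub, map_sub, sub_sub, sub_eq_zero] at h
  rw [h, coef_rep hρ, killingForm_eq_zero_of_mem_gr hy hY (by omega), map_zero, zero_add,
    (hl.map _).sum_eq, sum_map_finRange, map_sum, Finset.sum_eq_single (s j)]
  · rw [if_pos h1, map_smul, coef_rep hρ, smul_eq_mul, mul_comm, Algebra.smul_def]
  · intro l _ hl
    split_ifs with h2
    · rw [map_smul, coef_rep hρ, ← killingForm_lie_left, T.lie_X y hy, map_smul,
        LinearMap.smul_apply, killingForm_symm (X l), T.dual, if_neg hl.symm, smul_zero, map_zero,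
        smul_zero]
    · rw [map_zero]
  · simp

/-- Since `[X i, h₀] = -(ht i) X i`, the coefficient of the conjugated `h₀` in direction `X i` is
`-(ht i) a' i` plus a constant and an expression in exponents of lower height. As `ht i ≠ 0`, the
exponents can be solved for one height after another. -/
theorem mem_of_coef_mem_of_perm {x' : Fin N → (Matrix n n R)ˣ} {a' : Fin N → R}
    (T : IsTriangular h₀ X Y ht s) (hρ : IsFaithfulRep ρ)
    (F : IsExpFamily P (rep R ρ) h₀ X ht a' x') {l : List (Fin N)}
    (hl : l.Perm (List.finRange N)) (S : Subalgebra ℝ R)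
    (hS : ∀ φ : g →ₗ[ℝ] ℝ, coef R ρ φ (((l.map x').prod : (Matrix n n R)ˣ) * rep R ρ h₀ *
      (((l.map x').prod)⁻¹ : (Matrix n n R)ˣ)) ∈ S) (i : Fin N) : a' i ∈ S := by
  have key : ∀ m : ℕ, ∀ i, ht i = m → a' i ∈ S := by
    intro m
    induction m using Nat.strong_induction_on with
    | _ m ih =>
      intro i hi
      have hi1 := T.pos i
      have ha : ∀ i', ht i' ≤ ht i - 1 → a' i' ∈ S := fun i' hi' =>
        have := T.pos i'
        ih (ht i').toNat (by omega) i' (by omega)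
      obtain ⟨w, hw, y, hy, e⟩ := F.conj_prod_mem_subalgebra (h := ht i - 1) (by omega)
          IsTriangular.h₀_mem S ha l
      have h := hS (killingForm ℝ g (Y i))
      have hX : ∀ i', ⁅X i', h₀⁆ = -((ht i' : ℝ) • X i') := fun i' => by
        rw [← lie_skew, mem_gr.1 (T.mem_X i')]
      rw [e, map_add, map_add, map_add,
          coef_killing_eq_zero_of_mem_fil hρ (T.mem_Y i) (by omega) hy, add_zero,
          coef_rep hρ, (hl.map _).sum_eq, sum_map_finRange, map_sum, Finset.sum_eq_single i,
          if_pos (by omega), hX, map_smul, coef_rep hρ, map_neg, map_smul, T.dual,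
          if_pos rfl] at h
      · have h' := sub_mem (sub_mem h (coef_mem_of_mem_fil hρ S (killingForm ℝ g (Y i)) hw))
          (S.algebraMap_mem (killingForm ℝ g (Y i) h₀))
        rw [add_sub_cancel_right, add_sub_cancel_left, smul_eq_mul, mul_comm, ← Algebra.smul_def,
          smul_eq_mul, mul_one] at h'
        have h2 := S.smul_mem h' (-(ht i : ℝ))⁻¹
        rwa [smul_smul, inv_mul_cancel₀, one_smul] at h2
        simp only [ne_eq, neg_eq_zero, Int.cast_eq_zero]
        omega
      · intro i' _ hne
        split_ifs
        · rw [map_smul, hX, coef_rep hρ, map_neg, map_smul, T.dual, if_neg hne.symm,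
            smul_zero, neg_zero, map_zero, smul_zero]
        · rw [map_zero]
      · simp
  have := T.pos i
  exact key (ht i).toNat i (by omega)

variable (T : IsTriangularProduct P ρ h₀ X Y ht s a x u)

include T

theorem coef_conj_Y {y : g} (hy : y ∈ gr h₀ 0) (j : ι) :
    coef R ρ (killingForm ℝ g y) ((u : Matrix n n R) * rep R ρ (Y (s j)) *
      (u⁻¹ : (Matrix n n R)ˣ)) = killingForm ℝ g y ⁅X (s j), Y (s j)⁆ • a (s j) := by
  have := coef_conj_simple T.toIsTriangular T.faithful T.family (List.Perm.refl _) hy j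
  rwa [← T.eq_prod] at this

theorem coef_conj_inv_Y {y : g} (hy : y ∈ gr h₀ 0) (j : ι) :
    coef R ρ (killingForm ℝ g y) (((u⁻¹ : (Matrix n n R)ˣ) : Matrix n n R) * rep R ρ (Y (s j)) * u)
      = -(killingForm ℝ g y ⁅X (s j), Y (s j)⁆ • a (s j)) := by
  have := coef_conj_simple T.toIsTriangular T.faithful T.family_inv (List.reverse_perm _) hy j
  rwa [← T.eq_prod_inv, inv_inv, smul_neg] at this

variable {c : k} (hB : SimpleAction P ρ X Y s a u c)

include hB

/-- The bracket with `a (s i)` acts on `u η u⁻¹` as the commutator with `{a, u} u⁻¹`. The parts `Y`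
and `t` that are not conjugated by `u` are invisible to `κ(y, ·)`, because `y` commutes with both.
The conjugated parts become the brackets of `Y` and `t` with `η` inside the conjugation. -/
theorem br_simple_coef_conj {y : g} (hy : y ∈ gr h₀ 0) {i : ι}
    (hyi : killingForm ℝ g y ⁅X (s i), Y (s i)⁆ = 0) {j : ℤ} {η : g} (hη : η ∈ gr h₀ j) {lam : ℝ}
    (hlam : ⁅⁅X (s i), Y (s i)⁆, η⁆ = -(lam • η)) :
    P.br (a (s i)) (coef R ρ (killingForm ℝ g y)
      ((u : Matrix n n R) * rep R ρ η * (u⁻¹ : (Matrix n n R)ˣ))) =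
    c • (-(2 * coef R ρ (killingForm ℝ g y)
        ((u : Matrix n n R) * rep R ρ ⁅Y (s i), η⁆ * (u⁻¹ : (Matrix n n R)ˣ)))
      - lam • (a (s i) * coef R ρ (killingForm ℝ g y)
        ((u : Matrix n n R) * rep R ρ η * (u⁻¹ : (Matrix n n R)ˣ)))) := by
  have hC : (u : Matrix n n R) * rep R ρ η * (u⁻¹ : (Matrix n n R)ˣ) ∈ fil R (rep R ρ) h₀ j :=
    unip_conj_mem T.mem_unip (rep_mem_fil le_rfl hη)
  have hF : ⁅y, Y (s i)⁆ = 0 := by rw [T.lie_Y y hy, hyi, zero_smul, neg_zero]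
  have ht : ⁅y, ⁅X (s i), Y (s i)⁆⁆ = 0 := T.lie_lie_eq_zero hy _
  have hF' := coef_commutator T.faithful y (Y (s i)) hC
  have ht' := coef_commutator T.faithful y ⁅X (s i), Y (s i)⁆ hC
  rw [hF, map_zero] at hF'
  rw [ht, map_zero] at ht'
  have h0 : coef R ρ (0 : g →ₗ[ℝ] ℝ) = 0 := by ext; simp [coef]
  rw [h0, LinearMap.zero_apply] at hF' ht'
  rw [coef_map_br, map_br_mul, map_br_mul, map_br_rep, map_br_inv, hB i]
  have e1 := rep_lie (R := R) T.faithful (Y (s i)) η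
  have e2 := rep_lie (R := R) T.faithful ⁅X (s i), Y (s i)⁆ η
  rw [hlam, map_neg, map_smul] at e2
  set F := rep R ρ (Y (s i))
  set t := rep R ρ ⁅X (s i), Y (s i)⁆
  set C := rep R ρ η
  set v : Matrix n n R := ((u⁻¹ : (Matrix n n R)ˣ) : Matrix n n R) with hv
  have hvu : ∀ Z, v * ((u : Matrix n n R) * Z) = Z := fun Z => Units.inv_mul_cancel_left _ _
  have huv : (u : Matrix n n R) * v = 1 := Units.mul_inv _
  have key : (c • ((2 : R) • (F * u - u * F) + a (s i) • (u * t + t * u)) * C + u * 0) * v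
      + u * C * -(v * (c • ((2 : R) • (F * u - u * F) + a (s i) • (u * t + t * u))) * v) =
      c • ((2 : R) • ((F * (u * C * v) - u * C * v * F) - u * (F * C - C * F) * v) +
        a (s i) • ((t * (u * C * v) - u * C * v * t) + u * (t * C - C * t) * v)) := by
    simp only [smul_mul_assoc, mul_smul_comm, mul_neg, ← smul_neg, add_mul, mul_add, sub_mul,
      mul_sub, mul_assoc, hvu, huv, mul_one, mul_zero, add_zero, ← smul_add]
    congr 1
    rw [neg_add, add_add_add_comm, ← smul_neg, ← smul_neg, ← smul_add, ← smul_add]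
    congr 2 <;> abel
  rw [key, ← e1, ← e2]
  have hsm : ∀ Z, coef R ρ (killingForm ℝ g y) (c • Z) = c • coef R ρ (killingForm ℝ g y) Z :=
    fun Z => by rw [← algebraMap_smul R c Z, map_smul, algebraMap_smul]
  rw [hsm, map_add, map_smul, map_smul, map_sub, map_add, hF', ht']
  congr 1
  rw [mul_neg, neg_mul, mul_smul_comm, smul_mul_assoc, map_neg,
    ← algebraMap_smul R lam (_ * _ * _), map_smul, algebraMap_smul]
  simp only [smul_eq_mul, zero_sub, zero_add, mul_neg, mul_smul_comm]
  abel

/-- The same computation with `u⁻¹{a, u}`. The term with `Y` keeps its sign while the quadratic term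
changes sign; this is what turns left-nested q-brackets into right-nested ones. -/
theorem br_simple_coef_conj_inv {y : g} (hy : y ∈ gr h₀ 0) {i : ι}
    (hyi : killingForm ℝ g y ⁅X (s i), Y (s i)⁆ = 0) {j : ℤ} {η : g} (hη : η ∈ gr h₀ j) {lam : ℝ}
    (hlam : ⁅⁅X (s i), Y (s i)⁆, η⁆ = -(lam • η)) :
    P.br (a (s i)) (coef R ρ (killingForm ℝ g y)
      (((u⁻¹ : (Matrix n n R)ˣ) : Matrix n n R) * rep R ρ η * u)) =
    c • (-(2 * coef R ρ (killingForm ℝ g y)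
        (((u⁻¹ : (Matrix n n R)ˣ) : Matrix n n R) * rep R ρ ⁅Y (s i), η⁆ * u))
      + lam • (a (s i) * coef R ρ (killingForm ℝ g y)
        (((u⁻¹ : (Matrix n n R)ˣ) : Matrix n n R) * rep R ρ η * u))) := by
  have hC : ((u⁻¹ : (Matrix n n R)ˣ) : Matrix n n R) * rep R ρ η * u ∈ fil R (rep R ρ) h₀ j := by
    have := unip_conj_mem (inv_mem T.mem_unip) (rep_mem_fil (S := R) (r := rep R ρ) le_rfl hη)
    rwa [inv_inv] at this
  have hF : ⁅y, Y (s i)⁆ = 0 := by rw [T.lie_Y y hy, hyi, zero_smul, neg_zero]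
  have ht : ⁅y, ⁅X (s i), Y (s i)⁆⁆ = 0 := T.lie_lie_eq_zero hy _
  have hF' := coef_commutator T.faithful y (Y (s i)) hC
  have ht' := coef_commutator T.faithful y ⁅X (s i), Y (s i)⁆ hC
  rw [hF, map_zero] at hF'
  rw [ht, map_zero] at ht'
  have h0 : coef R ρ (0 : g →ₗ[ℝ] ℝ) = 0 := by ext; simp [coef]
  rw [h0, LinearMap.zero_apply] at hF' ht'
  rw [coef_map_br, map_br_mul, map_br_mul, map_br_rep, map_br_inv, hB i]
  have e1 := rep_lie (R := R) T.faithful (Y (s i)) η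
  have e2 := rep_lie (R := R) T.faithful ⁅X (s i), Y (s i)⁆ η
  rw [hlam, map_neg, map_smul] at e2
  set F := rep R ρ (Y (s i))
  set t := rep R ρ ⁅X (s i), Y (s i)⁆
  set C := rep R ρ η
  set v : Matrix n n R := ((u⁻¹ : (Matrix n n R)ˣ) : Matrix n n R) with hv
  have hvu : ∀ Z, v * ((u : Matrix n n R) * Z) = Z := fun Z => Units.inv_mul_cancel_left _ _
  have huv : ∀ Z, (u : Matrix n n R) * (v * Z) = Z := fun Z => Units.mul_inv_cancel_left _ _
  have key : (-(v * (c • ((2 : R) • (F * u - u * F) + a (s i) • (u * t + t * u))) * v) * C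
      + v * 0) * u + v * C * (c • ((2 : R) • (F * u - u * F) + a (s i) • (u * t + t * u))) =
      c • ((2 : R) • ((F * (v * C * u) - v * C * u * F) - v * (F * C - C * F) * u) +
        a (s i) • (-(t * (v * C * u) - v * C * u * t) - v * (t * C - C * t) * u)) := by
    simp only [smul_mul_assoc, mul_smul_comm, mul_neg, neg_mul, ← smul_neg, add_mul, mul_add,
      sub_mul, mul_sub, mul_assoc, hvu, huv, mul_one, mul_zero, zero_mul, add_zero, ← smul_add]
    congr 1
    rw [neg_add, add_add_add_comm, ← smul_neg, ← smul_neg, ← smul_add, ← smul_add]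
    congr 2 <;> abel
  rw [key, ← e1, ← e2]
  have hsm : ∀ Z, coef R ρ (killingForm ℝ g y) (c • Z) = c • coef R ρ (killingForm ℝ g y) Z :=
    fun Z => by rw [← algebraMap_smul R c Z, map_smul, algebraMap_smul]
  have hs : ∀ Z W : Matrix n n R, coef R ρ (killingForm ℝ g y) (Z - W) =
      coef R ρ (killingForm ℝ g y) Z - coef R ρ (killingForm ℝ g y) W := map_sub _
  rw [hsm, map_add, map_smul, map_smul, hs (F * _ - _), hs (-_), map_neg, hF', ht']
  congr 1
  rw [mul_neg, neg_mul, mul_smul_comm, smul_mul_assoc, map_neg,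
    ← algebraMap_smul R lam (_ * _ * _), map_smul, algebraMap_smul]
  simp only [smul_eq_mul, zero_sub, neg_zero, neg_neg, mul_neg, mul_smul_comm]

/-- The exponents are generated by the simple ones. -/
theorem mem_of_simple_mem (hc : c ≠ 0) (S : Subalgebra k R)
    (hS : ∀ f ∈ S, ∀ h ∈ S, P.br f h ∈ S) (hs : ∀ i, a (s i) ∈ S) (i : Fin N) : a i ∈ S := by
  have key : ∀ m : ℕ, ∀ i, ht i = m → a i ∈ S := by
    intro m
    induction m using Nat.strong_induction_on with
    | _ m ih =>
      intro i hi
      by_cases h1 : ht i = 1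
      · obtain ⟨j, rfl⟩ := (T.simple i).1 h1
        exact hs j
      -- The root of `i` is the sum of the root of `l` and the simple root of `j`. The equation `hB
      -- j`, multiplied by `u⁻¹`, is paired with `Y l`; in the three memberships below the cutoffs
      -- are chosen so that the remainders have degree above `ht l` and drop out.
      obtain ⟨j, l, hl, hN⟩ := T.lower i h1
      have ha : ∀ i', ht i' ≤ ht l → a i' ∈ S.restrictScalars ℝ := fun i' hi' =>
        have := T.pos i'
        ih (ht i').toNat (by omega) i' (by omega)
      have hl1 := T.pos l
      have hj : ht (s j) = 1 := (T.simple _).2 ⟨j, rfl⟩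
      set φ := killingForm ℝ g (Y l) with hφ
      have h2 : coef R ρ φ (logDeriv (rep R ρ) X x (fun i => P.br (a (s j)) (a i))
          (List.finRange N)) ∈ S.restrictScalars ℝ := by
        obtain ⟨w, hw, y, hy, e⟩ := T.family.logDeriv_mem_subalgebra (S.restrictScalars ℝ) ha
          (fun i' hi' => hS _ (hs j) _ (ha i' hi')) (List.finRange N)
        rw [e, map_add, hφ, coef_killing_eq_zero_of_mem_fil T.faithful (T.mem_Y l) (by omega) hy,
          add_zero]
        exact coef_mem_of_mem_fil T.faithful _ _ hw
      have h3 : coef R ρ φ ((u : Matrix n n R) * rep R ρ ⁅X (s j), Y (s j)⁆ *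
          (u⁻¹ : (Matrix n n R)ˣ)) ∈ S.restrictScalars ℝ := by
        obtain ⟨w, hw, y, hy, e⟩ := T.family.conj_prod_mem_subalgebra (h := ht l - 1) (by omega)
          (T.lie_mem_zero (s j)) (S.restrictScalars ℝ) (fun i' hi' => ha i' (by omega))
          (List.finRange N)
        rw [T.eq_prod, e, map_add, map_add, map_add, hφ,
          coef_killing_eq_zero_of_mem_fil T.faithful (T.mem_Y l) (by omega) hy, add_zero,
          coef_rep T.faithful, sum_map_finRange, map_sum]
        refine add_mem (add_mem (Subalgebra.algebraMap_mem _ _) (sum_mem fun i' _ => ?_))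
          (coef_mem_of_mem_fil T.faithful _ _ hw)
        split_ifs with hi'
        · rw [map_smul, coef_rep T.faithful, smul_eq_mul]
          exact mul_mem (ha i' (by omega)) (Subalgebra.algebraMap_mem _ _)
        · rw [map_zero]; exact zero_mem _
      -- The only place where exponents of height `ht l + 1 = ht i` occur. By `hN` only the one with
      -- index `i` pairs non-trivially with `Y l`.
      have h4 : coef R ρ φ ((u : Matrix n n R) * rep R ρ (Y (s j)) * (u⁻¹ : (Matrix n n R)ˣ))
          - killingForm ℝ g (Y l) ⁅X i, Y (s j)⁆ • a i ∈ S.restrictScalars ℝ := by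
        obtain ⟨w, hw, y, hy, e⟩ := T.family.conj_prod_mem_subalgebra (h := ht l) (by omega)
          (T.mem_Y (s j)) (S.restrictScalars ℝ) ha (List.finRange N)
        rw [T.eq_prod, e, map_add, map_add, map_add, hφ,
          coef_killing_eq_zero_of_mem_fil T.faithful (T.mem_Y l) (by omega) hy, add_zero,
          coef_rep T.faithful, sum_map_finRange, map_sum, Finset.sum_eq_single i]
        · rw [if_pos hl.symm, map_smul, coef_rep T.faithful, smul_eq_mul, Algebra.smul_def,
            mul_comm (a i)]
          have : ∀ p q r : R, p + q + r - q = p + r := fun p q r => by ring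
          rw [this]
          exact add_mem (Subalgebra.algebraMap_mem _ _) (coef_mem_of_mem_fil T.faithful _ _ hw)
        · intro i' _ hne
          split_ifs with hi'
          · have : killingForm ℝ g (Y l) ⁅X i', Y (s j)⁆ = 0 := by
              by_contra h
              exact hne ((hN i' (by omega)).1 h)
            rw [map_smul, coef_rep T.faithful, this, map_zero, smul_zero]
          · rw [map_zero]
        · simp
      have h5 := congrArg (· * ((u⁻¹ : (Matrix n n R)ˣ) : Matrix n n R)) (hB j)
      simp only [T.map_br] at h5
      rw [Units.mul_inv_cancel_right, smul_mul_assoc, add_mul, smul_mul_assoc, smul_mul_assoc,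
        sub_mul, add_mul, Units.mul_inv_cancel_right, Units.mul_inv_cancel_right] at h5
      have h6 := congrArg (fun Z => coef R ρ φ (c⁻¹ • Z)) h5
      have hsm : ∀ Z, coef R ρ φ (c⁻¹ • Z) = c⁻¹ • coef R ρ φ Z :=
        fun Z => by rw [← algebraMap_smul R c⁻¹ Z, map_smul, algebraMap_smul]
      simp only [smul_smul, inv_mul_cancel₀ hc, one_smul, hsm, map_add, map_smul, map_sub,
        coef_rep T.faithful] at h6
      -- Solving the paired equation for the linear term in `a i`; its coefficient is a non-zero
      -- real number.
      have h7 : (2 : R) * (killingForm ℝ g (Y l) ⁅X i, Y (s j)⁆ • a i) ∈ S.restrictScalars ℝ := by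
        have h8 : c⁻¹ • coef R ρ φ (logDeriv (rep R ρ) X x (fun i => P.br (a (s j)) (a i))
            (List.finRange N)) ∈ S.restrictScalars ℝ := S.smul_mem h2 c⁻¹
        have h9 : (2 : R) ∈ S.restrictScalars ℝ := by
          have := (S.restrictScalars ℝ).algebraMap_mem 2
          rwa [map_ofNat] at this
        have e : (2 : R) * (killingForm ℝ g (Y l) ⁅X i, Y (s j)⁆ • a i) =
            (2 : R) * algebraMap ℝ R (φ (Y (s j))) - (2 : R) * (coef R ρ φ
              ((u : Matrix n n R) * rep R ρ (Y (s j)) * (u⁻¹ : (Matrix n n R)ˣ))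
              - killingForm ℝ g (Y l) ⁅X i, Y (s j)⁆ • a i) + a (s j) * (coef R ρ φ
              ((u : Matrix n n R) * rep R ρ ⁅X (s j), Y (s j)⁆ * (u⁻¹ : (Matrix n n R)ˣ))
              + algebraMap ℝ R (φ ⁅X (s j), Y (s j)⁆))
            - c⁻¹ • coef R ρ φ (logDeriv (rep R ρ) X x (fun i => P.br (a (s j)) (a i))
            (List.finRange N)) := by
          rw [h6]
          simp only [smul_eq_mul]
          ring
        rw [e]
        exact sub_mem (add_mem (sub_mem (mul_mem h9 (Subalgebra.algebraMap_mem _ _))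
          (mul_mem h9 h4)) (mul_mem (hs j) (add_mem h3 (Subalgebra.algebraMap_mem _ _)))) h8
      have h8 : killingForm ℝ g (Y l) ⁅X i, Y (s j)⁆ ≠ 0 := (hN i rfl).2 rfl
      have h10 := (S.restrictScalars ℝ).smul_mem h7
        (2 * killingForm ℝ g (Y l) ⁅X i, Y (s j)⁆)⁻¹
      rw [← map_ofNat (algebraMap ℝ R) 2, ← Algebra.smul_def, smul_smul, smul_smul,
        mul_assoc, inv_mul_cancel₀ (by simpa using h8), one_smul] at h10
      exact h10
  have := T.pos i
  exact key (ht i).toNat i (by omega)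

omit hB in
/-- If the adjoint action of `u` on the grading element has coefficients in `S`, then so do the
exponents. -/
theorem mem_of_coef_mem (S : Subalgebra ℝ R)
    (hS : ∀ φ : g →ₗ[ℝ] ℝ, coef R ρ φ ((u : Matrix n n R) * rep R ρ h₀ *
      (u⁻¹ : (Matrix n n R)ˣ)) ∈ S) (i : Fin N) : a i ∈ S := by
  rw [T.eq_prod] at hS
  exact mem_of_coef_mem_of_perm T.toIsTriangular T.faithful T.family (List.Perm.refl _) S hS i

omit hB in
theorem mem_of_coef_inv_mem (S : Subalgebra ℝ R)
    (hS : ∀ φ : g →ₗ[ℝ] ℝ, coef R ρ φ (((u⁻¹ : (Matrix n n R)ˣ) : Matrix n n R) * rep R ρ h₀ *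
      u) ∈ S) (i : Fin N) : a i ∈ S := by
  have hS' : ∀ φ : g →ₗ[ℝ] ℝ, coef R ρ φ (((u⁻¹ : (Matrix n n R)ˣ) : Matrix n n R) * rep R ρ h₀ *
      ((u⁻¹)⁻¹ : (Matrix n n R)ˣ)) ∈ S := by rwa [inv_inv]
  rw [T.eq_prod_inv] at hS'
  exact neg_mem_iff.1 (mem_of_coef_mem_of_perm T.toIsTriangular T.faithful T.family_inv
    (List.reverse_perm _) S hS' i)

end IsTriangularProduct

end Charges

/-! ### Subspaces of tensors -/

section LegSpaces

variable {n : Type*} [Fintype n] [DecidableEq n] {R : Type*} [CommRing R]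

/-- The components in the first tensor factor. -/
def sliceOne (T : Matrix (n × n) (n × n) R) (c d : n) : Matrix n n R :=
  Matrix.of fun a b => T (a, c) (b, d)

/-- The components in the second tensor factor. -/
def sliceTwo (T : Matrix (n × n) (n × n) R) (a b : n) : Matrix n n R :=
  Matrix.of fun c d => T (a, c) (b, d)

/-- The tensors whose first factor lies in `V`. -/
def inLegOne (V : Submodule R (Matrix n n R)) : Submodule R (Matrix (n × n) (n × n) R) where
  carrier := {T | ∀ c d, sliceOne T c d ∈ V}
  add_mem' hT hT' c d := V.add_mem (hT c d) (hT' c d)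
  zero_mem' _ _ := V.zero_mem
  smul_mem' z _ hT c d := V.smul_mem z (hT c d)

/-- The tensors whose second factor lies in `V`. -/
def inLegTwo (V : Submodule R (Matrix n n R)) : Submodule R (Matrix (n × n) (n × n) R) where
  carrier := {T | ∀ a b, sliceTwo T a b ∈ V}
  add_mem' hT hT' a b := V.add_mem (hT a b) (hT' a b)
  zero_mem' _ _ := V.zero_mem
  smul_mem' z _ hT a b := V.smul_mem z (hT a b)

theorem mem_inLegOne {V : Submodule R (Matrix n n R)} {T : Matrix (n × n) (n × n) R} :
    T ∈ inLegOne V ↔ ∀ c d, sliceOne T c d ∈ V := Iff.rfl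

theorem mem_inLegTwo {V : Submodule R (Matrix n n R)} {T : Matrix (n × n) (n × n) R} :
    T ∈ inLegTwo V ↔ ∀ a b, sliceTwo T a b ∈ V := Iff.rfl

theorem sliceOne_sub (S T : Matrix (n × n) (n × n) R) (c d : n) :
    sliceOne (S - T) c d = sliceOne S c d - sliceOne T c d := rfl

theorem sliceTwo_sub (S T : Matrix (n × n) (n × n) R) (a b : n) :
    sliceTwo (S - T) a b = sliceTwo S a b - sliceTwo T a b := rfl

theorem sliceOne_inFirst_mul (w : Matrix n n R) (T : Matrix (n × n) (n × n) R) (c d : n) :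
    sliceOne (inFirst w * T) c d = w * sliceOne T c d := by
  ext a b
  simp [sliceOne, inFirst, Matrix.mul_apply, Fintype.sum_prod_type, Matrix.one_apply]

theorem sliceOne_mul_inFirst (w : Matrix n n R) (T : Matrix (n × n) (n × n) R) (c d : n) :
    sliceOne (T * inFirst w) c d = sliceOne T c d * w := by
  ext a b
  simp [sliceOne, inFirst, Matrix.mul_apply, Fintype.sum_prod_type, Matrix.one_apply]

theorem sliceOne_inSecond_mul (w : Matrix n n R) (T : Matrix (n × n) (n × n) R) (c d : n) :
    sliceOne (inSecond w * T) c d = ∑ j, w c j • sliceOne T j d := by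
  ext a b
  simp [sliceOne, inSecond, Matrix.mul_apply, Fintype.sum_prod_type, Matrix.one_apply,
    Matrix.sum_apply]

theorem sliceOne_mul_inSecond (w : Matrix n n R) (T : Matrix (n × n) (n × n) R) (c d : n) :
    sliceOne (T * inSecond w) c d = ∑ j, w j d • sliceOne T c j := by
  ext a b
  simp [sliceOne, inSecond, Matrix.mul_apply, Fintype.sum_prod_type, Matrix.one_apply,
    Matrix.sum_apply, mul_comm]

theorem sliceTwo_inSecond_mul (w : Matrix n n R) (T : Matrix (n × n) (n × n) R) (a b : n) :
    sliceTwo (inSecond w * T) a b = w * sliceTwo T a b := by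
  ext c d
  simp [sliceTwo, inSecond, Matrix.mul_apply, Fintype.sum_prod_type, Matrix.one_apply]

theorem sliceTwo_mul_inSecond (w : Matrix n n R) (T : Matrix (n × n) (n × n) R) (a b : n) :
    sliceTwo (T * inSecond w) a b = sliceTwo T a b * w := by
  ext c d
  simp [sliceTwo, inSecond, Matrix.mul_apply, Fintype.sum_prod_type, Matrix.one_apply]

theorem sliceTwo_inFirst_mul (w : Matrix n n R) (T : Matrix (n × n) (n × n) R) (a b : n) :
    sliceTwo (inFirst w * T) a b = ∑ j, w a j • sliceTwo T j b := by
  ext c d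
  simp [sliceTwo, inFirst, Matrix.mul_apply, Fintype.sum_prod_type, Matrix.one_apply,
    Matrix.sum_apply]

theorem sliceTwo_mul_inFirst (w : Matrix n n R) (T : Matrix (n × n) (n × n) R) (a b : n) :
    sliceTwo (T * inFirst w) a b = ∑ j, w j b • sliceTwo T a j := by
  ext c d
  simp [sliceTwo, inFirst, Matrix.mul_apply, Fintype.sum_prod_type, Matrix.one_apply,
    Matrix.sum_apply, mul_comm]

variable {V V' : Submodule R (Matrix n n R)} {T : Matrix (n × n) (n × n) R}

theorem inLegOne_inSecond_mul (w : Matrix n n R) (hT : T ∈ inLegOne V) :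
    inSecond w * T ∈ inLegOne V := fun c d => by
  rw [sliceOne_inSecond_mul]
  exact V.sum_mem fun j _ => V.smul_mem _ (hT j d)

theorem inLegOne_mul_inSecond (w : Matrix n n R) (hT : T ∈ inLegOne V) :
    T * inSecond w ∈ inLegOne V := fun c d => by
  rw [sliceOne_mul_inSecond]
  exact V.sum_mem fun j _ => V.smul_mem _ (hT c j)

theorem inLegTwo_inFirst_mul (w : Matrix n n R) (hT : T ∈ inLegTwo V) :
    inFirst w * T ∈ inLegTwo V := fun c d => by
  rw [sliceTwo_inFirst_mul]
  exact V.sum_mem fun j _ => V.smul_mem _ (hT j d)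

theorem inLegTwo_mul_inFirst (w : Matrix n n R) (hT : T ∈ inLegTwo V) :
    T * inFirst w ∈ inLegTwo V := fun c d => by
  rw [sliceTwo_mul_inFirst]
  exact V.sum_mem fun j _ => V.smul_mem _ (hT c j)

theorem inLegOne_conj {w w' : Matrix n n R} (hw : ∀ X ∈ V, w * X * w' ∈ V')
    (hT : T ∈ inLegOne V) : inFirst w * T * inFirst w' ∈ inLegOne V' := fun c d => by
  rw [sliceOne_mul_inFirst, sliceOne_inFirst_mul]
  exact hw _ (hT c d)

theorem inLegTwo_conj {w w' : Matrix n n R} (hw : ∀ X ∈ V, w * X * w' ∈ V')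
    (hT : T ∈ inLegTwo V) : inSecond w * T * inSecond w' ∈ inLegTwo V' := fun c d => by
  rw [sliceTwo_mul_inSecond, sliceTwo_inSecond_mul]
  exact hw _ (hT c d)

theorem kronecker_mem_inLegOne {X : Matrix n n R} (hX : X ∈ V) (Y : Matrix n n R) :
    X ⊗ₖ Y ∈ inLegOne V := fun c d => by
  have : sliceOne (X ⊗ₖ Y) c d = Y c d • X := by
    ext a b; simp [sliceOne, mul_comm]
  rw [this]
  exact V.smul_mem _ hX

theorem kronecker_mem_inLegTwo {Y : Matrix n n R} (hY : Y ∈ V) (X : Matrix n n R) :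
    X ⊗ₖ Y ∈ inLegTwo V := fun a b => by
  have : sliceTwo (X ⊗ₖ Y) a b = X a b • Y := by
    ext c d; simp [sliceTwo]
  rw [this]
  exact V.smul_mem _ hY

theorem tensorBracket_mul_left {k : Type*} [CommRing k] [Algebra k R] (P : PoissonBracket k R)
    (X Y Z : Matrix n n R) : tensorBracket P (X * Y) Z =
      tensorBracket P X Z * inFirst Y + inFirst X * tensorBracket P Y Z := by
  ext ⟨a, c⟩ ⟨b, d⟩
  have : ∀ f g h, P.br (f * g) h = P.br f h * g + f * P.br g h := fun f g h => by
    rw [P.skew, P.leibniz, P.skew f, P.skew g]; ring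
  simp [tensorBracket, inFirst, Matrix.mul_apply, Fintype.sum_prod_type, Matrix.one_apply, this,
    Finset.sum_add_distrib]

theorem tensorBracket_mul_right {k : Type*} [CommRing k] [Algebra k R] (P : PoissonBracket k R)
    (X Y Z : Matrix n n R) : tensorBracket P Z (X * Y) =
      tensorBracket P Z X * inSecond Y + inSecond X * tensorBracket P Z Y := by
  ext ⟨a, c⟩ ⟨b, d⟩
  simp [tensorBracket, inSecond, Matrix.mul_apply, Fintype.sum_prod_type, Matrix.one_apply,
    P.leibniz, Finset.sum_add_distrib]

theorem sliceOne_tensorBracket {k : Type*} [CommRing k] [Algebra k R] (P : PoissonBracket k R)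
    (X Y : Matrix n n R) (c d : n) :
    sliceOne (tensorBracket P X Y) c d = -X.map (P.br (Y c d)) := by
  ext a b
  exact P.skew _ _

theorem sliceTwo_tensorBracket {k : Type*} [CommRing k] [Algebra k R] (P : PoissonBracket k R)
    (X Y : Matrix n n R) (a b : n) :
    sliceTwo (tensorBracket P X Y) a b = Y.map (P.br (X a b)) := rfl

end LegSpaces

/-! ### The decomposition of tensors by degrees -/

section Decomposition

variable {g : Type*} [LieRing g] [LieAlgebra ℝ g]
  {n : Type*} [Fintype n] [DecidableEq n] {R : Type*} [CommRing R] [Algebra ℝ R]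
  {J : Type*} [Fintype J] {h₀ : g} {e e' : J → g} {deg : J → ℤ}
  {ρ : g →ₗ[ℝ] Matrix n n ℝ}

theorem IsDualBasis.neg (hd : IsDualBasis h₀ e e' deg) :
    IsDualBasis (-h₀) e e' (fun j => -deg j) where
  mem j := by rw [mem_gr_neg, neg_neg]; exact hd.mem j
  mem' j := by rw [mem_gr_neg, neg_neg]; exact hd.mem' j
  sum_left := hd.sum_left
  sum_right := hd.sum_right

/-- The span of the image of the elements of degree zero. -/
def cartanSpan (r : g →ₗ[ℝ] Matrix n n R) (h₀ : g) : Submodule R (Matrix n n R) :=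
  Submodule.span R (r '' gr h₀ 0)

theorem IsDualBasis.eq_sum (hd : IsDualBasis h₀ e e' deg) (hρ : IsFaithfulRep ρ)
    {X : Matrix n n R} (hX : X ∈ Submodule.span R (Set.range (rep R ρ))) :
    ∑ j, coef R ρ (killingForm ℝ g (e' j)) X • rep R ρ (e j) = X := by
  induction hX using Submodule.span_induction with
  | mem X h =>
    obtain ⟨v, rfl⟩ := h
    conv_rhs => rw [← hd.sum_left v, map_sum]
    refine Finset.sum_congr rfl fun j _ => ?_
    rw [coef_rep hρ, algebraMap_smul, map_smul, killingForm_symm]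
  | zero => simp
  | add X Y _ _ hX hY =>
    simp only [map_add, add_smul, Finset.sum_add_distrib, hX, hY]
  | smul c X _ hX =>
    simp only [map_smul, smul_assoc, ← Finset.smul_sum, hX]

theorem fil_le_span (r : g →ₗ[ℝ] Matrix n n R) (h₀ : g) (k : ℤ) :
    fil R r h₀ k ≤ Submodule.span R (Set.range r) :=
  Submodule.span_mono fun _ ⟨_, _, v, _, h⟩ => ⟨v, h⟩

theorem cartanSpan_le_span (r : g →ₗ[ℝ] Matrix n n R) (h₀ : g) :
    cartanSpan r h₀ ≤ Submodule.span R (Set.range r) :=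
  Submodule.span_mono (Set.image_subset_range _ _)

theorem IsDualBasis.coef_cartanSpan (hd : IsDualBasis h₀ e e' deg) (hρ : IsFaithfulRep ρ) {j : J}
    (hj : deg j ≠ 0) {X : Matrix n n R} (hX : X ∈ cartanSpan (rep R ρ) h₀) :
    coef R ρ (killingForm ℝ g (e' j)) X = 0 := by
  induction hX using Submodule.span_induction with
  | mem X h =>
    obtain ⟨v, hv, rfl⟩ := h
    rw [coef_rep hρ, killingForm_eq_zero_of_mem_gr (hd.mem' j) hv (by omega), map_zero]
  | zero => rw [map_zero]
  | add X Y _ _ hX hY => rw [map_add, hX, hY, add_zero]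
  | smul c X _ hX => rw [map_smul, hX, smul_zero]

theorem IsDualBasis.coef_fil (hd : IsDualBasis h₀ e e' deg) (hρ : IsFaithfulRep ρ) {j : J}
    (hj : deg j ≤ 0) {X : Matrix n n R} (hX : X ∈ fil R (rep R ρ) h₀ 1) :
    coef R ρ (killingForm ℝ g (e' j)) X = 0 :=
  coef_killing_eq_zero_of_mem_fil hρ (hd.mem' j) (by omega) hX

/-- The parts of negative, zero and positive degree are independent. -/
theorem IsDualBasis.eq_zero_of_add_eq_zero (hd : IsDualBasis h₀ e e' deg) (hρ : IsFaithfulRep ρ)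
    {X Y Z : Matrix n n R} (hX : X ∈ fil R (rep R ρ) (-h₀) 1) (hY : Y ∈ cartanSpan (rep R ρ) h₀)
    (hZ : Z ∈ fil R (rep R ρ) h₀ 1) (h : X + Y + Z = 0) : X = 0 ∧ Y = 0 ∧ Z = 0 := by
  have hc : ∀ j, coef R ρ (killingForm ℝ g (e' j)) X = 0 ∧
      coef R ρ (killingForm ℝ g (e' j)) Y = 0 ∧ coef R ρ (killingForm ℝ g (e' j)) Z = 0 := by
    intro j
    have h' := congrArg (coef R ρ (killingForm ℝ g (e' j))) h
    rw [map_add, map_add, map_zero] at h'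
    rcases lt_trichotomy (deg j) 0 with hj | hj | hj
    · have h1 := hd.coef_cartanSpan hρ hj.ne hY
      have h2 := hd.coef_fil hρ hj.le hZ
      rw [h1, h2, add_zero, add_zero] at h'
      exact ⟨h', h1, h2⟩
    · have h1 := hd.neg.coef_fil hρ (j := j) (by omega) hX
      have h2 := hd.coef_fil hρ hj.le hZ
      rw [h1, h2, zero_add, add_zero] at h'
      exact ⟨h1, h', h2⟩
    · have h1 := hd.neg.coef_fil hρ (j := j) (by omega) hX
      have h2 := hd.coef_cartanSpan hρ hj.ne' hY
      rw [h1, h2, zero_add, zero_add] at h'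
      exact ⟨h1, h2, h'⟩
  rw [← hd.eq_sum hρ (fil_le_span _ _ _ hX), ← hd.eq_sum hρ (cartanSpan_le_span _ _ hY),
    ← hd.eq_sum hρ (fil_le_span _ _ _ hZ)]
  simp [hc]

theorem IsDualBasis.legOne_eq_zero (hd : IsDualBasis h₀ e e' deg) (hρ : IsFaithfulRep ρ)
    {X Y Z : Matrix (n × n) (n × n) R} (hX : X ∈ inLegOne (fil R (rep R ρ) (-h₀) 1))
    (hY : Y ∈ inLegOne (cartanSpan (rep R ρ) h₀)) (hZ : Z ∈ inLegOne (fil R (rep R ρ) h₀ 1))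
    (h : X + Y + Z = 0) : X = 0 ∧ Y = 0 ∧ Z = 0 := by
  have key : ∀ c d, sliceOne X c d = 0 ∧ sliceOne Y c d = 0 ∧ sliceOne Z c d = 0 := fun c d =>
    hd.eq_zero_of_add_eq_zero hρ (hX c d) (hY c d) (hZ c d)
      (congrArg (fun T => sliceOne T c d) h)
  refine ⟨?_, ?_, ?_⟩ <;> ext ⟨a, c⟩ ⟨b, d⟩
  · exact congrFun (congrFun (key c d).1 a) b
  · exact congrFun (congrFun (key c d).2.1 a) b
  · exact congrFun (congrFun (key c d).2.2 a) b

theorem IsDualBasis.legTwo_eq_zero (hd : IsDualBasis h₀ e e' deg) (hρ : IsFaithfulRep ρ)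
    {X Y Z : Matrix (n × n) (n × n) R} (hX : X ∈ inLegTwo (fil R (rep R ρ) (-h₀) 1))
    (hY : Y ∈ inLegTwo (cartanSpan (rep R ρ) h₀)) (hZ : Z ∈ inLegTwo (fil R (rep R ρ) h₀ 1))
    (h : X + Y + Z = 0) : X = 0 ∧ Y = 0 ∧ Z = 0 := by
  have key : ∀ c d, sliceTwo X c d = 0 ∧ sliceTwo Y c d = 0 ∧ sliceTwo Z c d = 0 := fun c d =>
    hd.eq_zero_of_add_eq_zero hρ (hX c d) (hY c d) (hZ c d)
      (congrArg (fun T => sliceTwo T c d) h)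
  refine ⟨?_, ?_, ?_⟩ <;> ext ⟨a, c⟩ ⟨b, d⟩
  · exact congrFun (congrFun (key a b).1 c) d
  · exact congrFun (congrFun (key a b).2.1 c) d
  · exact congrFun (congrFun (key a b).2.2 c) d

theorem degTensor_mem_inLegOne (hd : IsDualBasis h₀ e e' deg) {w : ℤ → ℝ}
    {V : Submodule R (Matrix n n R)} {r : g →ₗ[ℝ] Matrix n n R}
    (hw : ∀ k, w k ≠ 0 → ∀ v ∈ gr h₀ k, r v ∈ V) : degTensor r e e' deg w ∈ inLegOne V := by
  refine Submodule.sum_mem _ fun j _ => kronecker_mem_inLegOne ?_ _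
  by_cases h : w (deg j) = 0
  · rw [h, zero_smul, map_zero]; exact V.zero_mem
  · exact hw _ h _ (Submodule.smul_mem _ _ (hd.mem j))

theorem degTensor_mem_inLegTwo (hd : IsDualBasis h₀ e e' deg) {w : ℤ → ℝ}
    {V : Submodule R (Matrix n n R)} {r : g →ₗ[ℝ] Matrix n n R}
    (hw : ∀ k, w k ≠ 0 → ∀ v ∈ gr h₀ (-k), r v ∈ V) : degTensor r e e' deg w ∈ inLegTwo V := by
  refine Submodule.sum_mem _ fun j _ => ?_
  by_cases h : w (deg j) = 0
  · rw [h, zero_smul, map_zero, Matrix.zero_kronecker]; exact Submodule.zero_mem _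
  · exact kronecker_mem_inLegTwo (hw _ h _ (hd.mem' j)) _

/-- An element of degree zero preserves every degree, so the cancellation for the Casimir tensor
takes place in each degree separately and holds for any weight `w`. -/
theorem commute_degTensor (hd : IsDualBasis h₀ e e' deg)
    (hρ : IsFaithfulRep ρ) {x : g} (hx : x ∈ gr h₀ 0) (w : ℤ → ℝ) :
    Commute (inFirst (rep R ρ x) + inSecond (rep R ρ x)) (degTensor (rep R ρ) e e' deg w) := by
  set r := rep R ρ
  rw [Commute, SemiconjBy, ← sub_eq_zero]
  have h : (inFirst (r x) + inSecond (r x)) * degTensor r e e' deg w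
      - degTensor r e e' deg w * (inFirst (r x) + inSecond (r x))
      = ∑ j, w (deg j) • (r ⁅x, e j⁆ ⊗ₖ r (e' j)) + ∑ j, w (deg j) • (r (e j) ⊗ₖ r ⁅x, e' j⁆) := by
    simp only [degTensor, map_smul, Matrix.smul_kronecker]
    rw [Finset.mul_sum, Finset.sum_mul, ← Finset.sum_sub_distrib, ← Finset.sum_add_distrib]
    refine Finset.sum_congr rfl fun j _ => ?_
    rw [mul_smul_comm, smul_mul_assoc, ← smul_sub, ← smul_add]
    congr 1
    rw [add_mul, mul_add, inFirst_mul_kronecker, kronecker_mul_inFirst, inSecond_mul_kronecker,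
      kronecker_mul_inSecond, rep_lie hρ, rep_lie hρ, sub_kronecker, kronecker_sub]
    abel
  rw [h]
  have h1 : ∀ j, r ⁅x, e j⁆ = ∑ l, killingForm ℝ g ⁅x, e j⁆ (e' l) • r (e l) := fun j => by
    conv_lhs => rw [← hd.sum_left ⁅x, e j⁆]
    simp only [map_sum, map_smul]
  have h2 : ∀ j, r ⁅x, e' j⁆ = ∑ l, killingForm ℝ g ⁅x, e' j⁆ (e l) • r (e' l) := fun j => by
    conv_lhs => rw [← hd.sum_right ⁅x, e' j⁆]
    simp only [map_sum, map_smul]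
  have hk : ∀ (s : Finset J) (f : J → Matrix n n R) (Y : Matrix n n R),
      (∑ l ∈ s, f l) ⊗ₖ Y = ∑ l ∈ s, f l ⊗ₖ Y := fun s f Y => by
    ext ⟨a, c⟩ ⟨b, d⟩
    simp [Matrix.sum_apply, Finset.sum_mul]
  have hk' : ∀ (s : Finset J) (f : J → Matrix n n R) (Y : Matrix n n R),
      Y ⊗ₖ (∑ l ∈ s, f l) = ∑ l ∈ s, Y ⊗ₖ f l := fun s f Y => by
    ext ⟨a, c⟩ ⟨b, d⟩
    simp [Matrix.sum_apply, Finset.mul_sum]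
  simp only [h1, h2, hk, hk', Finset.smul_sum]
  rw [Finset.sum_comm, ← Finset.sum_add_distrib]
  refine Finset.sum_eq_zero fun l _ => ?_
  rw [← Finset.sum_add_distrib]
  refine Finset.sum_eq_zero fun j _ => ?_
  rw [Matrix.smul_kronecker, Matrix.kronecker_smul, smul_smul, smul_smul, ← add_smul]
  have h3 : killingForm ℝ g ⁅x, e j⁆ (e' l) + killingForm ℝ g ⁅x, e' l⁆ (e j) = 0 := by
    rw [← lie_skew x (e j), map_neg, LinearMap.neg_apply, killingForm_lie_left,
      killingForm_symm _ (e j), neg_add_cancel]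
  by_cases hjl : deg j = deg l
  · rw [hjl, ← mul_add, h3, mul_zero, zero_smul]
  · have h4 := killingForm_eq_zero_of_mem_gr (lie_mem_gr hx (hd.mem j)) (hd.mem' l) (by omega)
    rw [h4, zero_add] at h3
    rw [h4, h3, mul_zero, mul_zero, add_zero, zero_smul]

/-- Conjugation by a unipotent matrix, modulo the part of positive degree in the first factor. -/
theorem conj_degTensor_sub_mem_inLegOne (hd : IsDualBasis h₀ e e' deg) {u : (Matrix n n R)ˣ}
    (hu : u ∈ unip (rep R ρ) h₀) {w : ℤ → ℝ} (hw : ∀ k < 0, w k = 0) :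
    inFirst (u : Matrix n n R) * degTensor (rep R ρ) e e' deg w *
      inFirst ((u⁻¹ : (Matrix n n R)ˣ) : Matrix n n R) - degTensor (rep R ρ) e e' deg w
      ∈ inLegOne (fil R (rep R ρ) h₀ 1) := by
  have h : degTensor (rep R ρ) e e' deg w ∈ inLegOne (fil R (rep R ρ) h₀ 0) :=
    degTensor_mem_inLegOne hd fun k hk v hv =>
      rep_mem_fil (not_lt.1 fun h => hk (hw k h)) hv
  rw [mem_inLegOne] at h ⊢
  intro c d
  rw [sliceOne_sub, sliceOne_mul_inFirst, sliceOne_inFirst_mul]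
  have := unip_conj_sub_mem hu (h c d)
  rwa [zero_add] at this

theorem conj_degTensor_sub_mem_inLegTwo (hd : IsDualBasis h₀ e e' deg) {u : (Matrix n n R)ˣ}
    (hu : u ∈ unip (rep R ρ) h₀) {w : ℤ → ℝ} (hw : ∀ k > 0, w k = 0) :
    inSecond (u : Matrix n n R) * degTensor (rep R ρ) e e' deg w *
      inSecond ((u⁻¹ : (Matrix n n R)ˣ) : Matrix n n R) - degTensor (rep R ρ) e e' deg w
      ∈ inLegTwo (fil R (rep R ρ) h₀ 1) := by
  have h : degTensor (rep R ρ) e e' deg w ∈ inLegTwo (fil R (rep R ρ) h₀ 0) :=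
    degTensor_mem_inLegTwo hd fun k hk v hv =>
      rep_mem_fil (neg_nonneg.2 (not_lt.1 fun h => hk (hw k h))) hv
  rw [mem_inLegTwo] at h ⊢
  intro c d
  rw [sliceTwo_sub, sliceTwo_mul_inSecond, sliceTwo_inSecond_mul]
  have := unip_conj_sub_mem hu (h c d)
  rwa [zero_add] at this

theorem degTensor_sub_wCartan_mem_inLegOne (hd : IsDualBasis h₀ e e' deg) {w : ℤ → ℝ}
    (hw : ∀ k < 0, w k = 0) (h0 : w 0 = 1) :
    degTensor (rep R ρ) e e' deg w - degTensor (rep R ρ) e e' deg wCartan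
      ∈ inLegOne (fil R (rep R ρ) h₀ 1) := by
  rw [sub_eq_add_neg, ← degTensor_neg, ← degTensor_add]
  refine degTensor_mem_inLegOne hd fun k hk v hv => rep_mem_fil ?_ hv
  by_contra hlt
  refine hk ?_
  rcases (show k ≤ 0 by omega).lt_or_eq with h' | h'
  · simp [hw k h', wCartan, h'.ne]
  · simp [h', h0, wCartan]

theorem degTensor_sub_wCartan_mem_inLegTwo (hd : IsDualBasis h₀ e e' deg) {w : ℤ → ℝ}
    (hw : ∀ k > 0, w k = 0) (h0 : w 0 = 1) :
    degTensor (rep R ρ) e e' deg w - degTensor (rep R ρ) e e' deg wCartan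
      ∈ inLegTwo (fil R (rep R ρ) h₀ 1) := by
  rw [sub_eq_add_neg, ← degTensor_neg, ← degTensor_add]
  refine degTensor_mem_inLegTwo hd fun k hk v hv => rep_mem_fil ?_ hv
  by_contra hlt
  refine hk ?_
  rcases (show 0 ≤ k by omega).lt_or_eq with h' | h'
  · simp [hw k h', wCartan, h'.ne']
  · simp [← h', h0, wCartan]

end Decomposition

/-! ### The brackets of the factors of a Gauss decomposition -/

section Gauss

variable {g : Type*} [LieRing g] [LieAlgebra ℝ g]
  {n : Type*} [Fintype n] [DecidableEq n] {R : Type*} [CommRing R] [Algebra ℝ R]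
  {J : Type*} [Fintype J] {h₀ : g} {e e' : J → g} {deg : J → ℤ}
  {ρ : g →ₗ[ℝ] Matrix n n ℝ}

/-- The tensor `R - u₁u₂R(u₁u₂)⁻¹ - u₁Hu₁⁻¹ + u₂Hu₂⁻¹`. -/
def nilTensor (r : g →ₗ[ℝ] Matrix n n R) (e e' : J → g) (deg : J → ℤ) (u : (Matrix n n R)ˣ) :
    Matrix (n × n) (n × n) R :=
  degTensor r e e' deg wSign
    - inFirst (u : Matrix n n R) * (inSecond (u : Matrix n n R) * degTensor r e e' deg wSign *
      inSecond ((u⁻¹ : (Matrix n n R)ˣ) : Matrix n n R)) *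
        inFirst ((u⁻¹ : (Matrix n n R)ˣ) : Matrix n n R)
    - inFirst (u : Matrix n n R) * degTensor r e e' deg wCartan *
      inFirst ((u⁻¹ : (Matrix n n R)ˣ) : Matrix n n R)
    + inSecond (u : Matrix n n R) * degTensor r e e' deg wCartan *
      inSecond ((u⁻¹ : (Matrix n n R)ˣ) : Matrix n n R)

theorem conj_conj_of_commute {u : (Matrix n n R)ˣ} {Ω : Matrix (n × n) (n × n) R}
    (h : Commute (inFirst (u : Matrix n n R) * inSecond (u : Matrix n n R)) Ω) :
    inFirst (u : Matrix n n R) * (inSecond (u : Matrix n n R) * Ω *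
      inSecond ((u⁻¹ : (Matrix n n R)ˣ) : Matrix n n R)) *
        inFirst ((u⁻¹ : (Matrix n n R)ˣ) : Matrix n n R) = Ω := by
  rw [← mul_assoc, ← mul_assoc, h.eq, (commute_inFirst_inSecond _ _).eq]
  simp only [mul_assoc]
  rw [← mul_assoc (inFirst _) (inSecond _) (inFirst _), (commute_inFirst_inSecond _ _).eq,
    mul_assoc (inSecond _), inFirst_mul_inv, mul_one, inSecond_mul_inv, mul_one]

/-- The Casimir tensor cancels from `R - u₁u₂R(u₁u₂)⁻¹`, so `R` may be replaced by `Θ = R + Ω`.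
Modulo positive degree in the first leg, `Θ`, `u₁Θu₁⁻¹` and `u₁Hu₁⁻¹` are all `H`, and what remains
is `H - u₂Hu₂⁻¹ - H + u₂Hu₂⁻¹ = 0`. -/
theorem nilTensor_mem_inLegOne (hd : IsDualBasis h₀ e e' deg) {u : (Matrix n n R)ˣ}
    (hu : u ∈ unip (rep R ρ) h₀)
    (hΩ : Commute (inFirst (u : Matrix n n R) * inSecond (u : Matrix n n R))
      (degTensor (rep R ρ) e e' deg wOne)) :
    nilTensor (rep R ρ) e e' deg u ∈ inLegOne (fil R (rep R ρ) h₀ 1) := by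
  have hw : ∀ j < 0, (wSign + wOne) j = 0 := fun j hj => by
    simp [wSign, wOne, Int.sign_eq_neg_one_of_neg hj]
  have h0 : (wSign + wOne) 0 = 1 := by norm_num [wSign, wOne]
  have hw' : ∀ j : ℤ, j < 0 → wCartan j = 0 := fun j hj => by simp [wCartan, hj.ne]
  have h1 := degTensor_sub_wCartan_mem_inLegOne (ρ := ρ) (R := R) hd hw h0
  have h2 := conj_degTensor_sub_mem_inLegOne hd hu hw
  have h3 := conj_degTensor_sub_mem_inLegOne hd hu hw'
  have hR : degTensor (rep R ρ) e e' deg wSign = degTensor (rep R ρ) e e' deg (wSign + wOne)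
      - degTensor (rep R ρ) e e' deg wOne := by
    rw [degTensor_add, add_sub_cancel_right]
  have hc := conj_conj_of_commute hΩ
  rw [nilTensor, hR]
  set Θ := degTensor (rep R ρ) e e' deg (wSign + wOne)
  set Ω := degTensor (rep R ρ) e e' deg wOne
  set C := degTensor (rep R ρ) e e' deg wCartan
  have h4 := inLegOne_mul_inSecond ((u⁻¹ : (Matrix n n R)ˣ) : Matrix n n R)
    (inLegOne_inSecond_mul (u : Matrix n n R) h1)
  have h5 := inLegOne_mul_inSecond ((u⁻¹ : (Matrix n n R)ˣ) : Matrix n n R)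
    (inLegOne_inSecond_mul (u : Matrix n n R) h2)
  have key := Submodule.sub_mem _ (Submodule.sub_mem _ (Submodule.sub_mem _ h1 h5) h4) h3
  convert key using 1
  have hswap : inFirst (u : Matrix n n R) * (inSecond (u : Matrix n n R) * Θ *
      inSecond ((u⁻¹ : (Matrix n n R)ˣ) : Matrix n n R)) *
        inFirst ((u⁻¹ : (Matrix n n R)ˣ) : Matrix n n R) =
      inSecond (u : Matrix n n R) * (inFirst (u : Matrix n n R) * Θ *
      inFirst ((u⁻¹ : (Matrix n n R)ˣ) : Matrix n n R)) *
        inSecond ((u⁻¹ : (Matrix n n R)ˣ) : Matrix n n R) := by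
    simp only [mul_assoc]
    rw [(commute_inFirst_inSecond _ _).symm.eq, ← mul_assoc (inFirst _) (inSecond _),
      (commute_inFirst_inSecond _ _).eq, mul_assoc]
  simp only [mul_sub, sub_mul, hc]
  rw [hswap]
  abel

/-- The mirror argument with `R = Ω - Θ` and `Θ = Ω - R`, which is supported in degrees at most 0 of
the first leg and hence at least 0 of the second. -/
theorem nilTensor_mem_inLegTwo (hd : IsDualBasis h₀ e e' deg) {u : (Matrix n n R)ˣ}
    (hu : u ∈ unip (rep R ρ) h₀)
    (hΩ : Commute (inFirst (u : Matrix n n R) * inSecond (u : Matrix n n R))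
      (degTensor (rep R ρ) e e' deg wOne)) :
    nilTensor (rep R ρ) e e' deg u ∈ inLegTwo (fil R (rep R ρ) h₀ 1) := by
  have hw : ∀ j > 0, (wOne + -wSign) j = 0 := fun j hj => by
    simp [wSign, wOne, Int.sign_eq_one_of_pos hj]
  have h0 : (wOne + -wSign) 0 = 1 := by norm_num [wSign, wOne]
  have hw' : ∀ j : ℤ, j > 0 → wCartan j = 0 := fun j hj => by simp [wCartan, hj.ne']
  have h1 := degTensor_sub_wCartan_mem_inLegTwo (ρ := ρ) (R := R) hd hw h0
  have h2 := conj_degTensor_sub_mem_inLegTwo hd hu hw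
  have h3 := conj_degTensor_sub_mem_inLegTwo hd hu hw'
  have hR : degTensor (rep R ρ) e e' deg wSign = degTensor (rep R ρ) e e' deg wOne
      - degTensor (rep R ρ) e e' deg (wOne + -wSign) := by
    rw [degTensor_add, degTensor_neg]; abel
  have hc := conj_conj_of_commute hΩ
  rw [nilTensor, hR]
  set Θ := degTensor (rep R ρ) e e' deg (wOne + -wSign)
  set Ω := degTensor (rep R ρ) e e' deg wOne
  set C := degTensor (rep R ρ) e e' deg wCartan
  have h4 := inLegTwo_mul_inFirst ((u⁻¹ : (Matrix n n R)ˣ) : Matrix n n R)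
    (inLegTwo_inFirst_mul (u : Matrix n n R) h1)
  have h5 := inLegTwo_mul_inFirst ((u⁻¹ : (Matrix n n R)ˣ) : Matrix n n R)
    (inLegTwo_inFirst_mul (u : Matrix n n R) h2)
  have key := Submodule.add_mem _ (Submodule.add_mem _ (Submodule.sub_mem _ h5 h1) h4) h3
  convert key using 1
  simp only [mul_sub, sub_mul, hc]
  abel

variable {k : Type*} [CommRing k] [Algebra k R]

/-- The formal properties of the factors of `U = mdp`. -/
structure IsGauss (P : PoissonBracket k R) (ρ : g →ₗ[ℝ] Matrix n n ℝ) (h₀ : g)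
    (e e' : J → g) (deg : J → ℤ) (m d p : (Matrix n n R)ˣ) : Prop where
  dual : IsDualBasis h₀ e e' deg
  faithful : IsFaithfulRep ρ
  p_unip : p ∈ unip (rep R ρ) h₀
  p_casimir : Commute (inFirst (p : Matrix n n R) * inSecond (p : Matrix n n R))
      (degTensor (rep R ρ) e e' deg wOne)
  p_deriv : ∀ f, (p : Matrix n n R).map (P.br f) * (p⁻¹ : (Matrix n n R)ˣ) ∈
    fil R (rep R ρ) h₀ 1
  m_unip : m ∈ unip (rep R ρ) (-h₀)
  m_casimir : Commute (inFirst (m : Matrix n n R) * inSecond (m : Matrix n n R))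
      (degTensor (rep R ρ) e e' deg wOne)
  m_deriv : ∀ f, (m : Matrix n n R).map (P.br f) * (m⁻¹ : (Matrix n n R)ˣ) ∈
    fil R (rep R ρ) (-h₀) 1
  d_comm : ∀ v ∈ gr h₀ 0, Commute (d : Matrix n n R) (rep R ρ v)
  d_eig : ∀ j, ∃ c : R, (d : Matrix n n R) * rep R ρ (e j) = c • (rep R ρ (e j) * d)
  d_tensor : ∀ w, Commute (inFirst (d : Matrix n n R) * inSecond (d : Matrix n n R))
      (degTensor (rep R ρ) e e' deg w)
  d_deriv : ∀ f, (d : Matrix n n R).map (P.br f) * (d⁻¹ : (Matrix n n R)ˣ) ∈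
    cartanSpan (rep R ρ) h₀

namespace IsGauss

variable {P : PoissonBracket k R} {m d p : (Matrix n n R)ˣ}

theorem d_conj (G : IsGauss P ρ h₀ e e' deg m d p) (X : Matrix n n R)
    (hX : X ∈ fil R (rep R ρ) h₀ 1) :
    (d : Matrix n n R) * X * (d⁻¹ : (Matrix n n R)ˣ) ∈ fil R (rep R ρ) h₀ 1 := by
  rw [← G.dual.eq_sum G.faithful (fil_le_span _ _ _ hX), Finset.mul_sum, Finset.sum_mul]
  refine Submodule.sum_mem _ fun j _ => ?_
  by_cases hj : deg j ≤ 0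
  · rw [G.dual.coef_fil G.faithful hj hX, zero_smul, mul_zero, zero_mul]
    exact zero_mem _
  · obtain ⟨c, hc⟩ := G.d_eig j
    rw [mul_smul_comm, smul_mul_assoc, hc, smul_mul_assoc, Units.mul_inv_cancel_right]
    exact Submodule.smul_mem _ _ (Submodule.smul_mem _ _ (rep_mem_fil (by omega) (G.dual.mem j)))

theorem d_wCartan (G : IsGauss P ρ h₀ e e' deg m d p) :
    Commute (inFirst (d : Matrix n n R)) (degTensor (rep R ρ) e e' deg wCartan) ∧
    Commute (inSecond (d : Matrix n n R)) (degTensor (rep R ρ) e e' deg wCartan) := by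
  have h : ∀ j, deg j = 0 → Commute (d : Matrix n n R) (rep R ρ (e j)) ∧
      Commute (d : Matrix n n R) (rep R ρ (e' j)) := fun j hj => by
    have h1 := G.dual.mem j
    have h2 := G.dual.mem' j
    rw [hj] at h1 h2
    rw [neg_zero] at h2
    exact ⟨G.d_comm _ h1, G.d_comm _ h2⟩
  constructor <;> refine Commute.sum_right _ _ _ fun j _ => ?_ <;> by_cases hj : deg j = 0
  · rw [Commute, SemiconjBy, inFirst_mul_kronecker, kronecker_mul_inFirst, map_smul,
      mul_smul_comm, smul_mul_assoc, (h j hj).1.eq]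
  · rw [wCartan, if_neg hj, zero_smul, map_zero, Matrix.zero_kronecker]; exact Commute.zero_right _
  · rw [Commute, SemiconjBy, inSecond_mul_kronecker, kronecker_mul_inSecond, (h j hj).2.eq]
  · rw [wCartan, if_neg hj, zero_smul, map_zero, Matrix.zero_kronecker]; exact Commute.zero_right _

theorem wCartan_mem (hd : IsDualBasis h₀ e e' deg) (r : g →ₗ[ℝ] Matrix n n R) :
    degTensor r e e' deg wCartan ∈ inLegOne (cartanSpan r h₀) ∧
    degTensor r e e' deg wCartan ∈ inLegTwo (cartanSpan r h₀) := by
  have h : ∀ k, wCartan k ≠ 0 → k = 0 := fun k hk => by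
    by_contra h; exact hk (if_neg h)
  refine ⟨degTensor_mem_inLegOne hd fun k hk v hv => ?_,
    degTensor_mem_inLegTwo hd fun k hk v hv => ?_⟩
  · rw [h k hk] at hv; exact Submodule.subset_span ⟨v, hv, rfl⟩
  · rw [h k hk, neg_zero] at hv; exact Submodule.subset_span ⟨v, hv, rfl⟩

/-- Conjugating one leg of `H₁₂` makes its defect nilpotent in that leg and leaves the other leg in
the Cartan part. These are the mixed pieces of the nine-fold decomposition. -/
theorem conj_wCartan_sub_mem (hd : IsDualBasis h₀ e e' deg) {u : (Matrix n n R)ˣ}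
    (hu : u ∈ unip (rep R ρ) h₀) :
    inFirst (u : Matrix n n R) * degTensor (rep R ρ) e e' deg wCartan *
      inFirst ((u⁻¹ : (Matrix n n R)ˣ) : Matrix n n R) - degTensor (rep R ρ) e e' deg wCartan
      ∈ inLegOne (fil R (rep R ρ) h₀ 1) ⊓ inLegTwo (cartanSpan (rep R ρ) h₀) ∧
    inSecond (u : Matrix n n R) * degTensor (rep R ρ) e e' deg wCartan *
      inSecond ((u⁻¹ : (Matrix n n R)ˣ) : Matrix n n R) - degTensor (rep R ρ) e e' deg wCartan
      ∈ inLegOne (cartanSpan (rep R ρ) h₀) ⊓ inLegTwo (fil R (rep R ρ) h₀ 1) := by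
  have h := wCartan_mem hd (rep R ρ)
  exact ⟨⟨conj_degTensor_sub_mem_inLegOne hd hu fun j hj => if_neg (ne_of_lt hj),
      Submodule.sub_mem _ (inLegTwo_mul_inFirst _ (inLegTwo_inFirst_mul _ h.2)) h.2⟩,
    ⟨Submodule.sub_mem _ (inLegOne_mul_inSecond _ (inLegOne_inSecond_mul _ h.1)) h.1,
      conj_degTensor_sub_mem_inLegTwo hd hu fun j hj => if_neg (ne_of_gt hj)⟩⟩

end IsGauss

theorem degTensor_neg_deg (r : g →ₗ[ℝ] Matrix n n R) :
    degTensor r e e' (fun j => -deg j) wSign = -degTensor r e e' deg wSign ∧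
    degTensor r e e' (fun j => -deg j) wCartan = degTensor r e e' deg wCartan ∧
    degTensor r e e' (fun j => -deg j) wOne = degTensor r e e' deg wOne := by
  refine ⟨?_, ?_, ?_⟩
  · rw [← degTensor_neg]
    simp [degTensor, wSign]
  · simp [degTensor, wCartan]
  · simp [degTensor, wOne]

end Gauss

/-! ### Two-sided normalisation of the nine brackets. -/

section Place

variable {n : Type*} [Fintype n] [DecidableEq n] {R : Type*} [CommRing R]

/-- Multiplication of both legs of a tensor from both sides. -/
def twoSided (l₁ l₂ r₁ r₂ : (Matrix n n R)ˣ) :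
    Matrix (n × n) (n × n) R →ₗ[R] Matrix (n × n) (n × n) R where
  toFun T := inFirst (l₁ : Matrix n n R) * (inSecond (l₂ : Matrix n n R) * T *
    inSecond (r₂ : Matrix n n R)) * inFirst (r₁ : Matrix n n R)
  map_add' S T := by simp only [mul_add, add_mul]
  map_smul' c T := by simp only [mul_smul_comm, smul_mul_assoc, RingHom.id_apply]

theorem twoSided_apply (l₁ l₂ r₁ r₂ : (Matrix n n R)ˣ) (T : Matrix (n × n) (n × n) R) :
    twoSided l₁ l₂ r₁ r₂ T = inFirst (l₁ : Matrix n n R) * (inSecond (l₂ : Matrix n n R) * T *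
    inSecond (r₂ : Matrix n n R)) * inFirst (r₁ : Matrix n n R) := rfl

theorem twoSided_apply' (l₁ l₂ r₁ r₂ : (Matrix n n R)ˣ) (T : Matrix (n × n) (n × n) R) :
    twoSided l₁ l₂ r₁ r₂ T = inSecond (l₂ : Matrix n n R) * (inFirst (l₁ : Matrix n n R) * T *
    inFirst (r₁ : Matrix n n R)) * inSecond (r₂ : Matrix n n R) := by
  rw [twoSided_apply]
  simp only [mul_assoc]
  rw [(commute_inFirst_inSecond _ _).symm.eq, ← mul_assoc (inFirst _) (inSecond _),
    (commute_inFirst_inSecond _ _).eq, mul_assoc]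

theorem twoSided_injective (l₁ l₂ r₁ r₂ : (Matrix n n R)ˣ) :
    Function.Injective (twoSided l₁ l₂ r₁ r₂) := by
  have h : ∀ (u : (Matrix n n R)ˣ), IsUnit (inFirst (u : Matrix n n R)) ∧
      IsUnit (inSecond (u : Matrix n n R)) := fun u =>
    ⟨(unitFirst u).isUnit, (unitSecond u).isUnit⟩
  intro S T hST
  rw [twoSided_apply, twoSided_apply, (h r₁).1.mul_left_inj, (h l₁).1.mul_right_inj,
    (h r₂).2.mul_left_inj, (h l₂).2.mul_right_inj] at hST
  exact hST

variable {k : Type*} [CommRing k] [Algebra k R]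

/-- Fixing an entry in one leg leaves, up to sign, a derivation applied to the matrix in the other
leg, so each leg is controlled by its own logarithmic derivative. -/
theorem twoSided_tensorBracket_mem {P : PoissonBracket k R} {V V' : Submodule R (Matrix n n R)}
    {l₁ l₂ r₁ r₂ : (Matrix n n R)ˣ} {X Y : Matrix n n R}
    (hX : ∀ f, (l₁ : Matrix n n R) * X.map (P.br f) * r₁ ∈ V)
    (hY : ∀ f, (l₂ : Matrix n n R) * Y.map (P.br f) * r₂ ∈ V') :
    twoSided l₁ l₂ r₁ r₂ (tensorBracket P X Y) ∈ inLegOne V ⊓ inLegTwo V' := by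
  constructor
  · rw [twoSided_apply']
    refine inLegOne_mul_inSecond _ (inLegOne_inSecond_mul _ (mem_inLegOne.2 fun c d => ?_))
    rw [sliceOne_mul_inFirst, sliceOne_inFirst_mul, sliceOne_tensorBracket, mul_neg, neg_mul]
    exact neg_mem (hX _)
  · rw [twoSided_apply]
    refine inLegTwo_mul_inFirst _ (inLegTwo_inFirst_mul _ (mem_inLegTwo.2 fun c d => ?_))
    rw [sliceTwo_mul_inSecond, sliceTwo_inSecond_mul, sliceTwo_tensorBracket]
    exact hY _

/-- The values of the nine brackets of the factors of `U = mdp`. -/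
def brackets (S C : Matrix (n × n) (n × n) R) (m d p : Matrix n n R) :
    Fin 3 → Fin 3 → Matrix (n × n) (n × n) R :=
  ![![S * (inFirst m * inSecond m) - (inFirst m * inSecond m) * S
        + inFirst m * C * inSecond m - inSecond m * C * inFirst m,
      inSecond d * (C * inFirst m - inFirst m * C), 0],
    ![-(inFirst d * (C * inSecond m - inSecond m * C)), 0,
      inFirst d * (C * inSecond p - inSecond p * C)],
    ![0, -(inSecond d * (C * inFirst p - inFirst p * C)),
      S * (inFirst p * inSecond p) - (inFirst p * inSecond p) * S
        - inFirst p * C * inSecond p + inSecond p * C * inFirst p]]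

/-- The tensor `S - u₁u₂S(u₁u₂)⁻¹ - u₁Cu₁⁻¹ + u₂Cu₂⁻¹`. -/
def conjDefect (S C : Matrix (n × n) (n × n) R) (u : (Matrix n n R)ˣ) :
    Matrix (n × n) (n × n) R :=
  S - inFirst (u : Matrix n n R) * (inSecond (u : Matrix n n R) * S *
      inSecond ((u⁻¹ : (Matrix n n R)ˣ) : Matrix n n R)) *
        inFirst ((u⁻¹ : (Matrix n n R)ˣ) : Matrix n n R)
    - inFirst (u : Matrix n n R) * C * inFirst ((u⁻¹ : (Matrix n n R)ˣ) : Matrix n n R)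
    + inSecond (u : Matrix n n R) * C * inSecond ((u⁻¹ : (Matrix n n R)ˣ) : Matrix n n R)

/-- After normalisation the claimed values become conjugation defects of `S` and `C`, whose legs can
be located in the triangular decomposition. -/
theorem twoSided_brackets {m d p : (Matrix n n R)ˣ} {S C : Matrix (n × n) (n × n) R}
    (hd1 : Commute (inFirst (d : Matrix n n R)) C)
    (hd2 : Commute (inSecond (d : Matrix n n R)) C) :
    (twoSided m⁻¹ m⁻¹ 1 1 (brackets S C (m : Matrix n n R) d p 0 0) = conjDefect (-S) C m⁻¹ ∧
    twoSided m⁻¹ 1 1 d⁻¹ (brackets S C (m : Matrix n n R) d p 0 1) =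
      inFirst (m⁻¹ : (Matrix n n R)ˣ).val * C * inFirst (m : Matrix n n R) - C ∧
    twoSided 1 m⁻¹ d⁻¹ 1 (brackets S C (m : Matrix n n R) d p 1 0) =
      -(-(C - inSecond (m⁻¹ : (Matrix n n R)ˣ).val * C * inSecond (m : Matrix n n R)))) ∧
    twoSided 1 d d⁻¹ (p⁻¹ * d⁻¹) (brackets S C (m : Matrix n n R) d p 1 2) =
      -(inSecond (d : Matrix n n R) * (inSecond (p : Matrix n n R) * C *
        inSecond (p⁻¹ : (Matrix n n R)ˣ).val - C) * inSecond (d⁻¹ : (Matrix n n R)ˣ).val) ∧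
    twoSided d 1 (p⁻¹ * d⁻¹) d⁻¹ (brackets S C (m : Matrix n n R) d p 2 1) =
      inFirst (d : Matrix n n R) * (inFirst (p : Matrix n n R) * C *
        inFirst (p⁻¹ : (Matrix n n R)ˣ).val - C) * inFirst (d⁻¹ : (Matrix n n R)ˣ).val ∧
    twoSided d d (p⁻¹ * d⁻¹) (p⁻¹ * d⁻¹) (brackets S C (m : Matrix n n R) d p 2 2) =
      inFirst (d : Matrix n n R) * (inSecond (d : Matrix n n R) * conjDefect S C p *
        inSecond (d⁻¹ : (Matrix n n R)ˣ).val) * inFirst (d⁻¹ : (Matrix n n R)ˣ).val := by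
  have cs : ∀ X Y : Matrix n n R, inSecond X * inFirst Y = inFirst Y * inSecond X :=
    fun X Y => (commute_inFirst_inSecond Y X).symm.eq
  have cs' : ∀ (X Y : Matrix n n R) Z, inSecond X * (inFirst Y * Z) =
      inFirst Y * (inSecond X * Z) := fun X Y Z => by
    rw [← mul_assoc, cs, mul_assoc]
  have c1 : ∀ u : (Matrix n n R)ˣ, inFirst (u : Matrix n n R) *
      inFirst (u⁻¹ : (Matrix n n R)ˣ).val = 1 := inFirst_mul_inv
  have c2 : ∀ u : (Matrix n n R)ˣ, inSecond (u : Matrix n n R) *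
      inSecond (u⁻¹ : (Matrix n n R)ˣ).val = 1 := inSecond_mul_inv
  have c3 : ∀ u : (Matrix n n R)ˣ, inFirst (u⁻¹ : (Matrix n n R)ˣ).val *
      inFirst (u : Matrix n n R) = 1 := fun u => by
    rw [← inFirst_mul, Units.inv_mul, inFirst_one]
  have c4 : ∀ u : (Matrix n n R)ˣ, inSecond (u⁻¹ : (Matrix n n R)ˣ).val *
      inSecond (u : Matrix n n R) = 1 := fun u => by
    rw [← inSecond_mul, Units.inv_mul, inSecond_one]
  have c1' : ∀ (u : (Matrix n n R)ˣ) Z, inFirst (u : Matrix n n R) *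
      (inFirst (u⁻¹ : (Matrix n n R)ˣ).val * Z) = Z := fun u Z => by
    rw [← mul_assoc, c1, one_mul]
  have c2' : ∀ (u : (Matrix n n R)ˣ) Z, inSecond (u : Matrix n n R) *
      (inSecond (u⁻¹ : (Matrix n n R)ˣ).val * Z) = Z := fun u Z => by
    rw [← mul_assoc, c2, one_mul]
  have c3' : ∀ (u : (Matrix n n R)ˣ) Z, inFirst (u⁻¹ : (Matrix n n R)ˣ).val *
      (inFirst (u : Matrix n n R) * Z) = Z := fun u Z => by
    rw [← mul_assoc, c3, one_mul]
  have c4' : ∀ (u : (Matrix n n R)ˣ) Z, inSecond (u⁻¹ : (Matrix n n R)ˣ).val *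
      (inSecond (u : Matrix n n R) * Z) = Z := fun u Z => by
    rw [← mul_assoc, c4, one_mul]
  have dH1 : ∀ Z, inFirst (d : Matrix n n R) * (C * Z) = C * (inFirst (d : Matrix n n R) * Z) :=
    fun Z => by rw [← mul_assoc, hd1.eq, mul_assoc]
  have dH2 : ∀ Z, inSecond (d : Matrix n n R) * (C * Z) = C * (inSecond (d : Matrix n n R) * Z) :=
    fun Z => by rw [← mul_assoc, hd2.eq, mul_assoc]

  refine ⟨⟨?_, ?_, ?_⟩, ?_, ?_, ?_⟩
  -- In this entry `d₁` must pass factors of the second leg to reach `C` and cancel against `d₁⁻¹`,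
  -- so the opposite normal order of the legs is used first.
  case refine_4 =>
    have fs' : ∀ (X Y : Matrix n n R) Z, inFirst X * (inSecond Y * Z) =
      inSecond Y * (inFirst X * Z) := fun X Y Z => (cs' Y X Z).symm
    have fs : ∀ (X Y : Matrix n n R), inFirst X * inSecond Y =
      inSecond Y * inFirst X := fun X Y => (cs Y X).symm
    simp only [brackets, Matrix.cons_val, twoSided_apply, mul_add, add_mul, mul_sub, sub_mul, mul_neg, neg_mul, mul_assoc, fs, fs', c1, c2, c3, c4,
    c1', c2', c3', c4', dH1, dH2, inFirst_one, inSecond_one, one_mul, mul_one, mul_zero, zero_mul,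
    Units.val_mul, Units.val_one, inFirst_mul, inSecond_mul, inv_inv, sub_neg_eq_add, neg_sub, neg_neg]
  all_goals simp only [brackets, conjDefect, Matrix.cons_val, twoSided_apply, mul_add, add_mul, mul_sub, sub_mul, mul_neg, neg_mul, mul_assoc, cs, cs', c1, c2, c3, c4,
    c1', c2', c3', c4', dH1, dH2, inFirst_one, inSecond_one, one_mul, mul_one, mul_zero, zero_mul,
    Units.val_mul, Units.val_one, inFirst_mul, inSecond_mul, inv_inv, sub_neg_eq_add, neg_sub, neg_neg]
  all_goals abel

/-- The sum telescopes. The entry of `m` gives `m⁻¹Sm - S`, that of `p` gives `dSd⁻¹ - dpS(dp)⁻¹`,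
and `dSd⁻¹ = S`; the `C` terms cancel against the mixed entries. -/
theorem sum_twoSided {m d p u : (Matrix n n R)ˣ} (hu : u = m * d * p)
    {S C : Matrix (n × n) (n × n) R} (hd1 : Commute (inFirst (d : Matrix n n R)) C)
    (hd2 : Commute (inSecond (d : Matrix n n R)) C)
    (hdS : Commute (inFirst (d : Matrix n n R) * inSecond (d : Matrix n n R)) S) :
    ∑ i, ∑ j, twoSided (![m⁻¹, 1, d] i) (![m⁻¹, 1, d] j) (![1, d⁻¹, p⁻¹ * d⁻¹] i)
      (![1, d⁻¹, p⁻¹ * d⁻¹] j) (brackets S C (m : Matrix n n R) d p i j) =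
    twoSided m⁻¹ m⁻¹ (p⁻¹ * d⁻¹) (p⁻¹ * d⁻¹)
      (S * (inFirst (u : Matrix n n R) * inSecond (u : Matrix n n R))
        - (inFirst (u : Matrix n n R) * inSecond (u : Matrix n n R)) * S) := by
  have cs : ∀ X Y : Matrix n n R, inSecond X * inFirst Y = inFirst Y * inSecond X :=
    fun X Y => (commute_inFirst_inSecond Y X).symm.eq
  have cs' : ∀ (X Y : Matrix n n R) Z, inSecond X * (inFirst Y * Z) =
      inFirst Y * (inSecond X * Z) := fun X Y Z => by
    rw [← mul_assoc, cs, mul_assoc]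
  have c1 : ∀ u : (Matrix n n R)ˣ, inFirst (u : Matrix n n R) *
      inFirst (u⁻¹ : (Matrix n n R)ˣ).val = 1 := inFirst_mul_inv
  have c2 : ∀ u : (Matrix n n R)ˣ, inSecond (u : Matrix n n R) *
      inSecond (u⁻¹ : (Matrix n n R)ˣ).val = 1 := inSecond_mul_inv
  have c3 : ∀ u : (Matrix n n R)ˣ, inFirst (u⁻¹ : (Matrix n n R)ˣ).val *
      inFirst (u : Matrix n n R) = 1 := fun u => by
    rw [← inFirst_mul, Units.inv_mul, inFirst_one]
  have c4 : ∀ u : (Matrix n n R)ˣ, inSecond (u⁻¹ : (Matrix n n R)ˣ).val *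
      inSecond (u : Matrix n n R) = 1 := fun u => by
    rw [← inSecond_mul, Units.inv_mul, inSecond_one]
  have c1' : ∀ (u : (Matrix n n R)ˣ) Z, inFirst (u : Matrix n n R) *
      (inFirst (u⁻¹ : (Matrix n n R)ˣ).val * Z) = Z := fun u Z => by
    rw [← mul_assoc, c1, one_mul]
  have c2' : ∀ (u : (Matrix n n R)ˣ) Z, inSecond (u : Matrix n n R) *
      (inSecond (u⁻¹ : (Matrix n n R)ˣ).val * Z) = Z := fun u Z => by
    rw [← mul_assoc, c2, one_mul]
  have c3' : ∀ (u : (Matrix n n R)ˣ) Z, inFirst (u⁻¹ : (Matrix n n R)ˣ).val *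
      (inFirst (u : Matrix n n R) * Z) = Z := fun u Z => by
    rw [← mul_assoc, c3, one_mul]
  have c4' : ∀ (u : (Matrix n n R)ˣ) Z, inSecond (u⁻¹ : (Matrix n n R)ˣ).val *
      (inSecond (u : Matrix n n R) * Z) = Z := fun u Z => by
    rw [← mul_assoc, c4, one_mul]
  have dH1 : ∀ Z, inFirst (d : Matrix n n R) * (C * Z) = C * (inFirst (d : Matrix n n R) * Z) :=
    fun Z => by rw [← mul_assoc, hd1.eq, mul_assoc]
  have dH2 : ∀ Z, inSecond (d : Matrix n n R) * (C * Z) = C * (inSecond (d : Matrix n n R) * Z) :=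
    fun Z => by rw [← mul_assoc, hd2.eq, mul_assoc]

  have dS : inFirst (d : Matrix n n R) * (inSecond (d : Matrix n n R) * (S *
      (inFirst (d⁻¹ : (Matrix n n R)ˣ).val * inSecond (d⁻¹ : (Matrix n n R)ˣ).val))) = S := by
    rw [← mul_assoc, ← mul_assoc, hdS.eq, mul_assoc, mul_assoc, cs', c2, mul_one, c1, mul_one]
  simp only [Fin.sum_univ_three, brackets, Matrix.cons_val, map_zero, add_zero, zero_add]
  simp only [hu, twoSided_apply, mul_add, add_mul, mul_sub, sub_mul, mul_neg, neg_mul, mul_assoc, cs, cs', c1, c2, c3, c4,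
    c1', c2', c3', c4', dH1, dH2, inFirst_one, inSecond_one, one_mul, mul_one, mul_zero, zero_mul,
    Units.val_mul, Units.val_one, inFirst_mul, inSecond_mul, inv_inv, sub_neg_eq_add, neg_sub, neg_neg, dS]
  abel

/-- Leibniz rule in both legs: `m⁻¹ δ(mdp) (dp)⁻¹ = m⁻¹ δm + δd d⁻¹ + d δp p⁻¹ d⁻¹`. -/
theorem sum_twoSided_tensorBracket {k : Type*} [CommRing k] [Algebra k R]
    (P : PoissonBracket k R) {m d p u : (Matrix n n R)ˣ} (hu : u = m * d * p) :
    ∑ i, ∑ j, twoSided (![m⁻¹, 1, d] i) (![m⁻¹, 1, d] j) (![1, d⁻¹, p⁻¹ * d⁻¹] i)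
      (![1, d⁻¹, p⁻¹ * d⁻¹] j) (tensorBracket P ((![m, d, p] i : (Matrix n n R)ˣ) : Matrix n n R)
      ((![m, d, p] j : (Matrix n n R)ˣ) : Matrix n n R)) =
    twoSided m⁻¹ m⁻¹ (p⁻¹ * d⁻¹) (p⁻¹ * d⁻¹) (tensorBracket P (u : Matrix n n R) u) := by
  have cs : ∀ X Y : Matrix n n R, inSecond X * inFirst Y = inFirst Y * inSecond X :=
    fun X Y => (commute_inFirst_inSecond Y X).symm.eq
  have cs' : ∀ (X Y : Matrix n n R) Z, inSecond X * (inFirst Y * Z) =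
      inFirst Y * (inSecond X * Z) := fun X Y Z => by
    rw [← mul_assoc, cs, mul_assoc]
  have c1 : ∀ u : (Matrix n n R)ˣ, inFirst (u : Matrix n n R) *
      inFirst (u⁻¹ : (Matrix n n R)ˣ).val = 1 := inFirst_mul_inv
  have c2 : ∀ u : (Matrix n n R)ˣ, inSecond (u : Matrix n n R) *
      inSecond (u⁻¹ : (Matrix n n R)ˣ).val = 1 := inSecond_mul_inv
  have c3 : ∀ u : (Matrix n n R)ˣ, inFirst (u⁻¹ : (Matrix n n R)ˣ).val *
      inFirst (u : Matrix n n R) = 1 := fun u => by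
    rw [← inFirst_mul, Units.inv_mul, inFirst_one]
  have c4 : ∀ u : (Matrix n n R)ˣ, inSecond (u⁻¹ : (Matrix n n R)ˣ).val *
      inSecond (u : Matrix n n R) = 1 := fun u => by
    rw [← inSecond_mul, Units.inv_mul, inSecond_one]
  have c1' : ∀ (u : (Matrix n n R)ˣ) Z, inFirst (u : Matrix n n R) *
      (inFirst (u⁻¹ : (Matrix n n R)ˣ).val * Z) = Z := fun u Z => by
    rw [← mul_assoc, c1, one_mul]
  have c2' : ∀ (u : (Matrix n n R)ˣ) Z, inSecond (u : Matrix n n R) *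
      (inSecond (u⁻¹ : (Matrix n n R)ˣ).val * Z) = Z := fun u Z => by
    rw [← mul_assoc, c2, one_mul]
  have c3' : ∀ (u : (Matrix n n R)ˣ) Z, inFirst (u⁻¹ : (Matrix n n R)ˣ).val *
      (inFirst (u : Matrix n n R) * Z) = Z := fun u Z => by
    rw [← mul_assoc, c3, one_mul]
  have c4' : ∀ (u : (Matrix n n R)ˣ) Z, inSecond (u⁻¹ : (Matrix n n R)ˣ).val *
      (inSecond (u : Matrix n n R) * Z) = Z := fun u Z => by
    rw [← mul_assoc, c4, one_mul]
  simp only [Fin.sum_univ_three, Matrix.cons_val]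
  simp only [hu, twoSided_apply, tensorBracket_mul_left, tensorBracket_mul_right, mul_add, add_mul, mul_sub, sub_mul, mul_neg, neg_mul, mul_assoc, cs, cs', c1, c2, c3, c4,
    c1', c2', c3', c4', inFirst_one, inSecond_one, one_mul, mul_one, mul_zero, zero_mul,
    Units.val_mul, Units.val_one, inFirst_mul, inSecond_mul, inv_inv, sub_neg_eq_add, neg_sub, neg_neg]
  abel

end Place

/-! ### Uniqueness of the nine components. -/

section Gauss

variable {g : Type*} [LieRing g] [LieAlgebra ℝ g]
  {n : Type*} [Fintype n] [DecidableEq n] {R : Type*} [CommRing R] [Algebra ℝ R]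
  {J : Type*} [Fintype J] {h₀ : g} {e e' : J → g} {deg : J → ℤ}
  {ρ : g →ₗ[ℝ] Matrix n n ℝ}

/-- Independence is applied to the first legs of the row sums, then to the second legs within each
row. -/
theorem IsDualBasis.tensor_eq_zero (hd : IsDualBasis h₀ e e' deg) (hρ : IsFaithfulRep ρ)
    {T : Fin 3 → Fin 3 → Matrix (n × n) (n × n) R}
    {V : Fin 3 → Submodule R (Matrix n n R)}
    (hV : V = ![fil R (rep R ρ) (-h₀) 1, cartanSpan (rep R ρ) h₀, fil R (rep R ρ) h₀ 1])
    (hT : ∀ i j, T i j ∈ inLegOne (V i) ⊓ inLegTwo (V j)) (h : ∑ i, ∑ j, T i j = 0)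
    (i j : Fin 3) : T i j = 0 := by
  subst hV
  have h1 : ∀ i, ∑ j, T i j = 0 := by
    have hm := fun i => Submodule.sum_mem _ fun j (_ : j ∈ Finset.univ) => (hT i j).1
    rw [Fin.sum_univ_three] at h
    have := hd.legOne_eq_zero hρ (hm 0) (hm 1) (hm 2) h
    intro i
    fin_cases i
    exacts [this.1, this.2.1, this.2.2]
  have h2 := h1 i
  rw [Fin.sum_univ_three] at h2
  have := hd.legTwo_eq_zero hρ (hT i 0).2 (hT i 1).2 (hT i 2).2 h2
  fin_cases j
  exacts [this.1, this.2.1, this.2.2]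

variable {k : Type*} [CommRing k] [Algebra k R]

namespace IsGauss

variable {P : PoissonBracket k R} {m d p : (Matrix n n R)ˣ}

/-- The entries of `p` follow from the defects of `p` after conjugation by `d`, which preserves the
positive part. The entries of `m` are the same statements for `m⁻¹` and the reversed grading, for
which the tensor with weight `wSign` changes sign. -/
theorem twoSided_brackets_mem (G : IsGauss P ρ h₀ e e' deg m d p) (i j : Fin 3) :
    twoSided (![m⁻¹, 1, d] i) (![m⁻¹, 1, d] j) (![1, d⁻¹, p⁻¹ * d⁻¹] i)
      (![1, d⁻¹, p⁻¹ * d⁻¹] j) (brackets (degTensor (rep R ρ) e e' deg wSign)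
        (degTensor (rep R ρ) e e' deg wCartan) (m : Matrix n n R) d p i j) ∈
      inLegOne (![fil R (rep R ρ) (-h₀) 1, cartanSpan (rep R ρ) h₀, fil R (rep R ρ) h₀ 1] i) ⊓
      inLegTwo (![fil R (rep R ρ) (-h₀) 1, cartanSpan (rep R ρ) h₀, fil R (rep R ρ) h₀ 1] j) := by
  have hΩ : Commute (inFirst (m⁻¹ : (Matrix n n R)ˣ).val * inSecond (m⁻¹ : (Matrix n n R)ˣ).val)
      (degTensor (rep R ρ) e e' (fun j => -deg j) wOne) := by
    rw [(degTensor_neg_deg _).2.2]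
    have := Commute.units_inv_left (u := unitFirst m * unitSecond m) G.m_casimir
    rw [mul_inv_rev, Units.val_mul, ← map_inv, ← map_inv] at this
    rw [(commute_inFirst_inSecond _ _).eq]
    exact this
  have hm1 := nilTensor_mem_inLegOne G.dual.neg (inv_mem G.m_unip) hΩ
  have hm2 := nilTensor_mem_inLegTwo G.dual.neg (inv_mem G.m_unip) hΩ
  have hp1 := nilTensor_mem_inLegOne G.dual G.p_unip G.p_casimir
  have hp2 := nilTensor_mem_inLegTwo G.dual G.p_unip G.p_casimir
  have hpH := conj_wCartan_sub_mem G.dual G.p_unip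
  have hmH := conj_wCartan_sub_mem G.dual.neg (inv_mem G.m_unip)
  rw [nilTensor] at hm1 hm2 hp1 hp2
  rw [(degTensor_neg_deg _).1, (degTensor_neg_deg _).2.1] at hm1 hm2
  rw [(degTensor_neg_deg _).2.1, inv_inv] at hmH
  have hcs : cartanSpan (rep R ρ) (-h₀) = cartanSpan (rep R ρ) h₀ := by
    rw [cartanSpan, cartanSpan]
    congr 2
    ext v
    rw [SetLike.mem_coe, SetLike.mem_coe, mem_gr_neg, neg_zero]
  rw [hcs] at hmH
  obtain ⟨⟨b00, b01, b10⟩, b12, b21, b22⟩ := twoSided_brackets (m := m) (p := p)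
    (S := degTensor (rep R ρ) e e' deg wSign) G.d_wCartan.1 G.d_wCartan.2
  have cH1 : ∀ T ∈ inLegOne (fil R (rep R ρ) h₀ 1), inFirst (d : Matrix n n R) * T *
      inFirst (d⁻¹ : (Matrix n n R)ˣ).val ∈ inLegOne (fil R (rep R ρ) h₀ 1) :=
    fun T hT => inLegOne_conj G.d_conj hT
  have cH2 : ∀ T ∈ inLegTwo (fil R (rep R ρ) h₀ 1), inSecond (d : Matrix n n R) * T *
      inSecond (d⁻¹ : (Matrix n n R)ˣ).val ∈ inLegTwo (fil R (rep R ρ) h₀ 1) :=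
    fun T hT => inLegTwo_conj G.d_conj hT
  fin_cases i <;> fin_cases j
  · exact b00 ▸ ⟨hm1, hm2⟩
  · exact b01 ▸ hmH.1
  · simp [brackets]
  · exact b10 ▸ neg_mem (by rw [neg_sub]; exact hmH.2)
  · simp [brackets]
  · refine b12 ▸ Submodule.neg_mem _ ⟨?_, ?_⟩
    · exact inLegOne_mul_inSecond _ (inLegOne_inSecond_mul _ hpH.2.1)
    · exact cH2 _ hpH.2.2
  · simp [brackets]
  · exact b21 ▸ ⟨cH1 _ hpH.1.1, inLegTwo_mul_inFirst _ (inLegTwo_inFirst_mul _ hpH.1.2)⟩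
  · exact b22 ▸ ⟨cH1 _ (inLegOne_mul_inSecond _ (inLegOne_inSecond_mul _ hp1)),
      inLegTwo_mul_inFirst _ (inLegTwo_inFirst_mul _ (cH2 _ hp2))⟩

/-- The brackets of the factors of `U = mdp`, if `U` satisfies the Sklyanin bracket. -/
theorem tensorBracket_eq (G : IsGauss P ρ h₀ e e' deg m d p) {c : R}
    {u : (Matrix n n R)ˣ} (hu : u = m * d * p)
    (hU : tensorBracket P (u : Matrix n n R) u =
      c • (degTensor (rep R ρ) e e' deg wSign * (inFirst (u : Matrix n n R) *
          inSecond (u : Matrix n n R))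
        - (inFirst (u : Matrix n n R) * inSecond (u : Matrix n n R)) *
          degTensor (rep R ρ) e e' deg wSign)) (i j : Fin 3) :
    tensorBracket P ((![m, d, p] i : (Matrix n n R)ˣ) : Matrix n n R)
      ((![m, d, p] j : (Matrix n n R)ˣ) : Matrix n n R) =
      c • brackets (degTensor (rep R ρ) e e' deg wSign) (degTensor (rep R ρ) e e' deg wCartan)
        (m : Matrix n n R) d p i j := by
  -- The normalised derivatives of `m`, `d` and `p` lie in the negative, Cartan and positive part
  -- respectively.
  have hder : ∀ i f, ((![m⁻¹, 1, d] i : (Matrix n n R)ˣ) : Matrix n n R) *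
      ((![m, d, p] i : (Matrix n n R)ˣ) : Matrix n n R).map (P.br f) *
        ((![1, d⁻¹, p⁻¹ * d⁻¹] i : (Matrix n n R)ˣ) : Matrix n n R) ∈
      ![fil R (rep R ρ) (-h₀) 1, cartanSpan (rep R ρ) h₀, fil R (rep R ρ) h₀ 1] i := by
    intro i f
    fin_cases i
    · have := unip_conj_mem (inv_mem G.m_unip) (G.m_deriv f)
      rw [inv_inv, mul_assoc, Units.inv_mul_cancel_right] at this
      simpa using this
    · simpa using G.d_deriv f
    · simpa [mul_assoc] using G.d_conj _ (G.p_deriv f)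
  -- The differences between the true and the claimed brackets lie in independent spaces and add up
  -- to zero.
  have hTC := fun i j => Submodule.sub_mem _
    (twoSided_tensorBracket_mem (P := P) (hder i) (hder j))
    (Submodule.smul_mem _ c (G.twoSided_brackets_mem i j))
  have := G.dual.tensor_eq_zero G.faithful rfl hTC (by
    simp only [Finset.sum_sub_distrib, ← Finset.smul_sum]
    rw [sum_twoSided_tensorBracket P hu, sum_twoSided hu G.d_wCartan.1 G.d_wCartan.2
      (G.d_tensor wSign), hU, map_smul, sub_self]) i j
  rw [← map_smul, sub_eq_zero] at this
  exact twoSided_injective _ _ _ _ this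

end IsGauss

end Gauss

/-! ### The torus part -/

section Torus

variable {g : Type*} [LieRing g] [LieAlgebra ℝ g]
  {n : Type*} [Fintype n] [DecidableEq n] {R : Type*} [CommRing R] [Algebra ℝ R]
  {k : Type*} [CommRing k] [Algebra k R] {K : Type*} [Fintype K] [DecidableEq K]
  {P : PoissonBracket k R} {ρ : g →ₗ[ℝ] Matrix n n ℝ} {h₀ : g} {Z y : K → g} {q : K → R}
  {x : K → (Matrix n n R)ˣ} {d : (Matrix n n R)ˣ}

/-- A product of exponentials of elements of degree zero. -/
structure IsTorusProduct (P : PoissonBracket k R) (ρ : g →ₗ[ℝ] Matrix n n ℝ) (h₀ : g)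
    (Z y : K → g) (q : K → R) (x : K → (Matrix n n R)ˣ) (d : (Matrix n n R)ˣ) : Prop where
  faithful : IsFaithfulRep ρ
  mem : ∀ i, Z i ∈ gr h₀ 0
  abel : ∀ v ∈ gr h₀ 0, ∀ w ∈ gr h₀ 0, ⁅v, w⁆ = 0
  dual : ∀ i j, killingForm ℝ g (y i) (Z j) = if i = j then 1 else 0
  exp : ∀ i, IsExpElt P (rep R ρ) (q i) (Z i) (x i)
  prod : d = (Finset.univ.toList.map x).prod

namespace IsTorusProduct

theorem mul_rep_list_prod {r : g →ₗ[ℝ] Matrix n n R} (hx : ∀ i, IsExpElt P r (q i) (Z i) (x i))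
    {v : g} {χ : K → ℝ} (hv : ∀ i, ⁅Z i, v⁆ = χ i • v) (l : List K) :
    ∃ c : R, ((l.map x).prod : Matrix n n R) * r v =
      c • (r v * ((l.map x).prod : (Matrix n n R)ˣ)) := by
  induction l with
  | nil => exact ⟨1, by simp⟩
  | cons i l ih =>
    obtain ⟨c, hc⟩ := ih
    obtain ⟨c', hc'⟩ := (hx i).eig _ _ (hv i)
    refine ⟨c * c', ?_⟩
    rw [List.map_cons, List.prod_cons, Units.val_mul, mul_assoc, hc, mul_smul_comm, ← mul_assoc,
      hc', smul_mul_assoc, smul_smul, mul_assoc]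

theorem list_prod_tensor {r : g →ₗ[ℝ] Matrix n n R} (hx : ∀ i, IsExpElt P r (q i) (Z i) (x i))
    {Ω : Matrix (n × n) (n × n) R}
    (hΩ : ∀ i, Commute (inFirst (r (Z i)) + inSecond (r (Z i))) Ω) (l : List K) :
    Commute (inFirst ((l.map x).prod : (Matrix n n R)ˣ).val *
      inSecond ((l.map x).prod : (Matrix n n R)ˣ).val) Ω := by
  induction l with
  | nil =>
    rw [List.map_nil, List.prod_nil, Units.val_one, inFirst_one, inSecond_one, one_mul]
    exact Commute.one_left _
  | cons i l ih =>
    rw [List.map_cons, List.prod_cons, Units.val_mul, inFirst_mul, inSecond_mul, mul_assoc,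
      ← mul_assoc (inFirst ((l.map x).prod : (Matrix n n R)ˣ).val),
      (commute_inFirst_inSecond ((l.map x).prod : (Matrix n n R)ˣ).val _).eq, mul_assoc,
      ← mul_assoc]
    exact ((hx i).tensor Ω (hΩ i)).mul_left ih

variable (T : IsTorusProduct P ρ h₀ Z y q x d)

include T

theorem commute_rep {v : g} (hv : v ∈ gr h₀ 0) : Commute (d : Matrix n n R) (rep R ρ v) := by
  rw [T.prod]
  induction (Finset.univ : Finset K).toList with
  | nil => simp
  | cons i l ih =>
    rw [List.map_cons, List.prod_cons, Units.val_mul]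
    refine Commute.mul_left ?_ ih
    have h := (T.exp i).conj_of_lie_eq_zero (T.abel _ (T.mem i) v hv)
    rw [Units.mul_inv_eq_iff_eq_mul] at h
    exact h

theorem map_br (f : R) : (d : Matrix n n R).map (P.br f) =
    (∑ i, P.br f (q i) • rep R ρ (Z i)) * d := by
  have hl : ∀ l : List K, logDeriv (rep R ρ) Z x (fun i => P.br f (q i)) l =
      (l.map fun i => P.br f (q i) • rep R ρ (Z i)).sum := by
    intro l
    induction l with
    | nil => rfl
    | cons i l ih =>
      rw [logDeriv, ih, List.map_cons, List.sum_cons]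
      congr 1
      -- The exponents commute, so no conjugation survives in the logarithmic derivative and it
      -- reduces to a plain sum.
      have : ∀ l : List K, Commute (x i : Matrix n n R)
          (l.map fun i => P.br f (q i) • rep R ρ (Z i)).sum := by
        intro l
        induction l with
        | nil => simp
        | cons j l ih =>
          rw [List.map_cons, List.sum_cons]
          refine Commute.add_right (Commute.smul_right ?_ _) ih
          have h := (T.exp i).conj_of_lie_eq_zero (T.abel _ (T.mem i) _ (T.mem j))
          rw [Units.mul_inv_eq_iff_eq_mul] at h
          exact h
      rw [(this l).eq, Units.mul_inv_cancel_right]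
  rw [T.prod, map_br_list_prod T.exp, hl, Finset.sum_map_toList]

theorem map_br_mul_inv (f : R) : (d : Matrix n n R).map (P.br f) * (d⁻¹ : (Matrix n n R)ˣ) =
    ∑ i, P.br f (q i) • rep R ρ (Z i) := by
  rw [T.map_br, Units.mul_inv_cancel_right]

theorem map_br_mem (f : R) : (d : Matrix n n R).map (P.br f) * (d⁻¹ : (Matrix n n R)ˣ) ∈
    cartanSpan (rep R ρ) h₀ := by
  rw [T.map_br_mul_inv]
  exact Submodule.sum_mem _ fun i _ => Submodule.smul_mem _ _
    (Submodule.subset_span ⟨_, T.mem i, rfl⟩)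

theorem coef_map_br_mul_inv (f : R) (i : K) : coef R ρ (killingForm ℝ g (y i))
    ((d : Matrix n n R).map (P.br f) * (d⁻¹ : (Matrix n n R)ˣ)) = P.br f (q i) := by
  rw [T.map_br_mul_inv, map_sum, Finset.sum_eq_single i]
  · rw [map_smul, coef_rep T.faithful, T.dual, if_pos rfl, map_one, smul_eq_mul, mul_one]
  · intro j _ hj
    rw [map_smul, coef_rep T.faithful, T.dual, if_neg hj.symm, map_zero, smul_zero]
  · simp

/-- The brackets with the exponents of the torus part, from the brackets with the torus part. -/
theorem map_br_exponent (i : K) (X : Matrix n n R) :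
    X.map (P.br (q i)) = legOne R ρ (killingForm ℝ g (y i))
      (tensorBracket P (d : Matrix n n R) X * inFirst (d⁻¹ : (Matrix n n R)ˣ).val) := by
  ext a b
  rw [legOne_apply]
  have : (Matrix.of fun i j => (tensorBracket P (d : Matrix n n R) X *
      inFirst (d⁻¹ : (Matrix n n R)ˣ).val) (i, a) (j, b)) =
      -((d : Matrix n n R).map (P.br (X a b)) * (d⁻¹ : (Matrix n n R)ˣ)) := by
    change sliceOne _ a b = _
    rw [sliceOne_mul_inFirst, sliceOne_tensorBracket, neg_mul]
  rw [this, map_neg, T.coef_map_br_mul_inv, Matrix.map_apply, P.skew]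

theorem br_exponent_eq_zero (h : tensorBracket P (d : Matrix n n R) d = 0) (i j : K) :
    P.br (q i) (q j) = 0 := by
  rw [← T.coef_map_br_mul_inv, T.map_br_exponent i, h, zero_mul, map_zero, zero_mul, map_zero]

/-- The action of the exponents of the torus part. -/
theorem map_br_exponent_of_eq {J : Type*} [Fintype J] {e e' : J → g} {deg : J → ℤ}
    (hd : IsDualBasis h₀ e e' deg) {c : R} {X : Matrix n n R}
    (h : tensorBracket P (d : Matrix n n R) X = c • (inFirst (d : Matrix n n R) *
      (degTensor (rep R ρ) e e' deg wCartan * inSecond X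
        - inSecond X * degTensor (rep R ρ) e e' deg wCartan)))
    (hc : Commute (inFirst (d : Matrix n n R)) (degTensor (rep R ρ) e e' deg wCartan))
    {i : K} (hy : y i ∈ gr h₀ 0) :
    X.map (P.br (q i)) = c • (rep R ρ (y i) * X - X * rep R ρ (y i)) := by
  have hy' := hy
  rw [← neg_zero] at hy'
  rw [T.map_br_exponent i, h]
  have e1 : (c • (inFirst (d : Matrix n n R) *
      (degTensor (rep R ρ) e e' deg wCartan * inSecond X
        - inSecond X * degTensor (rep R ρ) e e' deg wCartan))) *
          inFirst (d⁻¹ : (Matrix n n R)ˣ).val =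
      c • (degTensor (rep R ρ) e e' deg wCartan * inSecond X
        - inSecond X * degTensor (rep R ρ) e e' deg wCartan) := by
    rw [smul_mul_assoc]
    congr 1
    -- Since `d₁` commutes with `H₁₂` and with `X₂`, it cancels against `d₁⁻¹`, and the contraction
    -- of `H₁₂` with the Cartan element `y i` is `y i` itself.
    have h1 : Commute (inFirst (d : Matrix n n R)) (degTensor (rep R ρ) e e' deg wCartan * inSecond X
        - inSecond X * degTensor (rep R ρ) e e' deg wCartan) :=
      (hc.mul_right (commute_inFirst_inSecond _ _)).sub_right
        ((commute_inFirst_inSecond _ _).mul_right hc)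
    rw [h1.eq, mul_assoc, inFirst_mul_inv, mul_one]
  rw [e1, map_smul, map_sub, legOne_mul_inSecond, legOne_inSecond_mul,
    legOne_degTensor hd T.faithful hy', wCartan, if_pos rfl, one_smul]

theorem eig {v : g} {χ : K → ℝ} (hv : ∀ i, ⁅Z i, v⁆ = χ i • v) :
    ∃ c : R, (d : Matrix n n R) * rep R ρ v = c • (rep R ρ v * d) := by
  rw [T.prod]
  exact mul_rep_list_prod T.exp hv _

theorem tensor {J : Type*} [Fintype J] {e e' : J → g} {deg : J → ℤ}
    (hd : IsDualBasis h₀ e e' deg) (w : ℤ → ℝ) :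
    Commute (inFirst (d : Matrix n n R) * inSecond (d : Matrix n n R))
      (degTensor (rep R ρ) e e' deg w) := by
  rw [T.prod]
  exact list_prod_tensor T.exp (fun i => commute_degTensor hd T.faithful (T.mem i) w) _

end IsTorusProduct

end Torus

/-! ### Gauss data built from products of exponentials. -/

section Gauss

variable {g : Type*} [LieRing g] [LieAlgebra ℝ g]
  {n : Type*} [Fintype n] [DecidableEq n] {R : Type*} [CommRing R] [Algebra ℝ R]
  {k : Type*} [Field k] [Algebra k R] {K : Type*} [Fintype K] [DecidableEq K]
  {P : PoissonBracket k R} {ρ : g →ₗ[ℝ] Matrix n n ℝ} {h₀ : g} {Z y : K → g} {q : K → R}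
  {xd : K → (Matrix n n R)ˣ} {m d p : (Matrix n n R)ˣ} {N : ℕ} {ι : Type*}
  {X Y : Fin N → g} {ht : Fin N → ℤ} {s : ι → Fin N} {a a' : Fin N → R}
  {x x' : Fin N → (Matrix n n R)ˣ} {u : (Matrix n n R)ˣ}
  {J : Type*} [Fintype J] {e e' : J → g} {deg : J → ℤ}

namespace IsTriangularProduct

theorem commute_casimir (T : IsTriangularProduct P ρ h₀ X Y ht s a x u)
    (hd : IsDualBasis h₀ e e' deg) :
    Commute (inFirst (u : Matrix n n R) * inSecond (u : Matrix n n R))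
      (degTensor (rep R ρ) e e' deg wOne) := by
  rw [T.eq_prod]
  exact IsTorusProduct.list_prod_tensor T.exp (fun i => commute_degTensor_one hd T.faithful _) _

theorem map_br_mem (T : IsTriangularProduct P ρ h₀ X Y ht s a x u) (f : R) :
    (u : Matrix n n R).map (P.br f) * (u⁻¹ : (Matrix n n R)ˣ) ∈ fil R (rep R ρ) h₀ 1 := by
  rw [T.map_br, Units.mul_inv_cancel_right]
  have := T.family.logDeriv_sub_sum_mem (h := 0) (d := fun i => P.br f (a i))
    (fun i hi => absurd (T.pos i) (by omega)) (List.finRange N)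
  rw [zero_add, sum_map_finRange, Finset.sum_eq_zero, sub_zero] at this
  · exact this
  · intro i _
    have := T.pos i
    rw [if_neg (by omega)]

/-- Injectivity of the logarithmic derivative is used twice, once for each of the two products. -/
theorem br_eq_zero_of_tensorBracket (T : IsTriangularProduct P ρ h₀ X Y ht s a x u) {h₁ : g}
    {X' Y' : Fin N → g} {ht' : Fin N → ℤ} {s' : ι → Fin N} {u' : (Matrix n n R)ˣ}
    (T' : IsTriangularProduct P ρ h₁ X' Y' ht' s' a' x' u')
    (h : tensorBracket P (u : Matrix n n R) u' = 0) (i j : Fin N) : P.br (a i) (a' j) = 0 := by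
  refine T'.br_eq_zero_of_map_br ?_ j
  ext b c
  rw [Matrix.map_apply, P.skew, Matrix.zero_apply, neg_eq_zero]
  refine T.br_eq_zero_of_map_br ?_ i
  ext b' c'
  rw [Matrix.map_apply, P.skew, Matrix.zero_apply, neg_eq_zero]
  exact congrFun (congrFun h (b', b)) (c', c)

end IsTriangularProduct

theorem isGauss_of_products (hd : IsDualBasis h₀ e e' deg)
    (D : IsTorusProduct P ρ h₀ Z y q xd d) {χ : J → K → ℝ}
    (hχ : ∀ j i, ⁅Z i, e j⁆ = χ j i • e j)
    (T : IsTriangularProduct P ρ h₀ X Y ht s a x p) {X' Y' : Fin N → g} {ht' : Fin N → ℤ}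
    {s' : ι → Fin N} (T' : IsTriangularProduct P ρ (-h₀) X' Y' ht' s' a' x' m) :
    IsGauss P ρ h₀ e e' deg m d p where
  dual := hd
  faithful := D.faithful
  p_unip := T.mem_unip
  p_casimir := T.commute_casimir hd
  p_deriv := T.map_br_mem
  m_unip := T'.mem_unip
  m_casimir := by
    have := T'.commute_casimir hd.neg
    rwa [(degTensor_neg_deg _).2.2] at this
  m_deriv := T'.map_br_mem
  d_comm _ := D.commute_rep
  d_eig j := D.eig (hχ j)
  d_tensor := D.tensor hd
  d_deriv := D.map_br_mem

end Gauss

/-! ### Matrix exponentials -/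

section MatrixExp

open NormedSpace (exp)

variable {n : Type*} [Fintype n] [DecidableEq n]

section

open scoped Matrix.Norms.Operator

theorem hasDerivAt_exp_smul_apply (A : Matrix n n ℂ) (t : ℂ) (i j : n) :
    HasDerivAt (fun u : ℂ => exp (u • A) i j) ((A * exp (t • A)) i j) t := by
  have h := hasDerivAt_exp_smul_const' (𝕂 := ℂ) A t
  exact ((LinearMap.toContinuousLinearMap (Matrix.entryLinearMap ℂ ℂ i j)).hasFDerivAt.comp_hasDerivAt
    t h)

theorem semiconjBy_exp {x a b : Matrix n n ℂ} (h : x * a = b * x) : x * exp a = exp b * x :=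
  SemiconjBy.exp_right h

theorem exp_inFirst (A : Matrix n n ℂ) : exp (inFirst A) = inFirst (exp A) := by
  let f : Matrix n n ℂ →ₐ[ℂ] Matrix (n × n) (n × n) ℂ :=
    AlgHom.ofLinearMap
      { toFun := inFirst
        map_add' := fun X Y => Matrix.add_kronecker X Y 1
        map_smul' := fun c X => Matrix.smul_kronecker c X 1 } inFirst_one inFirst_mul
  exact (NormedSpace.map_exp f f.toLinearMap.continuous_of_finiteDimensional A).symm

theorem exp_inSecond (A : Matrix n n ℂ) : exp (inSecond A) = inSecond (exp A) := by
  let f : Matrix n n ℂ →ₐ[ℂ] Matrix (n × n) (n × n) ℂ :=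
    AlgHom.ofLinearMap
      { toFun := inSecond
        map_add' := fun X Y => Matrix.kronecker_add 1 X Y
        map_smul' := fun c X => Matrix.kronecker_smul c 1 X } inSecond_one inSecond_mul
  exact (NormedSpace.map_exp f f.toLinearMap.continuous_of_finiteDimensional A).symm

end

theorem differentiable_exp_smul_apply (A : Matrix n n ℂ) (i j : n) :
    Differentiable ℂ (fun u : ℂ => exp (u • A) i j) :=
  fun t => (hasDerivAt_exp_smul_apply A t i j).differentiableAt

theorem exp_smul_mul_exp_neg_smul (A : Matrix n n ℂ) (z : ℂ) :
    exp (z • A) * exp ((-z) • A) = 1 := by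
  rw [← Matrix.exp_add_of_commute _ _ (by simp), neg_smul, add_neg_cancel, NormedSpace.exp_zero]

-- The polynomial on the right solves `Q' = [A, Q]` with `Q 0 = W 0`. Hence `exp(-zA) Q(z) exp(zA)`
-- has derivative zero and is constant.
open scoped Matrix.Norms.Operator in
theorem exp_conj_eq_sum (A : Matrix n n ℂ) (W : ℕ → Matrix n n ℂ)
    (hs : ∀ j, A * W j - W j * A = W (j + 1)) {K : ℕ} (hK : W K = 0) (z : ℂ) :
    exp (z • A) * W 0 * exp ((-z) • A) =
      ∑ j ∈ Finset.range K, ((j.factorial : ℂ)⁻¹ * z ^ j) • W j := by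
  cases K with
  | zero => rw [hK]; simp
  | succ K =>
    set Q : ℂ → Matrix n n ℂ :=
      fun z => ∑ j ∈ Finset.range (K + 1), ((j.factorial : ℂ)⁻¹ * z ^ j) • W j with hQ
    have hQd : ∀ z, HasDerivAt Q (A * Q z - Q z * A) z := by
      intro z
      have h1 : HasDerivAt Q (∑ j ∈ Finset.range (K + 1),
          ((j.factorial : ℂ)⁻¹ * (j * z ^ (j - 1))) • W j) z :=
        HasDerivAt.fun_sum fun j _ => ((hasDerivAt_pow j z).const_mul _).smul_const _
      convert h1 using 1
      rw [hQ]
      simp only [Finset.mul_sum, Finset.sum_mul, ← Finset.sum_sub_distrib, mul_smul_comm,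
        smul_mul_assoc, ← smul_sub, hs]
      -- The commutator shifts the index up and the derivative shifts the power down. The top term
      -- drops on one side and the constant term on the other.
      rw [Finset.sum_range_succ, hK, smul_zero, add_zero, Finset.sum_range_succ']
      simp only [Nat.cast_zero, zero_mul, mul_zero, zero_smul, add_zero, Nat.add_sub_cancel]
      refine Finset.sum_congr rfl fun j _ => ?_
      congr 1
      rw [Nat.factorial_succ]
      have : ((j : ℂ) + 1) ≠ 0 := by exact_mod_cast j.succ_ne_zero
      push_cast
      field_simp
    have hG : ∀ z, HasDerivAt (fun z => exp ((-z) • A) * Q z * exp (z • A)) 0 z := by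
      intro z
      have e1 : HasDerivAt (fun u : ℂ => exp ((-u) • A)) (-(exp ((-z) • A) * A)) z := by
        refine HasDerivAt.congr_deriv
          ((hasDerivAt_exp_smul_const (𝕂 := ℂ) A (-z)).scomp z (hasDerivAt_neg z)) ?_
        exact neg_one_smul ℂ _
      have e2 := hasDerivAt_exp_smul_const' (𝕂 := ℂ) A z
      refine ((e1.mul (hQd z)).mul e2).congr_deriv ?_
      change (-(exp ((-z) • A) * A) * Q z + exp ((-z) • A) * (A * Q z - Q z * A)) * exp (z • A)
        + exp ((-z) • A) * Q z * (A * exp (z • A)) = 0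
      generalize exp ((-z) • A) = E
      noncomm_ring
    have h0 := is_const_of_deriv_eq_zero (𝕜 := ℂ) (fun z => (hG z).differentiableAt)
      (fun z => (hG z).deriv) z 0
    simp only [neg_zero, zero_smul, NormedSpace.exp_zero, one_mul, mul_one] at h0
    have hQ0 : Q 0 = W 0 := by
      simp [hQ, Finset.sum_range_succ']
    rw [hQ0] at h0
    have h1 := exp_smul_mul_exp_neg_smul A z
    rw [← h0, mul_assoc, mul_assoc, h1, mul_one, ← mul_assoc, h1, one_mul]

end MatrixExp

/-! ### Exponentials of matrices of smooth functions -/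

section SmoothExp

open NormedSpace (exp)

variable {EM : Type*} [NormedAddCommGroup EM] [NormedSpace ℝ EM] {HM : Type*} [TopologicalSpace HM]
  {I : ModelWithCorners ℝ EM HM} {M : Type*} [TopologicalSpace M] [ChartedSpace HM M]
  {n : Type*} [Fintype n] [DecidableEq n]

/-- The composition of a smooth function with an entire function. -/
def compEntire (φ : ℂ → ℂ) (hφ : Differentiable ℂ φ) (a : SmoothC I M) : SmoothC I M :=
  ⟨fun m => φ (a m), (hφ.contDiff.restrict_scalars ℝ).contMDiff.comp a.contMDiff⟩

/-- The chain rule from the Leibniz rule alone, by Hadamard's trick: `φ ∘ a = φ(a m) + (a - a m) ψ ∘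
a` with `ψ` the difference quotient of `φ` at `a m`. After the bracket, evaluation at `m` kills the
term that still contains `a - a m`. -/
theorem br_compEntire_apply (P : PoissonBracket ℂ (SmoothC I M)) (f a : SmoothC I M) {φ : ℂ → ℂ}
    (hφ : Differentiable ℂ φ) (m : M) :
    P.br f (compEntire φ hφ a) m = P.br f a m * deriv φ (a m) := by
  have hψ : Differentiable ℂ (dslope φ (a m)) := by
    rw [← differentiableOn_univ] at hφ ⊢
    exact (Complex.differentiableOn_dslope Filter.univ_mem).2 hφ
  have h : compEntire φ hφ a = algebraMap ℂ (SmoothC I M) (φ (a m)) +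
      (a - algebraMap ℂ (SmoothC I M) (a m)) * compEntire _ hψ a := by
    ext m'
    have := sub_smul_dslope φ (a m) (a m')
    rw [smul_eq_mul] at this
    change φ (a m') = φ (a m) + (a m' - a m) * dslope φ (a m) (a m')
    rw [this]; ring
  rw [h, map_add, P.br_algebraMap, P.leibniz, map_sub, P.br_algebraMap, sub_zero, zero_add]
  change P.br f a m * dslope φ (a m) (a m) + (a m - a m) * _ = _
  rw [dslope_same, sub_self, zero_mul, add_zero]

/-- Evaluation at a point. -/
def evalAt (m : M) : SmoothC I M →+* ℂ where
  toFun f := f m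
  map_one' := rfl
  map_mul' _ _ := rfl
  map_zero' := rfl
  map_add' _ _ := rfl

theorem matrix_ext_evalAt {l l' : Type*} {X Y : Matrix l l' (SmoothC I M)}
    (h : ∀ m, X.map (evalAt m) = Y.map (evalAt m)) : X = Y := by
  ext i j m
  exact congrFun (congrFun (h m) i) j

theorem map_evalAt_inFirst (X : Matrix n n (SmoothC I M)) (m : M) :
    (inFirst X).map (evalAt m) = inFirst (X.map (evalAt m)) := by
  ext ⟨i, j⟩ ⟨i', j'⟩
  simp [inFirst, Matrix.one_apply, apply_ite (evalAt m)]

theorem map_evalAt_inSecond (X : Matrix n n (SmoothC I M)) (m : M) :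
    (inSecond X).map (evalAt m) = inSecond (X.map (evalAt m)) := by
  ext ⟨i, j⟩ ⟨i', j'⟩
  simp [inSecond, Matrix.one_apply, apply_ite (evalAt m)]

open scoped Matrix.Norms.Operator in
theorem exp_smul_one (z : ℂ) : exp (z • (1 : Matrix n n ℂ)) = Complex.exp z • 1 := by
  rw [← Algebra.algebraMap_eq_smul_one, ← Algebra.algebraMap_eq_smul_one, Complex.exp_eq_exp_ℂ,
    NormedSpace.algebraMap_exp_comm]
  rfl

theorem evalAt_algebraMap (c : ℝ) (m : M) :
    evalAt m (algebraMap ℝ (SmoothC I M) c) = (c : ℂ) := rfl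

/-- The matrix `exp(a A)`. -/
def expMatrix (a : SmoothC I M) (A : Matrix n n ℂ) : Matrix n n (SmoothC I M) :=
  Matrix.of fun i j => compEntire _ (differentiable_exp_smul_apply A i j) a

theorem map_evalAt_expMatrix (a : SmoothC I M) (A : Matrix n n ℂ) (m : M) :
    (expMatrix a A).map (evalAt m) = exp (a m • A) := rfl

theorem expMatrix_mul_neg (a : SmoothC I M) (A : Matrix n n ℂ) :
    expMatrix a A * expMatrix (-a) A = 1 := by
  refine matrix_ext_evalAt fun m => ?_
  rw [Matrix.map_mul, map_evalAt_expMatrix, map_evalAt_expMatrix, Matrix.map_one _ (map_zero _)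
    (map_one _)]
  exact exp_smul_mul_exp_neg_smul A (a m)

/-- The matrix `exp(a A)`, as a unit. -/
def expUnit (a : SmoothC I M) (A : Matrix n n ℂ) : (Matrix n n (SmoothC I M))ˣ where
  val := expMatrix a A
  inv := expMatrix (-a) A
  val_inv := expMatrix_mul_neg a A
  inv_val := by simpa using expMatrix_mul_neg (-a) A

theorem expUnit_inv (a : SmoothC I M) (A : Matrix n n ℂ) :
    (expUnit a A)⁻¹ = expUnit (-a) A := Units.ext rfl

variable {g : Type*} [LieRing g] [LieAlgebra ℝ g] {ρ : g →ₗ[ℝ] Matrix n n ℝ}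

theorem map_evalAt_rep (X : g) (m : M) :
    (rep (SmoothC I M) ρ X).map (evalAt m) = rhoC ρ X := rfl

theorem rhoC_lie (hρ : IsFaithfulRep ρ) (X Y : g) :
    rhoC ρ ⁅X, Y⁆ = rhoC ρ X * rhoC ρ Y - rhoC ρ Y * rhoC ρ X := rep_lie (R := ℂ) hρ X Y

theorem rhoC_smul (c : ℝ) (X : g) : rhoC ρ (c • X) = (c : ℂ) • rhoC ρ X := by
  ext i j
  simp [rhoC]

theorem map_br_expUnit (P : PoissonBracket ℂ (SmoothC I M)) (f a : SmoothC I M) (X : g) :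
    (expUnit a (rhoC ρ X)).val.map (P.br f) =
      P.br f a • (rep (SmoothC I M) ρ X * (expUnit a (rhoC ρ X)).val) := by
  refine matrix_ext_evalAt fun m => ?_
  ext i j
  have h := br_compEntire_apply P f a (differentiable_exp_smul_apply (rhoC ρ X) i j) m
  rw [(hasDerivAt_exp_smul_apply (rhoC ρ X) (a m) i j).deriv] at h
  refine h.trans ?_
  have h2 : (P.br f a • (rep (SmoothC I M) ρ X * (expUnit a (rhoC ρ X)).val)).map (evalAt m) =
      (P.br f a m) • (rhoC ρ X * exp (a m • rhoC ρ X)) := by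
    rw [← map_evalAt_expMatrix, ← map_evalAt_rep (I := I) (M := M) X m, ← Matrix.map_mul]
    rfl
  rw [h2]; rfl

theorem expUnit_conj (hρ : IsFaithfulRep ρ) (a : SmoothC I M) (X : g) {K : ℕ} {v : g}
    (hK : (LieAlgebra.ad ℝ g X ^ K) v = 0) :
    (expUnit a (rhoC ρ X)).val * rep (SmoothC I M) ρ v * ((expUnit a (rhoC ρ X))⁻¹).val =
      ∑ j ∈ Finset.range K, (algebraMap ℝ (SmoothC I M) (j.factorial : ℝ)⁻¹ * a ^ j) •
        rep (SmoothC I M) ρ ((LieAlgebra.ad ℝ g X ^ j) v) := by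
  rw [expUnit_inv]
  refine matrix_ext_evalAt fun m => ?_
  have h := exp_conj_eq_sum (rhoC ρ X) (fun j => rhoC ρ ((LieAlgebra.ad ℝ g X ^ j) v))
    (fun j => by rw [← rhoC_lie hρ, pow_succ', Module.End.mul_apply, LieAlgebra.ad_apply])
    (K := K) (by rw [hK]; exact map_zero (rep ℂ ρ)) (a m)
  rw [Matrix.map_mul, Matrix.map_mul]
  refine h.trans ?_
  ext i j
  simp only [Matrix.map_apply, Matrix.sum_apply, map_sum, Matrix.smul_apply, smul_eq_mul,
    map_mul, map_pow]
  refine Finset.sum_congr rfl fun l _ => ?_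
  rw [evalAt_algebraMap, Complex.ofReal_inv, Complex.ofReal_natCast]
  rfl

/-- The relation `[X, v] = c v` says that `v` intertwines `X + c` with `X`, and exponentials respect
intertwiners. The factor is `exp(c a)`. -/
theorem expUnit_mul_rep (hρ : IsFaithfulRep ρ) (a : SmoothC I M) (X : g) {c : ℝ} {v : g}
    (hv : ⁅X, v⁆ = c • v) : ∃ u : SmoothC I M,
      (expUnit a (rhoC ρ X)).val * rep (SmoothC I M) ρ v =
        u • (rep (SmoothC I M) ρ v * (expUnit a (rhoC ρ X)).val) := by
  refine ⟨compEntire (fun z => Complex.exp (c * z)) (by fun_prop) a, ?_⟩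
  refine matrix_ext_evalAt fun m => ?_
  have h0 := rhoC_lie hρ X v
  rw [hv, rhoC_smul, eq_sub_iff_add_eq'] at h0
  have h1 : rhoC ρ v * (a m • rhoC ρ X + (c * a m) • (1 : Matrix n n ℂ)) =
      (a m • rhoC ρ X) * rhoC ρ v := by
    rw [mul_add, mul_smul_comm, mul_smul_comm, mul_one, smul_mul_assoc, ← h0, smul_add,
      smul_smul, mul_comm (a m)]
  have h2 := semiconjBy_exp h1
  rw [Matrix.exp_add_of_commute _ _ ((Commute.one_right _).smul_right _), exp_smul_one,
    mul_smul_comm, mul_one, mul_smul_comm] at h2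
  rw [Matrix.map_mul, map_evalAt_rep]
  refine h2.symm.trans ?_
  rw [← map_evalAt_expMatrix, ← map_evalAt_rep (I := I) (M := M) v m, ← Matrix.map_mul]
  rfl

theorem exp_add_tensor (A B : Matrix n n ℂ) :
    exp (inFirst A + inSecond B) = inFirst (exp A) * inSecond (exp B) := by
  have h : Commute (inFirst A) (inSecond B) := commute_inFirst_inSecond A B
  rw [← exp_inFirst, ← exp_inSecond]
  exact Matrix.exp_add_of_commute _ _ h

theorem smul_add_tensor (z : ℂ) (A B : Matrix n n ℂ) :
    z • (inFirst A + inSecond B) = inFirst (z • A) + inSecond (z • B) := by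
  rw [smul_add]
  exact congrArg₂ (· + ·) (Matrix.smul_kronecker z A 1).symm (Matrix.kronecker_smul z 1 B).symm

theorem commute_exp_tensor {A : Matrix n n ℂ} {Ω : Matrix (n × n) (n × n) ℂ}
    (h : Commute (inFirst A + inSecond A) Ω) (z : ℂ) :
    Commute (inFirst (exp (z • A)) * inSecond (exp (z • A))) Ω := by
  rw [← exp_add_tensor, ← smul_add_tensor]
  have h' := h.smul_left z
  exact h'.exp_left

/-- At each point `exp(aX) ⊗ exp(aX)` is the exponential of `a (X ⊗ 1 + 1 ⊗ X)`. -/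
theorem commute_expUnit (a : SmoothC I M) (X : g)
    {Ω : Matrix (n × n) (n × n) (SmoothC I M)}
    (hΩ : Commute (inFirst (rep (SmoothC I M) ρ X) + inSecond (rep (SmoothC I M) ρ X)) Ω) :
    Commute (inFirst (expUnit a (rhoC ρ X)).val * inSecond (expUnit a (rhoC ρ X)).val) Ω := by
  refine matrix_ext_evalAt fun m => ?_
  have h := congrArg (fun T => Matrix.map T (evalAt m)) hΩ.eq
  simp only [Matrix.map_mul] at h
  have e1 : (inFirst (rep (SmoothC I M) ρ X) + inSecond (rep (SmoothC I M) ρ X)).map (evalAt m) =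
      inFirst (rhoC ρ X) + inSecond (rhoC ρ X) := by
    rw [Matrix.map_add _ (map_add _), map_evalAt_inFirst, map_evalAt_inSecond, map_evalAt_rep]
  rw [e1] at h
  have hc := commute_exp_tensor h (a m)
  rw [Matrix.map_mul, Matrix.map_mul, Matrix.map_mul, Matrix.map_mul, map_evalAt_inFirst,
    map_evalAt_inSecond]
  exact hc

theorem isExpElt_expUnit (P : PoissonBracket ℂ (SmoothC I M)) (hρ : IsFaithfulRep ρ)
    (a : SmoothC I M) (X : g) :
    IsExpElt P (rep (SmoothC I M) ρ) a X (expUnit a (rhoC ρ X)) where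
  deriv f := map_br_expUnit P f a X
  conj _ _ hK := expUnit_conj hρ a X hK
  eig _ _ hv := expUnit_mul_rep hρ a X hv
  tensor _ hΩ := commute_expUnit a X hΩ

end SmoothExp

/-! ### Ordered and commuting products of smooth exponentials. -/

section SmoothProducts

open NormedSpace (exp)

variable {EM : Type*} [NormedAddCommGroup EM] [NormedSpace ℝ EM] {HM : Type*} [TopologicalSpace HM]
  {I : ModelWithCorners ℝ EM HM} {M : Type*} [TopologicalSpace M] [ChartedSpace HM M]
  {n : Type*} [Fintype n] [DecidableEq n]

theorem map_evalAt_list_prod {K : Type*} (x : K → (Matrix n n (SmoothC I M))ˣ) (l : List K)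
    (m : M) : ((l.map x).prod : (Matrix n n (SmoothC I M))ˣ).val.map (evalAt m) =
      (l.map fun i => (x i).val.map (evalAt m)).prod := by
  induction l with
  | nil => simp [Matrix.map_one _ (map_zero (evalAt m)) (map_one (evalAt m))]
  | cons i l ih => rw [List.map_cons, List.prod_cons, Units.val_mul, Matrix.map_mul, ih,
      List.map_cons, List.prod_cons]

theorem exp_list_sum {K : Type*} (A : K → Matrix n n ℂ) (h : ∀ i j, Commute (A i) (A j))
    (l : List K) : exp (l.map A).sum = (l.map fun i => exp (A i)).prod := by
  induction l with
  | nil => simp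
  | cons i l ih =>
    rw [List.map_cons, List.sum_cons, List.map_cons, List.prod_cons, ← ih]
    exact Matrix.exp_add_of_commute _ _ (Commute.list_sum_right _ _ fun x hx => by
      obtain ⟨j, -, rfl⟩ := List.mem_map.1 hx
      exact h i j)

variable {g : Type*} [LieRing g] [LieAlgebra ℝ g] {ρ : g →ₗ[ℝ] Matrix n n ℝ}

theorem eq_prod_expUnit {N : ℕ} {X : Matrix n n (SmoothC I M)} (c : Fin N → ℂ)
    (q : Fin N → SmoothC I M) (E : Fin N → g)
    (h : ∀ m : M, X.map (fun f => f m) =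
      (List.ofFn fun k => exp ((c k * q k m) • rhoC ρ (E k))).prod) :
    X = ((List.ofFn fun k => expUnit (c k • q k) (rhoC ρ (E k))).prod :
      (Matrix n n (SmoothC I M))ˣ).val := by
  refine matrix_ext_evalAt fun m => ?_
  rw [List.ofFn_eq_map, map_evalAt_list_prod, ← List.ofFn_eq_map]
  exact h m

theorem eq_prod_expUnit_of_commute {K : Type*} [Fintype K] {X : Matrix n n (SmoothC I M)} (c : ℂ)
    (q : K → SmoothC I M) (Z : K → g) (hZ : ∀ i j, Commute (rhoC ρ (Z i)) (rhoC ρ (Z j)))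
    (h : ∀ m : M, X.map (fun f => f m) = exp (∑ i, (c * q i m) • rhoC ρ (Z i))) :
    X = ((Finset.univ.toList.map fun k => expUnit (c • q k) (rhoC ρ (Z k))).prod :
      (Matrix n n (SmoothC I M))ˣ).val := by
  refine matrix_ext_evalAt fun m => (h m).trans ?_
  rw [map_evalAt_list_prod, ← Finset.sum_map_toList, exp_list_sum]
  · rfl
  · exact fun i j => ((hZ i j).smul_left _).smul_right _

theorem rhoC_zero : rhoC ρ (0 : g) = 0 := map_zero (rep ℂ ρ)

theorem commute_rhoC (hρ : IsFaithfulRep ρ) {x y : g} (h : ⁅x, y⁆ = 0) :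
    Commute (rhoC ρ x) (rhoC ρ y) := by
  have := rhoC_lie hρ x y
  rw [h, rhoC_zero] at this
  exact (sub_eq_zero.1 this.symm)

end SmoothProducts

/-! ### The Poisson-Serre relations -/

section RootForm

open LieAlgebra.IsKilling

variable {g : Type*} [LieRing g] [LieAlgebra ℝ g] [Module.Finite ℝ g] [IsKilling ℝ g]
  {H : LieSubalgebra ℝ g} [H.IsCartanSubalgebra] [LieModule.IsTriangularizable ℝ H g]

theorem rootForm_comm (x y : Module.Dual ℝ H) : rootForm x y = rootForm y x :=
  killingForm_symm _ _

theorem rootForm_add_right (x y z : Module.Dual ℝ H) :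
    rootForm x (y + z) = rootForm x y + rootForm x z := by
  simp [rootForm]

theorem rootForm_nsmul_right (x y : Module.Dual ℝ H) (m : ℕ) :
    rootForm x (m • y) = m * rootForm x y := by
  induction m with
  | zero => simp [rootForm]
  | succ m ih => rw [succ_nsmul, rootForm_add_right, ih]; push_cast; ring

section Iterate

variable {A : Type*} [CommRing A] [Algebra ℂ A] {P : PoissonBracket ℂ A} {s : ℝ}
  {α β : Module.Dual ℝ H} {f : A} {F : ℕ → A} {K : ℂ}

/-- The quadratic term of the recursion is exactly what the q-bracket cancels at the current weight,
so each q-bracket moves one step along the sequence `F`. -/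
theorem iterate_qBracket_left (hF : ∀ m : ℕ, P.br f (F m) = K • F (m + 1)
      - ((s * rootForm α (β + m • α) : ℝ) : ℂ) • (f * F m)) (c₀ : ℂ) (m : ℕ) :
    ∃ c : ℂ, (fun x => qBracket P s (α, f) x)^[m] (β, c₀ • F 0) = (β + m • α, c • F m) := by
  induction m with
  | zero => exact ⟨c₀, by simp⟩
  | succ m ih =>
    obtain ⟨c, hc⟩ := ih
    refine ⟨c * K, ?_⟩
    rw [Function.iterate_succ_apply', hc]
    refine Prod.ext ?_ ?_
    · change α + (β + m • α) = β + (m + 1) • α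
      rw [succ_nsmul]; abel
    · change P.br f (c • F m) + ((s * rootForm α (β + m • α) : ℝ) : ℂ) • (f * (c • F m)) = _
      rw [map_smul, hF, mul_smul_comm, smul_comm _ c, ← smul_add, sub_add_cancel, smul_smul]

theorem iterate_qBracket_right (hF : ∀ m : ℕ, P.br f (F m) = K • F (m + 1)
      + ((s * rootForm α (β + m • α) : ℝ) : ℂ) • (f * F m)) (c₀ : ℂ) (m : ℕ) :
    ∃ c : ℂ, (fun x => qBracket P s x (α, f))^[m] (β, c₀ • F 0) = (β + m • α, c • F m) := by
  induction m with
  | zero => exact ⟨c₀, by simp⟩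
  | succ m ih =>
    obtain ⟨c, hc⟩ := ih
    refine ⟨-(c * K), ?_⟩
    rw [Function.iterate_succ_apply', hc]
    refine Prod.ext ?_ ?_
    · change β + m • α + α = β + (m + 1) • α
      rw [succ_nsmul]; abel
    · change P.br (c • F m) f + ((s * rootForm (β + m • α) α : ℝ) : ℂ) • ((c • F m) * f) = _
      rw [P.skew, map_smul, hF, rootForm_comm, mul_comm (c • F m), mul_smul_comm, smul_comm _ c,
        ← smul_neg, ← smul_add, neg_add, neg_add_cancel_right, smul_neg, smul_smul, neg_smul]

end Iterate

variable (b : (rootSystem H).Base)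
  {n : Type*} [Fintype n] [DecidableEq n] {R : Type*} [CommRing R] [Algebra ℝ R]
  [Algebra ℂ R] [IsScalarTower ℝ ℂ R]
  {P : PoissonBracket ℂ R} {ρ : g →ₗ[ℝ] Matrix n n ℝ} {N : ℕ}
  {h₀ : g} {X Y : Fin N → g} {ht : Fin N → ℤ} {s : b.support → Fin N} {a : Fin N → R}
  {x : Fin N → (Matrix n n R)ˣ} {u : (Matrix n n R)ˣ}

/-- The eigenvalue becomes `(α_i, α_j + m α_i)` up to sign, the number in the q-bracket with an
element of weight `α_j + m α_i`. -/
theorem IsTriangular.lie_ad_pow (T : IsTriangular h₀ X Y ht s) (i j : b.support) (m : ℕ) :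
    ⁅⁅X (s i), Y (s i)⁆, (LieAlgebra.ad ℝ g (Y (s i)) ^ m) (Y (s j))⁆ =
      -((killingForm ℝ g ⁅X (s i), Y (s i)⁆ ⁅X (s j), Y (s j)⁆ +
        m * killingForm ℝ g ⁅X (s i), Y (s i)⁆ ⁅X (s i), Y (s i)⁆) •
          (LieAlgebra.ad ℝ g (Y (s i)) ^ m) (Y (s j))) := by
  induction m with
  | zero => simp [T.lie_Y _ (T.lie_mem_zero _)]
  | succ m ih =>
    rw [pow_succ', Module.End.mul_apply, LieAlgebra.ad_apply, leibniz_lie, ih,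
      T.lie_Y _ (T.lie_mem_zero _), lie_neg, lie_smul, neg_lie, smul_lie]
    push_cast
    module

variable (T : IsTriangularProduct P ρ h₀ X Y ht s a x u) {c : ℝ}
  (hB : SimpleAction P ρ X Y s a u (c : ℂ)) {e : b.support → R} {κ : b.support → ℂ}
  (hκ : ∀ i, κ i ≠ 0) (ha : ∀ i, a (s i) = κ i • e i)
  (hw : ∀ i j, killingForm ℝ g ⁅X (s i), Y (s i)⁆ ⁅X (s j), Y (s j)⁆ =
    rootForm (rootVec (simpleRoot b i)) (rootVec (simpleRoot b j)))
  {i j : b.support} {y : g} (hy : y ∈ gr h₀ 0)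
  (hyi : killingForm ℝ g y ⁅X (s i), Y (s i)⁆ = 0)
  (hyj : killingForm ℝ g y ⁅X (s j), Y (s j)⁆ = 1)
  (hS : (LieAlgebra.ad ℝ g (Y (s i)) ^ (1 - cartanEntry b i j).toNat) (Y (s j)) = 0)

include T hB hκ ha hw hy hyi hyj hS

/-- The nested q-brackets run through the functions `κ(y, u η u⁻¹)` with `η = ad(Y_i)^m Y_j`. They
start at a multiple of `e j`, since `y` is dual to the root of `j`, and end at zero by the Serre
relation `hS` of 𝔤. -/
theorem IsTriangularProduct.serreLeft_eq_zero : serreLeft b P c e i j = 0 := by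
  set F : ℕ → R := fun m => coef R ρ (killingForm ℝ g y) ((u : Matrix n n R) *
    rep R ρ ((LieAlgebra.ad ℝ g (Y (s i)) ^ m) (Y (s j))) * (u⁻¹ : (Matrix n n R)ˣ)) with hF
  have h0 : e j = (κ j)⁻¹ • F 0 := by
    rw [hF]
    simp only [pow_zero, Module.End.one_apply]
    rw [T.coef_conj_Y hy, hyj, Algebra.smul_def (1 : ℝ), map_one, one_mul, ha, smul_smul, inv_mul_cancel₀ (hκ j), one_smul]
  have hrec : ∀ m : ℕ, P.br (e i) (F m) = ((κ i)⁻¹ * (c * -2)) • F (m + 1)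
      - ((c * rootForm (rootVec (simpleRoot b i)) (rootVec (simpleRoot b j) +
        m • rootVec (simpleRoot b i)) : ℝ) : ℂ) • (e i * F m) := by
    intro m
    have h := T.br_simple_coef_conj hB hy hyi (ad_pow_mem_gr (T.mem_Y (s i)) (T.mem_Y (s j)) m)
      (T.lie_ad_pow b i j m)
    rw [← LieAlgebra.ad_apply (R := ℝ) g (Y (s i)), ← Module.End.mul_apply, ← pow_succ', hw, hw,
      ← rootForm_nsmul_right, ← rootForm_add_right, ha] at h
    change P.br (κ i • e i) (F m) = (c : ℂ) • (-(2 * F (m + 1)) - _ • (κ i • e i * F m)) at h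
    rw [map_smul, LinearMap.smul_apply] at h
    have h' := congrArg ((κ i)⁻¹ • ·) h
    simp only [smul_smul, inv_mul_cancel₀ (hκ i), one_smul] at h'
    rw [h', Algebra.smul_def (rootForm _ _), IsScalarTower.algebraMap_apply ℝ ℂ R, ← Algebra.smul_def,
      smul_mul_assoc]
    simp only [smul_sub, smul_smul]
    congr 1
    · simp only [Algebra.smul_def, map_mul, map_neg, map_ofNat]
      ring
    · congr 1
      change (κ i)⁻¹ * c * (((rootForm _ _ : ℝ) : ℂ) * κ i) = _
      push_cast
      field_simp [hκ i]
  obtain ⟨d, hd⟩ := iterate_qBracket_left hrec (κ j)⁻¹ (1 - cartanEntry b i j).toNat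
  rw [serreLeft, h0, hd]
  simp only [hF, hS, map_zero, mul_zero, zero_mul, smul_zero]

/-- As for the other nesting, with `u⁻¹ η u`. The sign change of the quadratic term in
`br_simple_coef_conj_inv` matches brackets in which the simple element stands on the right. -/
theorem IsTriangularProduct.serreRight_eq_zero : serreRight b P c e i j = 0 := by
  set F : ℕ → R := fun m => coef R ρ (killingForm ℝ g y)
    (((u⁻¹ : (Matrix n n R)ˣ) : Matrix n n R) *
    rep R ρ ((LieAlgebra.ad ℝ g (Y (s i)) ^ m) (Y (s j))) * u) with hF
  have h0 : e j = (-(κ j)⁻¹) • F 0 := by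
    rw [hF]
    simp only [pow_zero, Module.End.one_apply]
    rw [T.coef_conj_inv_Y hy, hyj, Algebra.smul_def (1 : ℝ), map_one, one_mul, ha, neg_smul_neg, smul_smul, inv_mul_cancel₀ (hκ j),
      one_smul]
  have hrec : ∀ m : ℕ, P.br (e i) (F m) = ((κ i)⁻¹ * (c * -2)) • F (m + 1)
      + ((c * rootForm (rootVec (simpleRoot b i)) (rootVec (simpleRoot b j) +
        m • rootVec (simpleRoot b i)) : ℝ) : ℂ) • (e i * F m) := by
    intro m
    have h := T.br_simple_coef_conj_inv hB hy hyi
      (ad_pow_mem_gr (T.mem_Y (s i)) (T.mem_Y (s j)) m) (T.lie_ad_pow b i j m)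
    rw [← LieAlgebra.ad_apply (R := ℝ) g (Y (s i)), ← Module.End.mul_apply, ← pow_succ', hw, hw,
      ← rootForm_nsmul_right, ← rootForm_add_right, ha] at h
    change P.br (κ i • e i) (F m) = (c : ℂ) • (-(2 * F (m + 1)) + _ • (κ i • e i * F m)) at h
    rw [map_smul, LinearMap.smul_apply] at h
    have h' := congrArg ((κ i)⁻¹ • ·) h
    simp only [smul_smul, inv_mul_cancel₀ (hκ i), one_smul] at h'
    rw [h', Algebra.smul_def (rootForm _ _), IsScalarTower.algebraMap_apply ℝ ℂ R, ← Algebra.smul_def,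
      smul_mul_assoc]
    simp only [smul_add, smul_smul]
    congr 1
    · simp only [Algebra.smul_def, map_mul, map_neg, map_ofNat]
      ring
    · congr 1
      change (κ i)⁻¹ * c * (((rootForm _ _ : ℝ) : ℂ) * κ i) = _
      push_cast
      field_simp [hκ i]
  obtain ⟨d, hd⟩ := iterate_qBracket_right hrec (-(κ j)⁻¹) (1 - cartanEntry b i j).toNat
  rw [serreRight, h0, hd]
  simp only [hF, hS, map_zero, mul_zero, zero_mul, smul_zero]

end RootForm

/-! ### Root vectors -/

section RootVectors

open LieAlgebra.IsKilling

variable {g : Type*} [LieRing g] [LieAlgebra ℝ g] [Module.Finite ℝ g] [IsKilling ℝ g]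
  {H : LieSubalgebra ℝ g} [H.IsCartanSubalgebra] [LieModule.IsTriangularizable ℝ H g]

theorem rootVec_apply (α : H.root) (h : H) : rootVec α h = α.1 h := rfl

theorem rootVec_injective : Function.Injective (rootVec (H := H)) :=
  (rootSystem H).root.injective

theorem rootVec_negRoot (α : H.root) : rootVec (negRoot α) = -rootVec α := rfl

theorem negRoot_negRoot (α : H.root) : negRoot (negRoot α) = α :=
  rootVec_injective (by rw [rootVec_negRoot, rootVec_negRoot, neg_neg])

theorem isNonZero_root (α : H.root) : α.1.IsNonZero := LieSubalgebra.isNonZero_coe_root α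

theorem rootVec_ne_zero (α : H.root) : rootVec α ≠ 0 := (rootSystem H).ne_zero α

/-- The element of the Cartan subalgebra which is dual to a root. -/
def dualVec (α : H.root) : H := (cartanEquivDual H).symm (rootVec α)

theorem dualVec_negRoot (α : H.root) : dualVec (negRoot α) = -dualVec α := by
  rw [dualVec, rootVec_negRoot, map_neg, dualVec]

theorem killingForm_cartanEquivDual_symm (φ : Module.Dual ℝ H) (h : H) :
    killingForm ℝ g ((cartanEquivDual H).symm φ : g) h = φ h :=
  LinearMap.BilinForm.apply_toDual_symm_apply
    (hB := LieAlgebra.IsKilling.traceForm_cartan_nondegenerate ℝ g H) φ h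

theorem killingForm_dualVec (α : H.root) (h : H) :
    killingForm ℝ g (dualVec α : g) h = rootVec α h :=
  killingForm_cartanEquivDual_symm _ _

theorem lie_mem_rootSpace {α : H → ℝ} {x : g} (hx : x ∈ rootSpace H α) (h : H) :
    ⁅(h : g), x⁆ = α h • x := lie_eq_smul_of_mem_rootSpace hx h

theorem coe_mem_rootSpace_zero (h : H) : (h : g) ∈ rootSpace H (0 : H → ℝ) := by
  rw [rootSpace_zero_eq]; exact h.2

variable {E : H.root → g} (hE : IsCartanWeyl E)

include hE

namespace IsCartanWeyl

theorem lie_left (α : H.root) (h : H) : ⁅(h : g), E α⁆ = rootVec α h • E α :=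
  lie_mem_rootSpace (hE.mem α) h

theorem killing_eq (α β : H.root) [Decidable (β = negRoot α)] :
    killingForm ℝ g (E α) (E β) = if β = negRoot α then 1 else 0 := by
  split_ifs with h
  · rw [h, hE.norm_eq]
  · refine killingForm_apply_eq_zero_of_mem_rootSpace_of_add_ne_zero ℝ g H (hE.mem α) (hE.mem β)
      fun e => h (rootVec_injective ?_)
    rw [rootVec_negRoot, eq_neg_iff_add_eq_zero, add_comm]
    ext x
    exact congrFun e x

theorem killing_coe (α : H.root) (h : H) : killingForm ℝ g (E α) h = 0 := by
  refine killingForm_apply_eq_zero_of_mem_rootSpace_of_add_ne_zero ℝ g H (hE.mem α)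
    (coe_mem_rootSpace_zero h) fun e => rootVec_ne_zero α ?_
  rw [add_zero] at e
  ext x
  exact congrFun e x

theorem killing_coe' (α : H.root) (h : H) : killingForm ℝ g (h : g) (E α) = 0 := by
  rw [killingForm_symm, hE.killing_coe]

theorem lie_neg (α : H.root) : ⁅E α, E (negRoot α)⁆ = (dualVec α : g) := by
  have := lie_eq_killingForm_smul_of_mem_rootSpace_of_mem_rootSpace_neg (hE.mem α)
    (hE.mem (negRoot α))
  rwa [hE.norm_eq, one_smul] at this

theorem ne_zero (α : H.root) : E α ≠ 0 := fun h => by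
  have := hE.norm_eq α
  rw [h] at this
  simp at this

theorem exists_smul_eq (α : H.root) {x : g} (hx : x ∈ rootSpace H α.1) : ∃ c : ℝ, x = c • E α := by
  obtain ⟨c, hc⟩ := exists_smul_eq_of_finrank_eq_one (finrank_rootSpace_eq_one α.1 (isNonZero_root α))
    (x := ⟨E α, hE.mem α⟩) (fun h => hE.ne_zero α (congrArg Subtype.val h)) ⟨x, hx⟩
  exact ⟨c, (congrArg Subtype.val hc).symm⟩

omit hE in
theorem mem_rootSpace_lie {α β δ : H.root} (h : rootVec δ = rootVec α + rootVec β) {x y : g}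
    (hx : x ∈ rootSpace H α.1) (hy : y ∈ rootSpace H β.1) : ⁅x, y⁆ ∈ rootSpace H δ.1 := by
  have := lie_mem_genWeightSpace_of_mem_genWeightSpace hx hy
  have e : (α.1 + β.1 : H → ℝ) = δ.1 := by
    funext z; exact (LinearMap.congr_fun h z).symm
  rwa [e] at this

/-- If the bracket vanished, `E α` would be a primitive vector of the reversed sl₂ triple of `j`,
with weight `-α(j^∨) < 0`. Weights of primitive vectors are natural numbers in finite dimension. -/
theorem lie_ne_zero {α j : H.root} (h : 0 < α.1 (coroot j.1)) :
    ⁅E α, E (negRoot j)⁆ ≠ 0 := by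
  intro h0
  obtain ⟨t, e, f, ht, he, hf⟩ := exists_isSl2Triple_of_weight_isNonZero (isNonZero_root j)
  have ht' := ht.h_eq_coroot (isNonZero_root j) he hf
  obtain ⟨c, hc⟩ := hE.exists_smul_eq (negRoot j) (x := f) hf
  have hp : ht.symm.HasPrimitiveVectorWith (E α) (-(α.1 (coroot j.1))) := by
    refine ⟨hE.ne_zero α, ?_, ?_⟩
    · rw [ht', neg_lie, lie_mem_rootSpace (hE.mem α), neg_smul]
    · rw [hc, smul_lie, ← lie_skew, h0, neg_zero, smul_zero]
  obtain ⟨m, hm⟩ := hp.exists_nat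
  have : (0 : ℝ) ≤ m := m.cast_nonneg
  linarith

/-- `E (-δ)` pairs only with the root space of `δ`, which forces `α' - j = δ = α - j`. Conversely
that space is a line, and the bracket is a non-zero multiple of `E δ`. -/
theorem killing_lie_ne_zero_iff {α α' j δ : H.root} (h : 0 < α.1 (coroot j.1))
    (hδ : rootVec δ = rootVec α - rootVec j) :
    killingForm ℝ g (E (negRoot δ)) ⁅E α', E (negRoot j)⁆ ≠ 0 ↔ α' = α := by
  constructor
  · intro hne
    by_contra hα
    apply hne
    have h1 := lie_mem_genWeightSpace_of_mem_genWeightSpace (hE.mem α') (hE.mem (negRoot j))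
    refine killingForm_apply_eq_zero_of_mem_rootSpace_of_add_ne_zero ℝ g H (hE.mem (negRoot δ)) h1
      fun e => hα (rootVec_injective ?_)
    ext x
    have e1 : rootVec (negRoot δ) x + (rootVec α' x + rootVec (negRoot j) x) = 0 := congrFun e x
    rw [rootVec_negRoot, rootVec_negRoot, hδ] at e1
    simp only [LinearMap.neg_apply, LinearMap.sub_apply] at e1
    linarith
  · rintro rfl h0
    have h1 : ⁅E α', E (negRoot j)⁆ ∈ rootSpace H δ.1 :=
      mem_rootSpace_lie (by rw [hδ, rootVec_negRoot, sub_eq_add_neg]) (hE.mem α')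
        (hE.mem (negRoot j))
    obtain ⟨c, hc⟩ := hE.exists_smul_eq δ h1
    rw [hc, map_smul, killingForm_symm, hE.norm_eq, smul_eq_mul, mul_one] at h0
    exact hE.lie_ne_zero h (by rw [hc, h0, zero_smul])

/-- Since `β - α` is not a root, the `α`-string through `β` starts at `β` and has length `-z`. Thus
`β + (1 - z) α` is not a weight. -/
theorem ad_pow_eq_zero {α β : H.root} {z : ℤ} (hz : β.1 (coroot α.1) = z)
    (hn : rootVec β - rootVec α ∉ Set.range (rootSystem H).root) (hne : rootVec β ≠ rootVec α) :
    (LieAlgebra.ad ℝ g (E α) ^ (1 - z).toNat) (E β) = 0 := by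
  have hbot : ¬ (rootSpace H ((-1 : ℤ) • (α.1 : H → ℝ) + β.1) ≠ ⊥) := by
    intro hb
    let w : LieModule.Weight ℝ H g := ⟨(-1 : ℤ) • (α.1 : H → ℝ) + β.1, hb⟩
    have e : ∀ x, w x = rootVec β x - rootVec α x := fun x => by
      change ((-1 : ℤ) • (α.1 : H → ℝ) + β.1) x = _
      simp only [Pi.add_apply, Pi.neg_apply, neg_smul, one_smul, rootVec_apply]
      ring
    -- The zero weight must be excluded, as `hn` speaks about roots only; this is where `β ≠ α`
    -- enters.
    have hw : w.IsNonZero := fun h0 => hne (by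
      ext x
      have h1 : w x = 0 := congrFun h0 x
      rw [e] at h1
      linarith)
    refine hn ⟨⟨w, by simpa [LieSubalgebra.root] using hw⟩, ?_⟩
    ext x
    exact e x
  rw [rootSpace_zsmul_add_ne_bot_iff _ _ (isNonZero_root α)] at hbot
  have hc := apply_coroot_eq_cast α.1 β.1
  rw [hz] at hc
  have hc' : z = (LieModule.chainBotCoeff α.1 β.1 - LieModule.chainTopCoeff α.1 β.1 : ℤ) := by
    exact_mod_cast hc
  have hzn : ((1 - z).toNat : ℤ) = 1 - z := by omega
  have key : ∀ m : ℕ, (LieAlgebra.ad ℝ g (E α) ^ m) (E β) ∈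
      rootSpace H ((m : ℤ) • (α.1 : H → ℝ) + β.1) := by
    intro m
    induction m with
    | zero => simpa using hE.mem β
    | succ m ih =>
      rw [pow_succ', Module.End.mul_apply, LieAlgebra.ad_apply]
      have := lie_mem_genWeightSpace_of_mem_genWeightSpace (hE.mem α) ih
      have e : (α.1 : H → ℝ) + ((m : ℤ) • (α.1 : H → ℝ) + β.1) =
          ((m + 1 : ℕ) : ℤ) • (α.1 : H → ℝ) + β.1 := by
        push_cast
        rw [add_smul, one_smul]
        abel
      rwa [e] at this
  have h0 : rootSpace H (((1 - z).toNat : ℤ) • (α.1 : H → ℝ) + β.1) = ⊥ := by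
    by_contra hb
    rw [← ne_eq, rootSpace_zsmul_add_ne_bot_iff _ _ (isNonZero_root α)] at hb
    omega
  have := key (1 - z).toNat
  rw [h0] at this
  simpa using this

end IsCartanWeyl

end RootVectors

/-! ### The principal grading -/

section Base

open LieAlgebra.IsKilling

variable {g : Type*} [LieRing g] [LieAlgebra ℝ g] [Module.Finite ℝ g] [IsKilling ℝ g]
  {H : LieSubalgebra ℝ g} [H.IsCartanSubalgebra] [LieModule.IsTriangularizable ℝ H g]
  (b : (rootSystem H).Base)

/-- The fundamental co-weights, dual to the simple roots. -/
def coweight (i : b.support) : H := (Module.evalEquiv ℝ H).symm (b.toWeightBasis.coord i)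

theorem apply_coweight (i : b.support) (φ : Module.Dual ℝ H) :
    φ (coweight b i) = b.toWeightBasis.coord i φ := by
  have := LinearMap.congr_fun ((Module.evalEquiv ℝ H).apply_symm_apply (b.toWeightBasis.coord i)) φ
  rwa [Module.evalEquiv_apply] at this

theorem simpleRoot_coweight [DecidableEq b.support] (i j : b.support) :
    rootVec (simpleRoot b j) (coweight b i) = if j = i then 1 else 0 := by
  have : rootVec (simpleRoot b j) = b.toWeightBasis j := (b.toWeightBasis_apply j).symm
  rw [apply_coweight, this, Module.Basis.coord_apply, Module.Basis.repr_self,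
    Finsupp.single_apply]

/-- The sum of the fundamental co-weights. -/
def gradingElt : H := ∑ i : b.support, coweight b i

/-- Every simple root takes the value 1 on the sum of the fundamental co-weights. -/
theorem rootVec_gradingElt (α : H.root) : rootVec α (gradingElt b) = b.height α := by
  classical
  obtain ⟨f, -, -, hf⟩ := b.exists_root_eq_sum_int α
  rw [b.height_eq_sum hf]
  have h1 : ∀ j : b.support, (rootSystem H).root j (gradingElt b) = 1 := fun j => by
    have h2 : ∀ i, (rootSystem H).root j (coweight b i) = if j = i then 1 else 0 :=
      fun i => simpleRoot_coweight b i j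
    rw [gradingElt, map_sum, Finset.sum_congr rfl fun i _ => h2 i]
    simp
  change (rootSystem H).root α (gradingElt b) = _
  rw [hf, LinearMap.sum_apply, Int.cast_sum]
  refine Finset.sum_congr rfl fun j hj => ?_
  rw [LinearMap.smul_apply, h1 ⟨j, hj⟩, zsmul_eq_mul, mul_one]

theorem height_negRoot (α : H.root) : b.height (negRoot α) = -b.height α := by
  have h := rootVec_gradingElt b (negRoot α)
  rw [rootVec_negRoot, LinearMap.neg_apply, rootVec_gradingElt] at h
  exact_mod_cast h.symm

theorem sum_coroot (h : H) :
    ∑ i, killingForm ℝ g (h : g) (weightElt b i : g) • simpleCoroot b i = h := by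
  conv_rhs => rw [← b.toCoweightBasis.sum_repr h]
  refine Finset.sum_congr rfl fun i _ => ?_
  rw [b.toCoweightBasis_apply, killingForm_symm, weightElt, killingForm_cartanEquivDual_symm]
  rfl

theorem sum_weightElt (h : H) :
    ∑ i, killingForm ℝ g (h : g) (simpleCoroot b i : g) • weightElt b i = h := by
  apply (cartanEquivDual H).injective
  rw [map_sum]
  conv_rhs => rw [← b.toCoweightBasis.sum_dual_apply_smul_coord (cartanEquivDual H h)]
  refine Finset.sum_congr rfl fun i _ => ?_
  rw [map_smul, weightElt, LinearEquiv.apply_symm_apply, b.toCoweightBasis_apply]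
  rfl

theorem killing_coroot_weightElt [DecidableEq b.support] (i j : b.support) :
    killingForm ℝ g (simpleCoroot b i : g) (weightElt b j : g) = if i = j then 1 else 0 := by
  rw [killingForm_symm, weightElt, killingForm_cartanEquivDual_symm, fundWeight]
  have : simpleCoroot b i = b.toCoweightBasis i := (b.toCoweightBasis_apply i).symm
  rw [this, Module.Basis.coord_apply, Module.Basis.repr_self,
    Finsupp.single_apply]

theorem coe_mem_gr (h : H) : (h : g) ∈ gr (gradingElt b : g) 0 := by
  rw [mem_gr, Int.cast_zero, zero_smul]
  exact congrArg Subtype.val (LieModule.IsTrivial.trivial (gradingElt b) h)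

variable {b}

theorem isPos_or_neg (α : H.root) : b.IsPos α ∨ b.IsPos (negRoot α) := by
  have := b.height_ne_zero α
  rw [b.isPos_iff, b.isPos_iff, height_negRoot]
  omega

theorem exists_simple_of_height_eq_one {α : H.root} (h : b.height α = 1) :
    ∃ i, simpleRoot b i = α := by
  classical
  obtain ⟨f, -, hf | hf⟩ := b.exists_root_eq_sum_nat_or_neg α
  · have hf' : (rootSystem H).root α = ∑ j ∈ b.support, (fun j => (f j : ℤ)) j •
        (rootSystem H).root j := by simpa using hf
    rw [b.height_eq_sum hf'] at h
    have h1 : ∑ j ∈ b.support, f j = 1 := by exact_mod_cast h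
    obtain ⟨j, hj, hj1⟩ : ∃ j ∈ b.support, f j ≠ 0 := by
      by_contra! h0
      rw [Finset.sum_eq_zero h0] at h1
      exact zero_ne_one h1
    refine ⟨⟨j, hj⟩, rootVec_injective ?_⟩
    change (rootSystem H).root j = (rootSystem H).root α
    rw [← Finset.add_sum_erase _ _ hj] at h1
    have h2 : ∀ l ∈ b.support.erase j, f l = 0 := by
      have : ∑ l ∈ b.support.erase j, f l = 0 := by omega
      exact Finset.sum_eq_zero_iff.1 this
    have h3 : f j = 1 := by rw [Finset.sum_eq_zero h2] at h1; omega
    rw [hf, ← Finset.add_sum_erase _ _ hj, h3, one_smul,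
      Finset.sum_eq_zero fun l hl => by rw [h2 l hl, zero_smul], add_zero]
  · have hf' : (rootSystem H).root α = ∑ j ∈ b.support, (fun j => -(f j : ℤ)) j •
        (rootSystem H).root j := by simpa using hf
    rw [b.height_eq_sum hf'] at h
    have : ∑ j ∈ b.support, -(f j : ℤ) ≤ 0 := Finset.sum_nonpos fun j _ => by simp
    omega

variable {E : H.root → g} (hE : IsCartanWeyl E)

include hE

namespace IsCartanWeyl

theorem mem_gr (α : H.root) : E α ∈ gr (gradingElt b : g) (b.height α) := by
  rw [SklyaninCharges.mem_gr, hE.lie_left, rootVec_gradingElt]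

/-- Both sides are linear in `x`, and the weight spaces span 𝔤. On the Cartan subalgebra this is
duality of co-roots and the `P_i`; on a root line it is the normalisation of the root vectors. -/
theorem sum_eq (x : g) : ∑ α, killingForm ℝ g x (E (negRoot α)) • E α +
    ∑ i, killingForm ℝ g x (simpleCoroot b i : g) • (weightElt b i : g) = x := by
  classical
  let F : g →ₗ[ℝ] g :=
    ∑ α, (LinearMap.smulRight ((killingForm ℝ g).flip (E (negRoot α))) (E α)) +
    ∑ i, (LinearMap.smulRight ((killingForm ℝ g).flip (simpleCoroot b i : g)) (weightElt b i : g))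
  have hF : ∀ y, F y = ∑ α, killingForm ℝ g y (E (negRoot α)) • E α +
    ∑ i, killingForm ℝ g y (simpleCoroot b i : g) • (weightElt b i : g) := fun y => by
    simp [F, LinearMap.sum_apply]
  rw [← hF]
  change x ∈ LinearMap.eqLocus F LinearMap.id
  have htop := LieModule.iSup_genWeightSpace_eq_top' ℝ H g
  rw [← LieSubmodule.toSubmodule_inj, LieSubmodule.iSup_toSubmodule,
    LieSubmodule.top_toSubmodule] at htop
  have : (⊤ : Submodule ℝ g) ≤ LinearMap.eqLocus F LinearMap.id := by
    rw [← htop, iSup_le_iff]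
    intro χ y hy
    rw [LinearMap.mem_eqLocus, LinearMap.id_apply, hF]
    by_cases hχ : χ.IsZero
    · have hy' : y ∈ H := by
        have : (χ : H → ℝ) = 0 := hχ
        rw [this] at hy
        change y ∈ rootSpace H (0 : H → ℝ) at hy
        rwa [rootSpace_zero_eq, LieSubalgebra.mem_toLieSubmodule] at hy
      have h1 := congrArg Subtype.val (sum_weightElt b ⟨y, hy'⟩)
      rw [Finset.sum_eq_zero fun α _ => by rw [hE.killing_coe' _ ⟨y, hy'⟩, zero_smul], zero_add]
      simpa using h1
    · let α : H.root := ⟨χ, by simpa [LieSubalgebra.root] using hχ⟩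
      obtain ⟨c, rfl⟩ := hE.exists_smul_eq α hy
      rw [Finset.sum_eq_single α]
      · rw [map_smul, LinearMap.smul_apply, hE.norm_eq, smul_eq_mul, mul_one,
          Finset.sum_eq_zero fun i _ => by
            rw [LinearMap.smul_apply, hE.killing_coe, smul_zero, zero_smul], add_zero]
      · intro β _ hβ
        rw [map_smul, LinearMap.smul_apply, hE.killing_eq, if_neg, smul_zero, zero_smul]
        intro h
        rw [← negRoot_negRoot β, h, negRoot_negRoot] at hβ
        exact hβ rfl
      · simp
  exact this trivial

theorem sum_eq' (x : g) : ∑ α, killingForm ℝ g x (E α) • E (negRoot α) +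
    ∑ i, killingForm ℝ g x (weightElt b i : g) • (simpleCoroot b i : g) = x := by
  have h0 := hE.sum_eq (b := b) x
  -- The Cartan component of `x` is the same in either of the two dual bases, and the root part is
  -- reindexed by `α ↦ -α`.
  have h1 : ∑ i, killingForm ℝ g x (weightElt b i : g) • (simpleCoroot b i : g) =
      ∑ i, killingForm ℝ g x (simpleCoroot b i : g) • (weightElt b i : g) := by
    set z : H := ∑ i, killingForm ℝ g x (simpleCoroot b i : g) • weightElt b i with hz
    have hz' : (z : g) = ∑ i, killingForm ℝ g x (simpleCoroot b i : g) • (weightElt b i : g) := by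
      simp [hz]
    have hk : ∀ h : H, killingForm ℝ g x h = killingForm ℝ g (z : g) h := fun h => by
      conv_lhs => rw [← h0, ← hz']
      rw [map_add, LinearMap.add_apply, map_sum, LinearMap.sum_apply,
        Finset.sum_eq_zero fun α _ => by
          rw [map_smul, LinearMap.smul_apply, hE.killing_coe, smul_zero], zero_add]
    rw [← hz']
    simp only [hk]
    conv_rhs => rw [← sum_coroot b z]
    simp
  rw [h1]
  conv_rhs => rw [← h0]
  congr 1
  exact Fintype.sum_equiv ⟨negRoot, negRoot, negRoot_negRoot, negRoot_negRoot⟩ _ _ fun α => by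
    simp [negRoot_negRoot]

theorem mem_of_mem_gr_zero {x : g} (hx : x ∈ gr (gradingElt b : g) 0) : x ∈ H := by
  rw [← hE.sum_eq (b := b) x, Finset.sum_eq_zero, zero_add]
  · exact sum_mem fun i _ => H.smul_mem _ (weightElt b i).2
  · intro α _
    rw [killingForm_eq_zero_of_mem_gr hx (hE.mem_gr _), zero_smul]
    rw [zero_add]
    exact b.height_ne_zero _

theorem isDualBasis : IsDualBasis (gradingElt b : g) (Sum.elim E fun i => (weightElt b i : g))
    (Sum.elim (fun α => E (negRoot α)) fun i => (simpleCoroot b i : g))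
    (Sum.elim b.height fun _ : b.support => 0) where
  mem j := by
    rcases j with α | i
    · exact hE.mem_gr α
    · exact coe_mem_gr b _
  mem' j := by
    rcases j with α | i
    · simp only [Sum.elim_inl, ← height_negRoot]
      exact hE.mem_gr _
    · simp only [Sum.elim_inr, neg_zero]
      exact coe_mem_gr b _
  sum_left x := by
    rw [Fintype.sum_sum_type]
    exact hE.sum_eq x
  sum_right x := by
    rw [Fintype.sum_sum_type]
    exact hE.sum_eq' x

theorem lie_weightElt (j : H.root ⊕ b.support) (i : b.support) :
    ⁅(weightElt b i : g), Sum.elim E (fun i => (weightElt b i : g)) j⁆ =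
      Sum.elim (fun α => rootVec α (weightElt b i)) (fun _ => 0) j •
        Sum.elim E (fun i => (weightElt b i : g)) j := by
  rcases j with α | l
  · exact hE.lie_left _ _
  · simp only [Sum.elim_inr, zero_smul]
    exact congrArg Subtype.val (LieModule.IsTrivial.trivial (weightElt b i) (weightElt b l))

theorem lie_eq_zero_of_mem_gr_zero : ∀ v ∈ gr (gradingElt b : g) 0,
    ∀ w ∈ gr (gradingElt b : g) 0, ⁅v, w⁆ = 0 := by
  intro v hv w hw
  exact congrArg Subtype.val (LieModule.IsTrivial.trivial
    (⟨v, hE.mem_of_mem_gr_zero hv⟩ : H) (⟨w, hE.mem_of_mem_gr_zero hw⟩ : H))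

end IsCartanWeyl

end Base

/-! ### The triangular structure of the root vectors -/

section RootTriangular

open LieAlgebra.IsKilling

variable {g : Type*} [LieRing g] [LieAlgebra ℝ g] [Module.Finite ℝ g] [IsKilling ℝ g]
  {H : LieSubalgebra ℝ g} [H.IsCartanSubalgebra] [LieModule.IsTriangularizable ℝ H g]
  {b : (rootSystem H).Base}

theorem negRoot_apply_coroot_negRoot (α β : H.root) :
    (negRoot α).1 (coroot (negRoot β).1) = α.1 (coroot β.1) := by
  change -(rootVec α (coroot (-β.1))) = rootVec α (coroot β.1)
  rw [coroot_neg, map_neg, neg_neg]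

theorem isPos_simpleRoot (i : b.support) : b.IsPos (simpleRoot b i) :=
  RootPairing.Base.isPos_of_mem_support i.2

/-- The index of a simple root. -/
def simpleIndex {N : ℕ} (β : Fin N ≃ PosRoot b) (i : b.support) : Fin N :=
  β.symm ⟨simpleRoot b i, isPos_simpleRoot i⟩

theorem apply_simpleIndex {N : ℕ} (β : Fin N ≃ PosRoot b) (i : b.support) :
    (β (simpleIndex β i)).1 = simpleRoot b i := by
  rw [simpleIndex, Equiv.apply_symm_apply]

theorem simpleIndex_spec {N : ℕ} (β : Fin N ≃ PosRoot b) (k : Fin N) :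
    b.height (β k).1 = 1 ↔ ∃ i, simpleIndex β i = k := by
  constructor
  · intro h
    obtain ⟨i, hi⟩ := exists_simple_of_height_eq_one h
    refine ⟨i, ?_⟩
    rw [simpleIndex, Equiv.symm_apply_eq]
    exact Subtype.ext hi
  · rintro ⟨i, rfl⟩
    rw [apply_simpleIndex]
    exact RootPairing.Base.height_one_of_mem_support i.2

/-- A positive root which is not simple is the sum of a simple root and a positive root. -/
theorem exists_sub_simpleRoot {α : H.root} (hα : b.IsPos α) (h : b.height α ≠ 1) :
    ∃ (i : b.support) (δ : PosRoot b), 0 < α.1 (coroot (simpleRoot b i).1) ∧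
      rootVec δ.1 = rootVec α - rootVec (simpleRoot b i) ∧ b.height δ.1 + 1 = b.height α := by
  -- A positive root pairs positively with some simple root, and subtracting that simple root again
  -- gives a positive root.
  obtain ⟨j, hj, hp⟩ := hα.exists_mem_support_pos_pairingIn
  have hne : j ≠ α := by
    rintro rfl
    exact h (RootPairing.Base.height_one_of_mem_support hj)
  have hp' : 0 < (rootSystem H).pairingIn ℤ α j := ((rootSystem H).zero_lt_pairingIn_iff' ℤ).1 hp
  obtain ⟨δ, hδ⟩ := (rootSystem H).root_sub_root_mem_of_pairingIn_pos hp' hne.symm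
  have hh := b.height_sub hδ
  rw [RootPairing.Base.height_one_of_mem_support hj] at hh
  refine ⟨⟨j, hj⟩, ⟨δ, hα.sub hj hδ⟩, ?_, hδ, by simp only [hh]; ring⟩
  have := (rootSystem H).algebraMap_pairingIn ℤ α j
  rw [rootSystem_pairing_apply] at this
  change 0 < α.1 (coroot j.1)
  rw [← this]
  exact Int.cast_pos.2 hp'

theorem cartanEntry_eq (i j : b.support) :
    (simpleRoot b j).1 (coroot (simpleRoot b i).1) = cartanEntry b i j := by
  have := (rootSystem H).algebraMap_pairingIn ℤ j.1 i.1
  rw [rootSystem_pairing_apply] at this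
  exact this.symm

theorem sub_notMem_range (i j : b.support) :
    rootVec (simpleRoot b j) - rootVec (simpleRoot b i) ∉ Set.range (rootSystem H).root :=
  b.sub_notMem_range_root j.2 i.2

variable {E : H.root → g} (hE : IsCartanWeyl E)

include hE

namespace IsCartanWeyl

theorem isNilpotent_ad (α : H.root) : IsNilpotent (LieAlgebra.ad ℝ g (E α)) :=
  LieAlgebra.isNilpotent_ad_of_mem_rootSpace H (isNonZero_root α) (hE.mem α)

theorem lie_eq_killing_smul {h : g} (hh : h ∈ gr (gradingElt b : g) 0) (α : H.root) :
    ⁅h, E α⁆ = killingForm ℝ g h ⁅E α, E (negRoot α)⁆ • E α := by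
  have := hE.lie_left α ⟨h, hE.mem_of_mem_gr_zero hh⟩
  rw [← killingForm_dualVec, killingForm_symm, ← hE.lie_neg] at this
  exact this

theorem lie_neg_eq_neg_killing_smul {h : g} (hh : h ∈ gr (gradingElt b : g) 0) (α : H.root) :
    ⁅h, E (negRoot α)⁆ = -(killingForm ℝ g h ⁅E α, E (negRoot α)⁆ • E (negRoot α)) := by
  rw [hE.lie_eq_killing_smul hh, negRoot_negRoot, ← lie_skew, map_neg, neg_smul]

theorem isTriangular {N : ℕ} (β : Fin N ≃ PosRoot b) :
    IsTriangular (gradingElt b : g) (fun k => E (β k).1) (fun k => E (negRoot (β k).1))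
      (fun k => b.height (β k).1) (simpleIndex β) where
  pos k := (β k).2
  mem_X k := hE.mem_gr _
  mem_Y k := by rw [← height_negRoot]; exact hE.mem_gr _
  nilp k := hE.isNilpotent_ad _
  dual i j := by
    classical
    rw [hE.killing_eq, negRoot_negRoot]
    refine if_congr ?_ rfl rfl
    rw [eq_comm, Subtype.val_inj, β.injective.eq_iff]
  lie_X h hh k := hE.lie_eq_killing_smul hh _
  lie_Y h hh k := hE.lie_neg_eq_neg_killing_smul hh _
  simple := simpleIndex_spec β
  lower k hk := by
    obtain ⟨i, δ, hp, hδ, hh⟩ := exists_sub_simpleRoot (β k).2 hk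
    refine ⟨i, β.symm δ, by rw [Equiv.apply_symm_apply]; exact hh, fun k' _ => ?_⟩
    rw [Equiv.apply_symm_apply, apply_simpleIndex, hE.killing_lie_ne_zero_iff hp hδ,
      Subtype.val_inj, β.injective.eq_iff]

/-- With the grading reversed, the negative root vectors play the role of the positive ones, and
every result on triangular products applies to `M⁻`. -/
theorem isTriangular_neg {N : ℕ} (β : Fin N ≃ PosRoot b) :
    IsTriangular (-(gradingElt b : g)) (fun k => E (negRoot (β k).1)) (fun k => E (β k).1)
      (fun k => b.height (β k).1) (simpleIndex β) where
  pos k := (β k).2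
  mem_X k := by rw [mem_gr_neg, ← height_negRoot]; exact hE.mem_gr _
  mem_Y k := by rw [mem_gr_neg, neg_neg]; exact hE.mem_gr _
  nilp k := hE.isNilpotent_ad _
  dual i j := by
    classical
    rw [hE.killing_eq]
    refine if_congr ?_ rfl rfl
    rw [eq_comm, (Function.LeftInverse.injective negRoot_negRoot).eq_iff, Subtype.val_inj,
      β.injective.eq_iff]
  lie_X h hh k := by
    rw [mem_gr_neg, neg_zero] at hh
    have := hE.lie_eq_killing_smul hh (negRoot (β k).1)
    rwa [negRoot_negRoot] at this
  lie_Y h hh k := by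
    rw [mem_gr_neg, neg_zero] at hh
    have := hE.lie_neg_eq_neg_killing_smul hh (negRoot (β k).1)
    rwa [negRoot_negRoot] at this
  simple := simpleIndex_spec β
  lower k hk := by
    obtain ⟨i, δ, hp, hδ, hh⟩ := exists_sub_simpleRoot (β k).2 hk
    refine ⟨i, β.symm δ, by rw [Equiv.apply_symm_apply]; exact hh, fun k' _ => ?_⟩
    have h1 : 0 < (negRoot (β k).1).1 (coroot (negRoot (simpleRoot b i)).1) := by
      rwa [negRoot_apply_coroot_negRoot]
    have h2 := hE.killing_lie_ne_zero_iff (α' := negRoot (β k').1) h1 (δ := negRoot δ.1) (by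
      rw [rootVec_negRoot, rootVec_negRoot, rootVec_negRoot, hδ]; abel)
    rw [negRoot_negRoot, negRoot_negRoot] at h2
    rw [Equiv.apply_symm_apply, apply_simpleIndex, h2,
      (Function.LeftInverse.injective negRoot_negRoot).eq_iff, Subtype.val_inj,
      β.injective.eq_iff]

theorem ad_pow_simple_eq_zero {i j : b.support} (hij : i ≠ j) :
    (LieAlgebra.ad ℝ g (E (simpleRoot b i)) ^ (1 - cartanEntry b i j).toNat)
      (E (simpleRoot b j)) = 0 :=
  hE.ad_pow_eq_zero (cartanEntry_eq i j) (sub_notMem_range i j)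
    fun h => hij (Subtype.ext (rootVec_injective h).symm)

theorem ad_pow_neg_simple_eq_zero {i j : b.support} (hij : i ≠ j) :
    (LieAlgebra.ad ℝ g (E (negRoot (simpleRoot b i))) ^ (1 - cartanEntry b i j).toNat)
      (E (negRoot (simpleRoot b j))) = 0 := by
  refine hE.ad_pow_eq_zero ?_ (fun h => sub_notMem_range j i ?_) fun h => ?_
  · rw [negRoot_apply_coroot_negRoot, cartanEntry_eq]
  · rw [rootVec_negRoot, rootVec_negRoot, neg_sub_neg] at h
    exact h
  · rw [rootVec_negRoot, rootVec_negRoot, neg_inj] at h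
    exact hij (Subtype.ext (rootVec_injective h).symm)

end IsCartanWeyl

omit hE

theorem killing_coweight (i : b.support) (α : H.root) :
    killingForm ℝ g (coweight b i : g) (dualVec α : g) = rootVec α (coweight b i) := by
  rw [killingForm_symm, killingForm_dualVec]

theorem killing_dualVec_dualVec (α β : H.root) :
    killingForm ℝ g (dualVec α : g) (dualVec β : g) = rootForm (rootVec α) (rootVec β) := rfl

end RootTriangular

/-! ### The `R`-matrix and the complexified Sklyanin bracket -/

section RMatrix

open LieAlgebra.IsKilling

variable {g : Type*} [LieRing g] [LieAlgebra ℝ g] [Module.Finite ℝ g] [IsKilling ℝ g]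
  {H : LieSubalgebra ℝ g} [H.IsCartanSubalgebra] [LieModule.IsTriangularizable ℝ H g]
  (b : (rootSystem H).Base) {n : Type*} [Fintype n] [DecidableEq n] {R : Type*} [CommRing R]
  [Algebra ℝ R] (ρ : g →ₗ[ℝ] Matrix n n ℝ) (E : H.root → g)

open Classical in
theorem sum_root {M : Type*} [AddCommMonoid M] (f : H.root → M) :
    ∑ α, f α = ∑ α : PosRoot b, (f α.1 + f (negRoot α.1)) := by
  rw [← Fintype.sum_subtype_add_sum_subtype b.IsPos f, Finset.sum_add_distrib]
  congr 1
  let φ : PosRoot b ≃ {α // ¬b.IsPos α} :=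
    { toFun := fun α => ⟨negRoot α.1, by
        have := α.2
        rw [b.isPos_iff] at this ⊢
        rw [height_negRoot]
        omega⟩
      invFun := fun α => ⟨negRoot α.1, (isPos_or_neg α.1).resolve_left α.2⟩
      left_inv := fun α => Subtype.ext (negRoot_negRoot _)
      right_inv := fun α => Subtype.ext (negRoot_negRoot _) }
  exact (Fintype.sum_equiv φ _ _ fun α => rfl).symm

/-- The dual bases which consist of root vectors and of bases of the Cartan subalgebra. -/
def basisLeft : H.root ⊕ b.support → g := Sum.elim E fun i => (weightElt b i : g)

/-- The basis dual to `basisLeft`. -/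
def basisRight : H.root ⊕ b.support → g :=
  Sum.elim (fun α => E (negRoot α)) fun i => (simpleCoroot b i : g)

/-- The degrees of the elements of `basisLeft`. -/
def basisDeg : H.root ⊕ b.support → ℤ := Sum.elim b.height fun _ => 0

theorem degTensor_rep {J : Type*} [Fintype J] (e e' : J → g) (deg : J → ℤ) (w : ℤ → ℝ) :
    degTensor (rep R ρ) e e' deg w =
      (∑ j, ρ (w (deg j) • e j) ⊗ₖ ρ (e' j)).map (algebraMap ℝ R) := by
  ext p q
  simp only [degTensor, Matrix.sum_apply, rep_apply, Matrix.kroneckerMap_apply, Matrix.map_apply,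
    map_sum, map_mul]

/-- Positive roots have sign 1 and negative ones sign -1. Pairing `α` with `-α` yields the
antisymmetric sum, and the Cartan part has weight zero. -/
theorem rMatrix_map : (rMatrix b ρ E).map (algebraMap ℝ R) =
    degTensor (rep R ρ) (basisLeft b E) (basisRight b E) (basisDeg b) wSign := by
  classical
  rw [degTensor_rep, Fintype.sum_sum_type, sum_root b, rMatrix]
  congr 1
  rw [Finset.sum_eq_zero (s := (Finset.univ : Finset b.support)), add_zero]
  · refine Finset.sum_congr (by ext; simp) fun α _ => ?_
    have h := α.2
    rw [b.isPos_iff] at h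
    simp only [basisLeft, basisRight, basisDeg, Sum.elim_inl, height_negRoot, negRoot_negRoot,
      wSign, Int.sign_neg, Int.sign_eq_one_of_pos h, Int.cast_neg, Int.cast_one, one_smul,
      neg_smul, map_neg, sub_eq_add_neg]
    congr 1
    ext; simp
  · intro i _
    simp [basisDeg, wSign]

theorem cartanTensor_map : (cartanTensor b ρ).map (algebraMap ℝ R) =
    degTensor (rep R ρ) (basisLeft b E) (basisRight b E) (basisDeg b) wCartan := by
  rw [degTensor_rep, Fintype.sum_sum_type, cartanTensor]
  congr 1
  rw [Finset.sum_eq_zero (s := (Finset.univ : Finset H.root)), zero_add]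
  · simp [basisLeft, basisRight, basisDeg, wCartan]
  · intro α _
    simp [basisDeg, wCartan, b.height_ne_zero α]

end RMatrix

/-! ### The Sklyanin bracket over the complex numbers. -/

section Complexify

variable {EM : Type*} [NormedAddCommGroup EM] [NormedSpace ℝ EM] {HM : Type*} [TopologicalSpace HM]
  {I : ModelWithCorners ℝ EM HM} {M : Type*} [TopologicalSpace M] [ChartedSpace HM M]

/-- Real-valued functions as complex-valued functions. -/
def ofRealFun : SmoothR I M →+* SmoothC I M where
  toFun f := ⟨fun m => (f m : ℂ), Complex.ofRealCLM.contMDiff.comp f.contMDiff⟩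
  map_one' := by ext m; exact Complex.ofReal_one
  map_mul' f f' := by ext m; exact Complex.ofReal_mul _ _
  map_zero' := by ext m; exact Complex.ofReal_zero
  map_add' f f' := by ext m; exact Complex.ofReal_add _ _

theorem complexify_br_ofRealFun (P : PoissonBracket ℝ (SmoothR I M)) (f f' : SmoothR I M) :
    P.complexify.br (ofRealFun f) (ofRealFun f') = ofRealFun (P.br f f') := by
  have h1 : ∀ f : SmoothR I M, reFun (ofRealFun f) = f := fun f => by
    ext m; exact Complex.ofReal_re (f m)
  have h2 : ∀ f : SmoothR I M, imFun (ofRealFun f) = 0 := fun f => by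
    ext m; exact Complex.ofReal_im (f m)
  change ofReIm (P.br (reFun (ofRealFun f)) (reFun (ofRealFun f')) - P.br (imFun (ofRealFun f))
    (imFun (ofRealFun f'))) (P.br (reFun (ofRealFun f)) (imFun (ofRealFun f')) +
      P.br (imFun (ofRealFun f)) (reFun (ofRealFun f'))) = _
  rw [h1, h1, h2, h2, map_zero, map_zero, map_zero, LinearMap.zero_apply, sub_zero, add_zero]
  ext m
  change ((P.br f f' m : ℝ) : ℂ) + Complex.I * ((0 : ℝ) : ℂ) = ((P.br f f' m : ℝ) : ℂ)
  simp

variable {n : Type*} [Fintype n] [DecidableEq n]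

theorem tensorBracket_complexify (P : PoissonBracket ℝ (SmoothR I M))
    {U : Matrix n n (SmoothR I M)} {R : Matrix (n × n) (n × n) ℝ} {γ : ℝ}
    (h : tensorBracket P U U = γ • (R.map (algebraMap ℝ (SmoothR I M)) *
      (inFirst U * inSecond U) - (inFirst U * inSecond U) * R.map (algebraMap ℝ (SmoothR I M)))) :
    tensorBracket P.complexify (U.map ofRealFun) (U.map ofRealFun) =
      algebraMap ℂ (SmoothC I M) γ • (R.map (algebraMap ℝ (SmoothC I M)) *
        (inFirst (U.map ofRealFun) * inSecond (U.map ofRealFun)) -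
        (inFirst (U.map ofRealFun) * inSecond (U.map ofRealFun)) *
          R.map (algebraMap ℝ (SmoothC I M))) := by
  have h1 : tensorBracket P.complexify (U.map ofRealFun) (U.map ofRealFun) =
      (tensorBracket P U U).map ofRealFun := by
    ext1 p q
    exact complexify_br_ofRealFun P _ _
  have h2 : inFirst (U.map ofRealFun) = (inFirst U).map (ofRealFun : _ →+* SmoothC I M) := by
    simp only [inFirst]
    rw [← Matrix.map_one ofRealFun (map_zero _) (map_one _)]
    ext1 p q
    exact (map_mul ofRealFun _ _).symm
  have h3 : inSecond (U.map ofRealFun) = (inSecond U).map (ofRealFun : _ →+* SmoothC I M) := by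
    simp only [inSecond]
    rw [← Matrix.map_one ofRealFun (map_zero _) (map_one _)]
    ext1 p q
    exact (map_mul ofRealFun _ _).symm
  have h4 : R.map (algebraMap ℝ (SmoothC I M)) =
      (R.map (algebraMap ℝ (SmoothR I M))).map (ofRealFun : _ →+* SmoothC I M) := by
    ext; rfl
  rw [h1, h, h2, h3, h4, ← Matrix.map_mul, ← Matrix.map_mul, ← Matrix.map_mul]
  ext1 p q
  rw [Matrix.map_apply, Matrix.smul_apply, Matrix.smul_apply, Algebra.smul_def, map_mul,
    Matrix.sub_apply, Matrix.sub_apply, map_sub]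
  rfl

end Complexify

/-! ### The brackets of the exponents of the Gauss factors -/

section Factors

open LieAlgebra.IsKilling

variable {g : Type*} [LieRing g] [LieAlgebra ℝ g] [Module.Finite ℝ g] [IsKilling ℝ g]
  {H : LieSubalgebra ℝ g} [H.IsCartanSubalgebra] [LieModule.IsTriangularizable ℝ H g]
  {b : (rootSystem H).Base} [DecidableEq b.support] {n : Type*} [Fintype n] [DecidableEq n]
  {R : Type*} [CommRing R] [Algebra ℝ R] [Algebra ℂ R] [IsScalarTower ℝ ℂ R]
  {P : PoissonBracket ℂ R} {ρ : g →ₗ[ℝ] Matrix n n ℝ} {E : H.root → g} {N : ℕ}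
  {β : Fin N ≃ PosRoot b} {ap am : Fin N → R} {q : b.support → R}
  {xp xm : Fin N → (Matrix n n R)ˣ} {xd : b.support → (Matrix n n R)ˣ} {m d p : (Matrix n n R)ˣ}

/-- The factors of a Gauss decomposition, with their exponents. -/
structure IsFactorisation (P : PoissonBracket ℂ R) (ρ : g →ₗ[ℝ] Matrix n n ℝ) (E : H.root → g)
    (β : Fin N ≃ PosRoot b) (am : Fin N → R) (q : b.support → R) (ap : Fin N → R)
    (xm : Fin N → (Matrix n n R)ˣ) (xd : b.support → (Matrix n n R)ˣ)
    (xp : Fin N → (Matrix n n R)ˣ) (m d p : (Matrix n n R)ˣ) : Prop where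
  cartanWeyl : IsCartanWeyl E
  plus : IsTriangularProduct P ρ (gradingElt b : g) (fun k => E (β k).1)
    (fun k => E (negRoot (β k).1)) (fun k => b.height (β k).1) (simpleIndex β) ap xp p
  minus : IsTriangularProduct P ρ (-(gradingElt b : g)) (fun k => E (negRoot (β k).1))
    (fun k => E (β k).1) (fun k => b.height (β k).1) (simpleIndex β) am xm m
  torus : IsTorusProduct P ρ (gradingElt b : g) (fun i => (weightElt b i : g))
    (fun i => (simpleCoroot b i : g)) q xd d

namespace IsFactorisation

variable (F : IsFactorisation P ρ E β am q ap xm xd xp m d p)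

include F

theorem isDualBasis : IsDualBasis (gradingElt b : g) (basisLeft b E) (basisRight b E)
    (basisDeg b) := F.cartanWeyl.isDualBasis

theorem isGauss : IsGauss P ρ (gradingElt b : g) (basisLeft b E) (basisRight b E) (basisDeg b)
    m d p :=
  isGauss_of_products F.isDualBasis F.torus F.cartanWeyl.lie_weightElt F.plus F.minus

variable {c : ℝ} (hc : c ≠ 0)
  (hU : tensorBracket P ((m * d * p : (Matrix n n R)ˣ) : Matrix n n R) (m * d * p).val =
    algebraMap ℂ R c • (degTensor (rep R ρ) (basisLeft b E) (basisRight b E) (basisDeg b) wSign *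
      (inFirst (m * d * p : (Matrix n n R)ˣ).val * inSecond (m * d * p : (Matrix n n R)ˣ).val) -
      (inFirst (m * d * p : (Matrix n n R)ˣ).val * inSecond (m * d * p : (Matrix n n R)ˣ).val) *
        degTensor (rep R ρ) (basisLeft b E) (basisRight b E) (basisDeg b) wSign))

include hU

theorem tensorBracket_eq (i j : Fin 3) :
    tensorBracket P ((![m, d, p] i : (Matrix n n R)ˣ) : Matrix n n R)
      ((![m, d, p] j : (Matrix n n R)ˣ) : Matrix n n R) =
      (c : ℂ) • brackets
        (degTensor (rep R ρ) (basisLeft b E) (basisRight b E) (basisDeg b) wSign)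
        (degTensor (rep R ρ) (basisLeft b E) (basisRight b E) (basisDeg b) wCartan)
        (m : Matrix n n R) d p i j := by
  rw [F.isGauss.tensorBracket_eq rfl hU i j, algebraMap_smul]

theorem simpleAction_plus : SimpleAction P ρ (fun k => E (β k).1) (fun k => E (negRoot (β k).1))
    (simpleIndex β) ap p (c : ℂ) := by
  refine F.plus.map_br_simple F.isDualBasis ?_ (F.tensorBracket_eq hU 2 2)
  rintro _ rfl
  exact F.plus.commute_casimir F.isDualBasis

/-- Reversing the grading changes the sign of `R` but not of `H`. The bracket of `m` with constant
`c` therefore has the form of the bracket of `p` with constant `-c`; this is the origin of q⁻¹. -/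
theorem simpleAction_minus : SimpleAction P ρ (fun k => E (negRoot (β k).1)) (fun k => E (β k).1)
    (simpleIndex β) am m ((-c : ℝ) : ℂ) := by
  have hd := F.isDualBasis.neg
  obtain ⟨h1, h2, h3⟩ := degTensor_neg_deg (e := basisLeft b E) (e' := basisRight b E)
    (deg := basisDeg b) (rep R ρ)
  refine F.minus.map_br_simple hd ?_ ?_
  · rintro _ rfl
    exact F.minus.commute_casimir hd
  · rw [h1, h2]
    refine (F.tensorBracket_eq hU 0 0).trans ?_
    rw [Complex.ofReal_neg, neg_smul, ← smul_neg]
    congr 1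
    simp only [brackets, Matrix.cons_val_zero, neg_mul, mul_neg]
    abel

theorem br_torus (i j : b.support) : P.br (q i) (q j) = 0 :=
  F.torus.br_exponent_eq_zero (by simpa [brackets] using F.tensorBracket_eq hU 1 1) i j

theorem br_plus_minus (i j : Fin N) : P.br (ap i) (am j) = 0 :=
  F.plus.br_eq_zero_of_tensorBracket F.minus (by simpa [brackets] using F.tensorBracket_eq hU 2 0)
    i j

include hc

theorem br_torus_plus (i : b.support) (k : Fin N) :
    (c : ℂ)⁻¹ • P.br (q i) (ap k) = algebraMap ℝ R (rootVec (β k).1 (simpleCoroot b i)) * ap k := by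
  have hy := coe_mem_gr b (simpleCoroot b i)
  have h := F.torus.map_br_exponent_of_eq F.isDualBasis (X := (p : Matrix n n R))
    (c := algebraMap ℂ R c)
    (by rw [algebraMap_smul]; exact F.tensorBracket_eq hU 1 2) F.isGauss.d_wCartan.1 (i := i) hy
  have hc' : (c : ℂ) ≠ 0 := by exact_mod_cast hc
  have h2 := F.plus.br_eq_smul (c := (c : ℂ)⁻¹) hy (f := q i) (by
    rw [h, algebraMap_smul, smul_smul, inv_mul_cancel₀ hc', one_smul]) k
  rw [F.cartanWeyl.lie_neg, killingForm_symm, killingForm_dualVec] at h2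
  rw [h2, Algebra.smul_def]

/-- Two signs cancel, that of `{d₁, m₂}` and that of the negative roots. This is why the Cartan
charges act on both nilpotent families with the same sign. -/
theorem br_torus_minus (i : b.support) (k : Fin N) :
    (c : ℂ)⁻¹ • P.br (q i) (am k) = algebraMap ℝ R (rootVec (β k).1 (simpleCoroot b i)) * am k := by
  have hy := coe_mem_gr b (simpleCoroot b i)
  have h := F.torus.map_br_exponent_of_eq F.isDualBasis (X := (m : Matrix n n R))
    (c := -algebraMap ℂ R c)
    (by
      rw [neg_smul, ← smul_neg, algebraMap_smul]
      exact F.tensorBracket_eq hU 1 0) F.isGauss.d_wCartan.1 (i := i) hy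
  have hc' : (c : ℂ) ≠ 0 := by exact_mod_cast hc
  have h2 := F.minus.br_eq_smul (c := -(c : ℂ)⁻¹) (h := (simpleCoroot b i : g))
    (by rw [mem_gr_neg, neg_zero]; exact hy) (f := q i) (by
    rw [h, neg_smul, neg_smul, smul_neg, neg_neg, algebraMap_smul, smul_smul, inv_mul_cancel₀ hc',
      one_smul]) k
  have h3 := F.cartanWeyl.lie_neg (negRoot (β k).1)
  rw [negRoot_negRoot, dualVec_negRoot] at h3
  rw [h3, killingForm_symm, NegMemClass.coe_neg, map_neg, LinearMap.neg_apply, killingForm_dualVec,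
    neg_smul, Algebra.smul_def (-(rootVec _ _)), map_neg, neg_mul, neg_inj] at h2
  exact h2

omit hc

variable {κ : b.support → ℂ} (hκ : ∀ i, κ i ≠ 0) {e : b.support → R} {i j : b.support}
  (hij : i ≠ j)

include hκ hij

theorem serre_plus (he : ∀ i, ap (simpleIndex β i) = κ i • e i) :
    serreRight b P c e i j = 0 ∧ serreLeft b P c e i j = 0 := by
  have hs : ∀ l, ⁅E (β (simpleIndex β l)).1, E (negRoot (β (simpleIndex β l)).1)⁆ =
      (dualVec (simpleRoot b l) : g) := fun l => by
    rw [apply_simpleIndex, F.cartanWeyl.lie_neg]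
  have hw : ∀ i j, killingForm ℝ g ⁅E (β (simpleIndex β i)).1, E (negRoot (β (simpleIndex β i)).1)⁆
      ⁅E (β (simpleIndex β j)).1, E (negRoot (β (simpleIndex β j)).1)⁆ =
      rootForm (rootVec (simpleRoot b i)) (rootVec (simpleRoot b j)) := fun i j => by
    rw [hs, hs, killing_dualVec_dualVec]
  -- The fundamental co-weight of `j` is orthogonal to the dual vector of `α_i` and pairs to 1 with
  -- that of `α_j`, as required of `y`.
  have hy := coe_mem_gr b (coweight b j)
  have hyi : killingForm ℝ g (coweight b j : g)
      ⁅E (β (simpleIndex β i)).1, E (negRoot (β (simpleIndex β i)).1)⁆ = 0 := by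
    rw [hs, killing_coweight, simpleRoot_coweight, if_neg hij]
  have hyj : killingForm ℝ g (coweight b j : g)
      ⁅E (β (simpleIndex β j)).1, E (negRoot (β (simpleIndex β j)).1)⁆ = 1 := by
    rw [hs, killing_coweight, simpleRoot_coweight, if_pos rfl]
  have hS : (LieAlgebra.ad ℝ g (E (negRoot (β (simpleIndex β i)).1)) ^
      (1 - cartanEntry b i j).toNat) (E (negRoot (β (simpleIndex β j)).1)) = 0 := by
    rw [apply_simpleIndex, apply_simpleIndex, F.cartanWeyl.ad_pow_neg_simple_eq_zero hij]
  exact ⟨F.plus.serreRight_eq_zero b (F.simpleAction_plus hU) hκ he hw hy hyi hyj hS,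
    F.plus.serreLeft_eq_zero b (F.simpleAction_plus hU) hκ he hw hy hyi hyj hS⟩

theorem serre_minus (he : ∀ i, am (simpleIndex β i) = κ i • e i) :
    serreRight b P (-c) e i j = 0 ∧ serreLeft b P (-c) e i j = 0 := by
  have hs : ∀ l, ⁅E (negRoot (β (simpleIndex β l)).1), E (β (simpleIndex β l)).1⁆ =
      -(dualVec (simpleRoot b l) : g) := fun l => by
    rw [← lie_skew, apply_simpleIndex, F.cartanWeyl.lie_neg]
  have hw : ∀ i j, killingForm ℝ g ⁅E (negRoot (β (simpleIndex β i)).1), E (β (simpleIndex β i)).1⁆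
      ⁅E (negRoot (β (simpleIndex β j)).1), E (β (simpleIndex β j)).1⁆ =
      rootForm (rootVec (simpleRoot b i)) (rootVec (simpleRoot b j)) := fun i j => by
    rw [hs, hs, map_neg, map_neg, LinearMap.neg_apply, neg_neg, killing_dualVec_dualVec]
  have hy : -(coweight b j : g) ∈ gr (-(gradingElt b : g)) 0 := by
    rw [mem_gr_neg, neg_zero]
    exact neg_mem (coe_mem_gr b (coweight b j))
  have hyi : killingForm ℝ g (-(coweight b j : g))
      ⁅E (negRoot (β (simpleIndex β i)).1), E (β (simpleIndex β i)).1⁆ = 0 := by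
    rw [hs, map_neg, map_neg, LinearMap.neg_apply, neg_neg, killing_coweight, simpleRoot_coweight,
      if_neg hij]
  have hyj : killingForm ℝ g (-(coweight b j : g))
      ⁅E (negRoot (β (simpleIndex β j)).1), E (β (simpleIndex β j)).1⁆ = 1 := by
    rw [hs, map_neg, map_neg, LinearMap.neg_apply, neg_neg, killing_coweight, simpleRoot_coweight,
      if_pos rfl]
  have hS : (LieAlgebra.ad ℝ g (E (β (simpleIndex β i)).1) ^
      (1 - cartanEntry b i j).toNat) (E (β (simpleIndex β j)).1) = 0 := by
    rw [apply_simpleIndex, apply_simpleIndex, F.cartanWeyl.ad_pow_simple_eq_zero hij]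
  exact ⟨F.minus.serreRight_eq_zero b (F.simpleAction_minus hU) hκ he hw hy hyi hyj hS,
    F.minus.serreLeft_eq_zero b (F.simpleAction_minus hU) hκ he hw hy hyi hyj hS⟩

end IsFactorisation

end Factors

/-! ### Poisson subalgebras -/

section Generated

variable {k A : Type*} [CommRing k] [CommRing A] [Algebra k A] (P : PoissonBracket k A)

namespace PoissonBracket

theorem subset_generated (S : Set A) : S ⊆ P.generated S := fun x hx => by
  rw [PoissonBracket.generated, SetLike.mem_coe, Algebra.mem_sInf]
  exact fun B hB => hB.1 hx

theorem br_mem_generated (S : Set A) :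
    ∀ f ∈ P.generated S, ∀ h ∈ P.generated S, P.br f h ∈ P.generated S := fun f hf h hh => by
  rw [PoissonBracket.generated, Algebra.mem_sInf] at *
  exact fun B hB => hB.2 f (hf B hB) h (hh B hB)

variable {P} in
theorem generated_le {S : Set A} {B : Subalgebra k A} (hS : S ⊆ B)
    (hB : ∀ f ∈ B, ∀ h ∈ B, P.br f h ∈ B) : P.generated S ≤ B :=
  sInf_le (show B ∈ {B : Subalgebra k A | S ⊆ B ∧ _} from ⟨hS, hB⟩)

theorem generated_eq_of_subset {S T : Set A} (h : S ⊆ P.generated T) (h' : T ⊆ P.generated S) :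
    P.generated S = P.generated T :=
  le_antisymm (generated_le h (P.br_mem_generated T)) (generated_le h' (P.br_mem_generated S))

/-- The elements which Poisson-commute with every element of a set. -/
def centralizer (T : Set A) : Subalgebra k A where
  carrier := {f | ∀ t ∈ T, P.br t f = 0}
  mul_mem' hf hh t ht := by rw [P.leibniz, hf t ht, hh t ht, zero_mul, mul_zero, add_zero]
  add_mem' hf hh t ht := by rw [map_add, hf t ht, hh t ht, add_zero]
  algebraMap_mem' c t _ := by
    have h : P.br t 1 = 0 := by simpa using P.leibniz t 1 1
    rw [Algebra.algebraMap_eq_smul_one, map_smul, h, smul_zero]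

/-- The Jacobi identity. It makes the centraliser a Poisson subalgebra, so that commutation needs to
be checked on generators only. -/
theorem br_mem_centralizer (T : Set A) :
    ∀ f ∈ P.centralizer T, ∀ h ∈ P.centralizer T, P.br f h ∈ P.centralizer T := by
  intro f hf h hh t ht
  have := P.jacobi t f h
  rwa [P.skew h t, hh t ht, hf t ht, neg_zero, map_zero, map_zero, add_zero, add_zero] at this

theorem br_eq_zero_of_generated {S T : Set A} (h : ∀ x ∈ S, ∀ y ∈ T, P.br x y = 0) :
    ∀ x ∈ P.generated S, ∀ y ∈ P.generated T, P.br x y = 0 := by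
  have h1 : P.generated S ≤ P.centralizer T :=
    generated_le (fun x hx t ht => by rw [P.skew, h x hx t ht, neg_zero])
      (P.br_mem_centralizer T)
  have h2 : P.generated T ≤ P.centralizer (P.generated S) :=
    generated_le (fun t ht x hx => by rw [P.skew, h1 hx t ht, neg_zero])
      (P.br_mem_centralizer _)
  exact fun x hx y hy => h2 hy x hx

end PoissonBracket

end Generated

/-! ### The charges -/

section Charges

open LieAlgebra.IsKilling

variable {EM : Type*} [NormedAddCommGroup EM] [NormedSpace ℝ EM] {HM : Type*} [TopologicalSpace HM]
  {I : ModelWithCorners ℝ EM HM} {M : Type*} [TopologicalSpace M] [ChartedSpace HM M]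

instance : IsScalarTower ℝ ℂ (SmoothC I M) :=
  ⟨fun r c f => by ext m; exact smul_assoc r c (f m)⟩

variable {g : Type*} [LieRing g] [LieAlgebra ℝ g]
  {n : Type*} [Fintype n] [DecidableEq n] {ρ : g →ₗ[ℝ] Matrix n n ℝ}

theorem exists_isTriangularProduct (P : PoissonBracket ℂ (SmoothC I M)) (hρ : IsFaithfulRep ρ)
    {N : ℕ} {ι : Type*} {h₀ : g} {X Y : Fin N → g} {ht : Fin N → ℤ} {s : ι → Fin N}
    (T : IsTriangular h₀ X Y ht s) (c : Fin N → ℂ) (q : Fin N → SmoothC I M)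
    {U : Matrix n n (SmoothC I M)}
    (h : ∀ m : M, U.map (fun f => f m) =
      (List.ofFn fun k => NormedSpace.exp ((c k * q k m) • rhoC ρ (X k))).prod) :
    ∃ x u, U = Units.val u ∧
      IsTriangularProduct P ρ h₀ X Y ht s (fun k => c k • q k) x u :=
  ⟨fun k => expUnit (c k • q k) (rhoC ρ (X k)), _, eq_prod_expUnit c q X h,
    { T with
      faithful := hρ
      exp := fun _ => isExpElt_expUnit P hρ _ _
      exp_inv := fun _ => by rw [expUnit_inv]; exact isExpElt_expUnit P hρ _ _
      prod := rfl }⟩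

theorem exists_isTorusProduct (P : PoissonBracket ℂ (SmoothC I M)) (hρ : IsFaithfulRep ρ)
    {K : Type*} [Fintype K] [DecidableEq K] {h₀ : g} {Z y : K → g} (hZ : ∀ i, Z i ∈ gr h₀ 0)
    (habel : ∀ v ∈ gr h₀ 0, ∀ w ∈ gr h₀ 0, ⁅v, w⁆ = 0)
    (hdual : ∀ i j, killingForm ℝ g (y i) (Z j) = if i = j then 1 else 0)
    (c : ℂ) (q : K → SmoothC I M) {U : Matrix n n (SmoothC I M)}
    (h : ∀ m : M, U.map (fun f => f m) = NormedSpace.exp (∑ i, (c * q i m) • rhoC ρ (Z i))) :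
    ∃ x u, U = Units.val u ∧ IsTorusProduct P ρ h₀ Z y (fun i => c • q i) x u :=
  ⟨fun i => expUnit (c • q i) (rhoC ρ (Z i)), _,
    eq_prod_expUnit_of_commute c q Z
      (fun i j => commute_rhoC hρ (habel _ (hZ i) _ (hZ j))) h,
    { faithful := hρ
      mem := hZ
      abel := habel
      dual := hdual
      exp := fun _ => isExpElt_expUnit P hρ _ _
      prod := rfl }⟩

end Charges

/-! ### The Poisson algebras of the charges -/

section ChargeAlgebras

open LieAlgebra.IsKilling

variable {g : Type*} [LieRing g] [LieAlgebra ℝ g] [Module.Finite ℝ g] [IsKilling ℝ g]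
  {H : LieSubalgebra ℝ g} [H.IsCartanSubalgebra] [LieModule.IsTriangularizable ℝ H g]
  {b : (rootSystem H).Base} [DecidableEq b.support] {n : Type*} [Fintype n] [DecidableEq n]
  {R : Type*} [CommRing R] [Algebra ℝ R] [Algebra ℂ R] [IsScalarTower ℝ ℂ R]
  {P : PoissonBracket ℂ R} {ρ : g →ₗ[ℝ] Matrix n n ℝ} {E : H.root → g} {N : ℕ}
  {β : Fin N ≃ PosRoot b} {xp xm : Fin N → (Matrix n n R)ˣ} {xd : b.support → (Matrix n n R)ˣ}
  {m d p : (Matrix n n R)ˣ} {κ κ' : H.root → ℂ} {κd : ℂ} {QE : H.root → R} {QH : b.support → R}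

namespace IsFactorisation

variable (F : IsFactorisation P ρ E β
    (fun k => κ' (negRoot (β k).1) • QE (negRoot (β k).1)) (fun i => κd • QH i)
    (fun k => κ (β k).1 • QE (β k).1) xm xd xp m d p)
  (hκ : ∀ α, κ α ≠ 0) (hκ' : ∀ α, κ' α ≠ 0) (hd : κd ≠ 0) {c : ℝ} (hc : c ≠ 0)
  (hU : tensorBracket P ((m * d * p : (Matrix n n R)ˣ) : Matrix n n R) (m * d * p).val =
    algebraMap ℂ R c • (degTensor (rep R ρ) (basisLeft b E) (basisRight b E) (basisDeg b) wSign *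
      (inFirst (m * d * p : (Matrix n n R)ˣ).val * inSecond (m * d * p : (Matrix n n R)ˣ).val) -
      (inFirst (m * d * p : (Matrix n n R)ˣ).val * inSecond (m * d * p : (Matrix n n R)ˣ).val) *
        degTensor (rep R ρ) (basisLeft b E) (basisRight b E) (basisDeg b) wSign))

theorem _root_.SklyaninCharges.smul_mem_iff_of_ne_zero {k A : Type*} [Field k] [CommRing A]
    [Algebra k A] (S : Subalgebra k A) {a : k} (ha : a ≠ 0) {x : A} : a • x ∈ S ↔ x ∈ S :=
  ⟨fun h => by simpa [smul_smul, inv_mul_cancel₀ ha] using S.smul_mem h a⁻¹, fun h => S.smul_mem h a⟩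

include F hU hc

include hκ in
theorem charge_mem {S : Subalgebra ℂ R} (hS : ∀ f ∈ S, ∀ h ∈ S, P.br f h ∈ S)
    (he : ∀ i, QE (simpleRoot b i) ∈ S) (α : PosRoot b) : QE α.1 ∈ S := by
  have h := F.plus.mem_of_simple_mem (F.simpleAction_plus hU) (by exact_mod_cast hc) S hS
    (fun i => by rw [smul_mem_iff_of_ne_zero S (hκ _), apply_simpleIndex]; exact he i) (β.symm α)
  rwa [smul_mem_iff_of_ne_zero S (hκ _), Equiv.apply_symm_apply] at h

include hκ' in
theorem charge_neg_mem {S : Subalgebra ℂ R} (hS : ∀ f ∈ S, ∀ h ∈ S, P.br f h ∈ S)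
    (he : ∀ i, QE (negRoot (simpleRoot b i)) ∈ S) (α : PosRoot b) : QE (negRoot α.1) ∈ S := by
  have h := F.minus.mem_of_simple_mem (F.simpleAction_minus hU)
    (by exact_mod_cast neg_ne_zero.2 hc) S hS
    (fun i => by rw [smul_mem_iff_of_ne_zero S (hκ' _), apply_simpleIndex]; exact he i) (β.symm α)
  rwa [smul_mem_iff_of_ne_zero S (hκ' _), Equiv.apply_symm_apply] at h

include hκ in
theorem spansUqNilpotent_plus : SpansUqNilpotent b P c (fun i => QE (simpleRoot b i))
    (P.generated {x | ∃ α : PosRoot b, x = QE α.1}) where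
  generates := by
    refine P.generated_eq_of_subset ?_ ?_
    · rintro _ ⟨i, rfl⟩
      exact P.subset_generated _ ⟨⟨simpleRoot b i, isPos_simpleRoot i⟩, rfl⟩
    · rintro _ ⟨α, rfl⟩
      refine F.charge_mem hκ hc hU (P.br_mem_generated _) (fun i => ?_) α
      exact P.subset_generated _ ⟨i, rfl⟩
  serre_right i j hij := (F.serre_plus hU (κ := fun i => κ (simpleRoot b i)) (fun i => hκ _) hij
    (fun i => by rw [apply_simpleIndex])).1
  serre_left i j hij := (F.serre_plus hU (κ := fun i => κ (simpleRoot b i)) (fun i => hκ _) hij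
    (fun i => by rw [apply_simpleIndex])).2

include hκ' in
theorem spansUqNilpotent_minus : SpansUqNilpotent b P (-c) (fun i => QE (negRoot (simpleRoot b i)))
    (P.generated {x | ∃ α : PosRoot b, x = QE (negRoot α.1)}) where
  generates := by
    refine P.generated_eq_of_subset ?_ ?_
    · rintro _ ⟨i, rfl⟩
      exact P.subset_generated _ ⟨⟨simpleRoot b i, isPos_simpleRoot i⟩, rfl⟩
    · rintro _ ⟨α, rfl⟩
      refine F.charge_neg_mem hκ' hc hU (P.br_mem_generated _) (fun i => ?_) α
      exact P.subset_generated _ ⟨i, rfl⟩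
  serre_right i j hij := (F.serre_minus hU (κ := fun i => κ' (negRoot (simpleRoot b i)))
    (fun i => hκ' _) hij (fun i => by rw [apply_simpleIndex])).1
  serre_left i j hij := (F.serre_minus hU (κ := fun i => κ' (negRoot (simpleRoot b i)))
    (fun i => hκ' _) hij (fun i => by rw [apply_simpleIndex])).2

omit hc in
include hκ hκ' in
theorem br_charge_charge (α α' : PosRoot b) : P.br (QE α.1) (QE (negRoot α'.1)) = 0 := by
  have h := F.br_plus_minus hU (β.symm α) (β.symm α')
  rw [map_smul, map_smul, LinearMap.smul_apply, smul_smul, Equiv.apply_symm_apply,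
    Equiv.apply_symm_apply] at h
  have h' := congrArg ((κ' (negRoot α'.1) * κ α.1)⁻¹ • ·) h
  simpa [smul_smul, hκ α.1, hκ' (negRoot α'.1)] using h'

omit hc in
include hd in
theorem br_cartan (i j : b.support) : P.br (QH i) (QH j) = 0 := by
  have h := F.br_torus hU i j
  rw [map_smul, map_smul, LinearMap.smul_apply, smul_smul] at h
  have h' := congrArg ((κd * κd)⁻¹ • ·) h
  simpa [smul_smul, hd] using h'

include hκ in
theorem br_cartan_charge (i : b.support) (α : PosRoot b) :
    (κd * (c : ℂ)⁻¹) • P.br (QH i) (QE α.1) =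
      ((rootVec α.1 (simpleCoroot b i) : ℝ) : ℂ) • QE α.1 := by
  have h := F.br_torus_plus hc hU i (β.symm α)
  rw [map_smul, map_smul, LinearMap.smul_apply, Equiv.apply_symm_apply,
    IsScalarTower.algebraMap_apply ℝ ℂ R, ← Algebra.smul_def, smul_comm _ (κ α.1),
    smul_comm _ (κ α.1)] at h
  have h' := congrArg ((κ α.1)⁻¹ • ·) h
  simp only [smul_smul, inv_mul_cancel₀ (hκ α.1), one_mul, ← mul_assoc] at h'
  rw [mul_comm κd]
  exact h'

include hκ' in
theorem br_cartan_charge_neg (i : b.support) (α : PosRoot b) :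
    (κd * (c : ℂ)⁻¹) • P.br (QH i) (QE (negRoot α.1)) =
      ((rootVec α.1 (simpleCoroot b i) : ℝ) : ℂ) • QE (negRoot α.1) := by
  have h := F.br_torus_minus hc hU i (β.symm α)
  rw [map_smul, map_smul, LinearMap.smul_apply, Equiv.apply_symm_apply,
    IsScalarTower.algebraMap_apply ℝ ℂ R, ← Algebra.smul_def, smul_comm _ (κ' _),
    smul_comm _ (κ' _)] at h
  have h' := congrArg ((κ' (negRoot α.1))⁻¹ • ·) h
  simp only [smul_smul, inv_mul_cancel₀ (hκ' (negRoot α.1)), one_mul, ← mul_assoc] at h'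
  rw [mul_comm κd]
  exact h'

include hκ hd in
theorem spansUqBorel_plus (hcd : κd * (c : ℂ)⁻¹ = Complex.I) :
    SpansUqBorel b P c 1 QH (fun i => QE (simpleRoot b i))
      (P.generated (Set.range QH ∪ {x | ∃ α : PosRoot b, x = QE α.1})) where
  generates := by
    refine P.generated_eq_of_subset ?_ ?_
    · rintro _ (⟨i, rfl⟩ | ⟨i, rfl⟩)
      · exact P.subset_generated _ (Or.inl ⟨i, rfl⟩)
      · exact P.subset_generated _ (Or.inr ⟨⟨simpleRoot b i, isPos_simpleRoot i⟩, rfl⟩)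
    · rintro _ (⟨i, rfl⟩ | ⟨α, rfl⟩)
      · exact P.subset_generated _ (Or.inl ⟨i, rfl⟩)
      · refine F.charge_mem hκ hc hU (P.br_mem_generated _) (fun i => ?_) α
        exact P.subset_generated _ (Or.inr ⟨i, rfl⟩)
  cartan_comm := F.br_cartan hd hU
  cartan_act i j := by
    rw [← hcd, F.br_cartan_charge hκ hc hU i ⟨simpleRoot b j, isPos_simpleRoot j⟩, one_mul]
    change ((((simpleRoot b j).1 (coroot (simpleRoot b i).1) : ℝ)) : ℂ) • _ = _
    rw [cartanEntry_eq, Complex.ofReal_intCast]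
  nilpotent := by
    have h := F.spansUqNilpotent_plus hκ hc hU
    exact ⟨rfl, h.serre_right, h.serre_left⟩

include hκ' hd in
theorem spansUqBorel_minus (hcd : κd * (c : ℂ)⁻¹ = Complex.I) :
    SpansUqBorel b P (-c) (-1) (fun i => -QH i) (fun i => QE (negRoot (simpleRoot b i)))
      (P.generated (Set.range QH ∪ {x | ∃ α : PosRoot b, x = QE (negRoot α.1)})) where
  generates := by
    refine P.generated_eq_of_subset ?_ ?_
    · rintro _ (⟨i, rfl⟩ | ⟨i, rfl⟩)
      · exact neg_mem (P.subset_generated _ (Or.inl ⟨i, rfl⟩))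
      · exact P.subset_generated _ (Or.inr ⟨⟨simpleRoot b i, isPos_simpleRoot i⟩, rfl⟩)
    · rintro _ (⟨i, rfl⟩ | ⟨α, rfl⟩)
      · exact neg_mem_iff.1 (P.subset_generated _ (Or.inl ⟨i, rfl⟩))
      · refine F.charge_neg_mem hκ' hc hU (P.br_mem_generated _) (fun i => ?_) α
        exact P.subset_generated _ (Or.inr ⟨i, rfl⟩)
  cartan_comm i j := by
    rw [map_neg, map_neg, LinearMap.neg_apply, F.br_cartan hd hU, neg_zero, neg_zero]
  cartan_act i j := by
    rw [map_neg, LinearMap.neg_apply, smul_neg, ← hcd,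
      F.br_cartan_charge_neg hκ' hc hU i ⟨simpleRoot b j, isPos_simpleRoot j⟩, neg_one_mul,
      Int.cast_neg, neg_smul]
    change -((((simpleRoot b j).1 (coroot (simpleRoot b i).1) : ℝ) : ℂ) • _) = _
    rw [cartanEntry_eq, Complex.ofReal_intCast]
  nilpotent := by
    have h := F.spansUqNilpotent_minus hκ' hc hU
    exact ⟨rfl, h.serre_right, h.serre_left⟩

include hκ hκ' in
theorem generated_simple_charges :
    P.generated (Set.range QH ∪ Set.range (fun i => QE (simpleRoot b i)) ∪
      Set.range (fun i => QE (negRoot (simpleRoot b i)))) =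
      P.generated (Set.range QH ∪ Set.range QE) := by
  refine P.generated_eq_of_subset ?_ ?_
  · rintro _ ((⟨i, rfl⟩ | ⟨i, rfl⟩) | ⟨i, rfl⟩)
    · exact P.subset_generated _ (Or.inl ⟨i, rfl⟩)
    · exact P.subset_generated _ (Or.inr ⟨_, rfl⟩)
    · exact P.subset_generated _ (Or.inr ⟨_, rfl⟩)
  · rintro _ (⟨i, rfl⟩ | ⟨α, rfl⟩)
    · exact P.subset_generated _ (Or.inl (Or.inl ⟨i, rfl⟩))
    · rcases isPos_or_neg (b := b) α with hα | hα
      · refine F.charge_mem hκ hc hU (P.br_mem_generated _) (fun i => ?_) ⟨α, hα⟩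
        exact P.subset_generated _ (Or.inl (Or.inr ⟨i, rfl⟩))
      · rw [← negRoot_negRoot α]
        refine F.charge_neg_mem hκ' hc hU (P.br_mem_generated _) (fun i => ?_) ⟨negRoot α, hα⟩
        exact P.subset_generated _ (Or.inr ⟨i, rfl⟩)

end IsFactorisation

end ChargeAlgebras

/-! ### Involutions of Gauss decompositions -/

section Involution

variable {g : Type*} [LieRing g] [LieAlgebra ℝ g] {n : Type*} [Fintype n] [DecidableEq n]
  {R : Type*} [CommRing R] [Algebra ℝ R] {ρ : g →ₗ[ℝ] Matrix n n ℝ} {h₀ : g} (σ : R →ₐ[ℝ] R)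

theorem mapMatrix_rep (x : g) : σ.mapMatrix (rep R ρ x) = rep R ρ x := by
  ext i j
  exact σ.commutes _

theorem mapMatrix_smul (c : R) (X : Matrix n n R) :
    σ.mapMatrix (c • X) = σ c • σ.mapMatrix X := by
  ext i j
  exact map_mul σ _ _

theorem mapMatrix_mem_fil {k : ℤ} {X : Matrix n n R} (hX : X ∈ fil R (rep R ρ) h₀ k) :
    σ.mapMatrix X ∈ fil R (rep R ρ) h₀ k := by
  induction hX using Submodule.span_induction with
  | mem X h =>
    obtain ⟨j, hj, v, hv, rfl⟩ := h
    rw [mapMatrix_rep]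
    exact rep_mem_fil hj hv
  | zero => rw [map_zero]; exact zero_mem _
  | add X Y _ _ hX hY => rw [map_add]; exact add_mem hX hY
  | smul c X _ hX => rw [mapMatrix_smul]; exact Submodule.smul_mem _ _ hX

theorem mapMatrix_coef (φ : g →ₗ[ℝ] ℝ) (X : Matrix n n R) :
    σ (coef R ρ φ X) = coef R ρ φ (σ.mapMatrix X) := by
  simp [coef]

/-- The action of `σ` on invertible matrices. -/
def mapUnits : (Matrix n n R)ˣ →* (Matrix n n R)ˣ :=
  Units.map (σ.mapMatrix (m := n)).toRingHom.toMonoidHom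

theorem coe_mapUnits (u : (Matrix n n R)ˣ) :
    (mapUnits σ u : Matrix n n R) = σ.mapMatrix (u : Matrix n n R) := rfl

theorem coe_mapUnits_inv (u : (Matrix n n R)ˣ) :
    ((mapUnits σ u)⁻¹ : (Matrix n n R)ˣ).val = σ.mapMatrix (u⁻¹ : (Matrix n n R)ˣ).val := by
  rw [← map_inv, coe_mapUnits]

theorem mapUnits_mem_unip {u : (Matrix n n R)ˣ} (hu : u ∈ unip (rep R ρ) h₀) :
    mapUnits σ u ∈ unip (rep R ρ) h₀ := by
  intro k v hv
  have h := hu k v hv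
  rw [coe_mapUnits_inv, coe_mapUnits, ← mapMatrix_rep σ v, ← map_mul, ← map_mul, ← map_sub,
    ← map_mul, ← map_mul, ← map_sub]
  exact ⟨mapMatrix_mem_fil σ h.1, mapMatrix_mem_fil σ h.2⟩

variable {k : Type*} [CommRing k] [Algebra k R] {P : PoissonBracket k R}
  {J : Type*} [Fintype J] {e e' : J → g} {deg : J → ℤ} {m d p : (Matrix n n R)ˣ}

/-- If `mdp` is fixed by the involution `σ`, then so is the adjoint action of `m` and of `p⁻¹` on
the grading element. -/
theorem IsGauss.mapMatrix_conj (G : IsGauss P ρ h₀ e e' deg m d p) (hσ : ∀ x, σ (σ x) = x)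
    (hu : mapUnits σ (m * d * p) = m * d * p) :
    σ.mapMatrix (m.val * rep R ρ h₀ * (m⁻¹ : (Matrix n n R)ˣ).val) =
        m.val * rep R ρ h₀ * (m⁻¹ : (Matrix n n R)ˣ).val ∧
      σ.mapMatrix ((p⁻¹ : (Matrix n n R)ˣ).val * rep R ρ h₀ * p.val) =
        (p⁻¹ : (Matrix n n R)ˣ).val * rep R ρ h₀ * p.val := by
  set r := rep R ρ h₀ with hr
  set m' := mapUnits σ m with hm'
  set d' := mapUnits σ d with hd'
  set p' := mapUnits σ p with hp'
  have h₀0 : h₀ ∈ gr h₀ 0 := IsTriangular.h₀_mem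
  have h₀1 : h₀ ∈ gr (-h₀) 0 := by rw [mem_gr_neg, neg_zero]; exact h₀0
  -- From `σ(m)σ(d)σ(p) = mdp` follows `w = σ(d) v d⁻¹` with `w = σ(m)⁻¹m` lower and `v = σ(p)p⁻¹`
  -- upper unipotent. Unipotency is known for the adjoint action only, so the equation is tested on
  -- `h₀`.
  have hw : m'⁻¹ * m ∈ unip (rep R ρ) (-h₀) := mul_mem (inv_mem (mapUnits_mem_unip σ G.m_unip))
    G.m_unip
  have hv : p' * p⁻¹ ∈ unip (rep R ρ) h₀ := mul_mem (mapUnits_mem_unip σ G.p_unip)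
    (inv_mem G.p_unip)
  have hwv : m'⁻¹ * m = d' * (p' * p⁻¹) * d⁻¹ := by
    rw [map_mul, map_mul] at hu
    have h1 : m' * d' * p' = m * d * p := hu
    have h2 : m = m' * d' * p' * p⁻¹ * d⁻¹ := by rw [h1]; group
    rw [h2]; group
  have hdr : Commute d.val r := G.d_comm _ h₀0
  have hdr' : Commute d'.val r := by
    have h := congrArg σ.mapMatrix hdr.eq
    rwa [map_mul, map_mul, mapMatrix_rep] at h
  have hdri : Commute (d⁻¹ : (Matrix n n R)ˣ).val r := hdr.units_inv_left
  set w := m'⁻¹ * m with hwdef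
  set v := p' * p⁻¹ with hvdef
  have h1 := (hw 0 h₀ h₀1).1
  have h2 := (hv 0 h₀ h₀0).1
  rw [zero_add] at h1 h2
  have hd3 : ∀ X ∈ fil R (rep R ρ) h₀ 1, d'.val * X * (d'⁻¹ : (Matrix n n R)ˣ).val ∈
      fil R (rep R ρ) h₀ 1 := by
    intro X hX
    have h := mapMatrix_mem_fil σ (G.d_conj _ (mapMatrix_mem_fil σ hX))
    have hX' : σ.mapMatrix (σ.mapMatrix X) = X := by ext i j; exact hσ _
    rwa [map_mul, map_mul, hX', ← coe_mapUnits, ← coe_mapUnits_inv] at h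
  have h3 := hd3 _ h2
  -- The left side has only negative degrees and the right side only positive ones, so both vanish
  -- and `w` and `v` commute with `h₀`. The differences between `m` and `σ(m)`, and between `p` and
  -- `σ(p)`, are then invisible in the conjugates of `h₀`.
  have h4 : w.val * r * (w⁻¹ : (Matrix n n R)ˣ).val - r =
      d'.val * (v.val * r * (v⁻¹ : (Matrix n n R)ˣ).val - r) * (d'⁻¹ : (Matrix n n R)ˣ).val := by
    rw [hwv, mul_inv_rev, mul_inv_rev, inv_inv]
    simp only [Units.val_mul, mul_sub, sub_mul]
    congr 1
    · simp only [mul_assoc]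
      rw [← mul_assoc (d⁻¹ : (Matrix n n R)ˣ).val r, hdri.eq, mul_assoc r,
        Units.inv_mul_cancel_left]
    · rw [hdr'.eq, Units.mul_inv_cancel_right]
  rw [← hr] at h1 h2
  rw [← h4] at h3
  have h5 := (G.dual.eq_zero_of_add_eq_zero G.faithful h1 (zero_mem _) (neg_mem h3) (by abel)).1
  have hwr : w.val * r = r * w.val := by
    rw [sub_eq_zero] at h5
    exact (Units.mul_inv_eq_iff_eq_mul _).1 h5
  have hvr : v.val * r = r * v.val := by
    have hv' : v = d'⁻¹ * w * d := by rw [hwv]; group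
    have hdri' : Commute (d'⁻¹ : (Matrix n n R)ˣ).val r := hdr'.units_inv_left
    rw [hv']
    exact ((hdri'.mul_left hwr).mul_left hdr).eq
  have hm : m = m' * w := by rw [hwdef]; group
  have hp : p' = v * p := by rw [hvdef]; group
  clear_value w v
  constructor
  · rw [map_mul, map_mul, mapMatrix_rep, ← coe_mapUnits, ← coe_mapUnits_inv, ← hm', ← hr]
    conv_rhs => rw [hm, mul_inv_rev, Units.val_mul, Units.val_mul, mul_assoc m'.val w.val r, hwr]
    simp only [mul_assoc, Units.mul_inv_cancel_left]
  · rw [map_mul, map_mul, mapMatrix_rep, ← coe_mapUnits_inv, ← coe_mapUnits, ← map_inv, map_inv,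
      ← hp', ← hr, hp, mul_inv_rev, Units.val_mul, Units.val_mul, mul_assoc, mul_assoc,
      ← mul_assoc r, ← hvr]
    simp only [mul_assoc, Units.inv_mul_cancel_left]

end Involution

/-! ### Exponents fixed by an involution. -/

section FixedExponents

open LieAlgebra.IsKilling

variable {g : Type*} [LieRing g] [LieAlgebra ℝ g] [Module.Finite ℝ g] [IsKilling ℝ g]
  {H : LieSubalgebra ℝ g} [H.IsCartanSubalgebra] [LieModule.IsTriangularizable ℝ H g]
  {b : (rootSystem H).Base} [DecidableEq b.support] {n : Type*} [Fintype n] [DecidableEq n]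
  {R : Type*} [CommRing R] [Algebra ℝ R] [Algebra ℂ R] [IsScalarTower ℝ ℂ R]
  {P : PoissonBracket ℂ R} {ρ : g →ₗ[ℝ] Matrix n n ℝ} {E : H.root → g} {N : ℕ}
  {β : Fin N ≃ PosRoot b} {ap am : Fin N → R} {q : b.support → R}
  {xp xm : Fin N → (Matrix n n R)ˣ} {xd : b.support → (Matrix n n R)ˣ} {m d p : (Matrix n n R)ˣ}

/-- The fixed elements of `σ` form a real subalgebra that contains the coefficients of `m h₀ m⁻¹`
and `p⁻¹ h₀ p`, hence also the exponents recovered from them. -/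
theorem IsFactorisation.map_exponent (F : IsFactorisation P ρ E β am q ap xm xd xp m d p)
    (σ : R →ₐ[ℝ] R) (hσ : ∀ x, σ (σ x) = x) (hu : mapUnits σ (m * d * p) = m * d * p)
    (k : Fin N) : σ (am k) = am k ∧ σ (ap k) = ap k := by
  obtain ⟨h1, h2⟩ := F.isGauss.mapMatrix_conj σ hσ hu
  constructor
  · refine (AlgHom.mem_equalizer σ (AlgHom.id ℝ R) _).1
      (F.minus.mem_of_coef_mem (AlgHom.equalizer σ (AlgHom.id ℝ R)) (fun φ => ?_) k)
    rw [AlgHom.mem_equalizer, mapMatrix_coef, map_neg (rep R ρ), mul_neg, neg_mul, map_neg, h1]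
    rfl
  · refine (AlgHom.mem_equalizer σ (AlgHom.id ℝ R) _).1
      (F.plus.mem_of_coef_inv_mem (AlgHom.equalizer σ (AlgHom.id ℝ R)) (fun φ => ?_) k)
    rw [AlgHom.mem_equalizer, mapMatrix_coef, h2]
    rfl

end FixedExponents

/-! ### Principal logarithms -/

section PrincipalLog

open NormedSpace (exp)

variable {n : Type*} [Fintype n] [DecidableEq n]

open scoped Matrix.Norms.Operator in
theorem exp_mul_pow_of_pow_eq_zero {N : Matrix n n ℂ} {j : ℕ} (h : N ^ (j + 2) = 0) :
    exp N * N ^ j = N ^ j + N ^ (j + 1) := by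
  have h1 := (NormedSpace.exp_series_hasSum_exp' (𝕂 := ℂ) N).mul_right (N ^ j)
  refine h1.unique ?_
  have h2 := hasSum_sum_of_ne_finset_zero (L := SummationFilter.unconditional ℕ) (f := fun k : ℕ => ((k.factorial : ℂ)⁻¹ • N ^ k) * N ^ j)
    (s := Finset.range 2) (fun k hk => by
      rw [Finset.mem_range, not_lt] at hk
      obtain ⟨l, rfl⟩ := Nat.exists_eq_add_of_le hk
      rw [smul_mul_assoc, ← pow_add, show 2 + l + j = j + 2 + l by ring, pow_add, h, zero_mul,
        smul_zero])
  have h3 : N ^ j + N ^ (j + 1) =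
      ∑ k ∈ Finset.range 2, ((k.factorial : ℂ)⁻¹ • N ^ k) * N ^ j := by
    simp [Finset.sum_range_succ, pow_succ']
  rw [h3]
  exact h2

/-- On the last non-zero powers the exponential is `1 + N`. If it is the identity, the highest power
vanishes, and the exponent descends to 1. -/
theorem eq_zero_of_exp_eq_one {N : Matrix n n ℂ} (hN : IsNilpotent N) (h : exp N = 1) : N = 0 := by
  obtain ⟨k, hk⟩ := hN
  have key : ∀ j : ℕ, N ^ (j + 1) = 0 → N = 0 := by
    intro j
    induction j with
    | zero => intro h; simpa using h
    | succ j ih =>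
      intro hj
      have := exp_mul_pow_of_pow_eq_zero hj
      rw [h, one_mul] at this
      exact ih (by simpa using this.symm)
  exact key k (by rw [pow_succ, hk, zero_mul])

/-- Over ℂ the characteristic polynomial is a power of the variable, and Cayley-Hamilton applies. -/
theorem isNilpotent_of_spectrum {N : Matrix n n ℂ} (h : ∀ z ∈ spectrum ℂ N, z = 0) :
    IsNilpotent N := by
  have h1 := (IsAlgClosed.splits N.charpoly).eq_prod_roots_of_monic N.charpoly_monic
  have h2 : N.charpoly.roots = Multiset.replicate (Multiset.card N.charpoly.roots) 0 :=
    Multiset.eq_replicate_card.2 fun z hz =>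
      h z (Matrix.mem_spectrum_iff_isRoot_charpoly.2 (Polynomial.isRoot_of_mem_roots hz))
  rw [h2] at h1
  refine ⟨Multiset.card N.charpoly.roots, ?_⟩
  have h3 := Matrix.aeval_self_charpoly N
  rw [h1] at h3
  simpa using h3

theorem exp_mulVec {N : Matrix n n ℂ} {z : ℂ} {v : n → ℂ} (h : N.mulVec v = z • v) :
    (exp N).mulVec v = Complex.exp z • v := by
  -- The eigenvector equation is written as an intertwining relation for `v vᵀ`, which the
  -- exponential preserves. A column with `v i ≠ 0` is read off at the end.
  have h1 : Matrix.vecMulVec v v * (z • (1 : Matrix n n ℂ)) = N * Matrix.vecMulVec v v := by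
    rw [Matrix.mul_vecMulVec, h, Matrix.smul_vecMulVec, mul_smul_comm, mul_one]
  by_cases hv : v = 0
  · simp [hv]
  obtain ⟨i, hi⟩ : ∃ i, v i ≠ 0 := by
    by_contra! hc
    exact hv (funext hc)
  have h2 := semiconjBy_exp h1
  rw [exp_smul_one, mul_smul_comm, mul_one, Matrix.mul_vecMulVec, ← Matrix.smul_vecMulVec] at h2
  funext j
  have h3 := congrFun (congrFun h2 j) i
  simp only [Matrix.vecMulVec_apply] at h3
  exact (mul_right_cancel₀ hi h3).symm

theorem mem_spectrum_of_mulVec {N : Matrix n n ℂ} {z : ℂ} {v : n → ℂ} (hv : v ≠ 0)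
    (h : N.mulVec v = z • v) : z ∈ spectrum ℂ N := by
  rw [← Matrix.spectrum_toLin', ← Module.End.hasEigenvalue_iff_mem_spectrum]
  exact Module.End.hasEigenvalue_of_hasEigenvector
    ⟨Module.End.mem_eigenspace_iff.2 (by rwa [Matrix.toLin'_apply]), hv⟩

theorem exists_joint_eigenvector {N Z : Matrix n n ℂ} (hc : Commute N Z) {z : ℂ}
    (hz : z ∈ spectrum ℂ N) :
    ∃ (v : n → ℂ) (w : ℂ), v ≠ 0 ∧ N.mulVec v = z • v ∧ Z.mulVec v = w • v := by
  rw [← Matrix.spectrum_toLin', ← Module.End.hasEigenvalue_iff_mem_spectrum] at hz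
  have hmaps : ∀ x ∈ Module.End.eigenspace (Matrix.toLin' N) z,
      Matrix.toLin' Z x ∈ Module.End.eigenspace (Matrix.toLin' N) z := by
    intro x hx
    rw [Module.End.mem_eigenspace_iff, Matrix.toLin'_apply] at *
    rw [Matrix.toLin'_apply, Matrix.mulVec_mulVec, hc.eq, ← Matrix.mulVec_mulVec, hx,
      Matrix.mulVec_smul]
  have : Nontrivial (Module.End.eigenspace (Matrix.toLin' N) z) :=
    Submodule.nontrivial_iff_ne_bot.2 hz
  obtain ⟨w, hw⟩ := Module.End.exists_eigenvalue ((Matrix.toLin' Z).restrict hmaps)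
  obtain ⟨v, hv, hv0⟩ := hw.exists_hasEigenvector
  refine ⟨v, w, fun h => hv0 (Subtype.ext h), ?_, ?_⟩
  · simpa using Module.End.mem_eigenspace_iff.1 v.2
  · simpa using congrArg Subtype.val (Module.End.mem_eigenspace_iff.1 hv)

/-- Commuting principal logarithms of the same matrix are equal. -/
theorem IsPrincipalLog.eq_of_exp_eq {Z Z' : Matrix n n ℂ} (hZ : IsPrincipalLog Z)
    (hZ' : IsPrincipalLog Z') (hc : Commute Z Z') (h : exp Z = exp Z') : Z = Z' := by
  have hexp : exp (Z - Z') = 1 := by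
    rw [sub_eq_add_neg, Matrix.exp_add_of_commute _ _ hc.neg_right, h,
      ← Matrix.exp_add_of_commute _ _ (Commute.refl Z').neg_right, add_neg_cancel,
      NormedSpace.exp_zero]
  refine sub_eq_zero.1 (eq_zero_of_exp_eq_one (isNilpotent_of_spectrum fun z hz => ?_) hexp)
  obtain ⟨v, w, hv, h1, h2⟩ :=
    exists_joint_eigenvector (Z := Z) ((Commute.refl Z).sub_left hc.symm) hz
  have h3 : Z'.mulVec v = (w - z) • v := by
    rw [Matrix.sub_mulVec, h2] at h1
    rw [sub_smul, ← h1]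
    abel
  have h4 := hZ _ (mem_spectrum_of_mulVec hv h2)
  have h5 := hZ' _ (mem_spectrum_of_mulVec hv h3)
  have h6 := exp_mulVec h1
  rw [hexp, Matrix.one_mulVec] at h6
  -- An eigenvalue of `Z - Z'` is a multiple of `2πi` and also a difference of eigenvalues of `Z`
  -- and `Z'`, whose imaginary parts differ by less than `2π`. Hence it is zero.
  have h7 : Complex.exp z = 1 := by
    obtain ⟨i, hi⟩ : ∃ i, v i ≠ 0 := by
      by_contra! hc
      exact hv (funext hc)
    have := congrFun h6 i
    rw [Pi.smul_apply, smul_eq_mul] at this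
    exact mul_right_cancel₀ hi (by rw [one_mul]; exact this.symm)
  obtain ⟨k, hk⟩ := Complex.exp_eq_one_iff.1 h7
  have h8 : z.im = k * (2 * Real.pi) := by rw [hk]; simp
  rw [Complex.sub_im, h8] at h5
  have h9 : |(k : ℝ)| < 1 := by
    rw [abs_lt] at *
    have := Real.pi_pos
    constructor <;> nlinarith
  have h10 : k = 0 := by
    have : |k| < 1 := by exact_mod_cast h9
    exact Int.abs_lt_one_iff.1 this
  rw [hk, h10]; simp

/-! ### Complex conjugation -/

theorem conj_exp (Z : Matrix n n ℂ) :
    (starRingEnd ℂ).mapMatrix (exp Z) = exp ((starRingEnd ℂ).mapMatrix Z) := by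
  have h : ∀ X : Matrix n n ℂ, (starRingEnd ℂ).mapMatrix X = X.conjTranspose.transpose :=
    fun X => by ext i j; rfl
  rw [h, h, Matrix.exp_transpose, Matrix.exp_conjTranspose]

theorem IsPrincipalLog.conj {Z : Matrix n n ℂ} (hZ : IsPrincipalLog Z) :
    IsPrincipalLog ((starRingEnd ℂ).mapMatrix Z) := by
  intro z hz
  have h : (starRingEnd ℂ) z ∈ spectrum ℂ Z := by
    rw [spectrum.mem_iff] at hz ⊢
    intro h
    refine hz ?_
    have := h.map (starRingEnd ℂ).mapMatrix
    rwa [map_sub, show (starRingEnd ℂ).mapMatrix (algebraMap ℂ (Matrix n n ℂ) ((starRingEnd ℂ) z)) =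
      algebraMap ℂ (Matrix n n ℂ) z by
        ext i j
        simp [Matrix.algebraMap_matrix_apply, apply_ite (starRingEnd ℂ)]] at this
  simpa using hZ _ h

variable {g : Type*} [LieRing g] [LieAlgebra ℝ g] {ρ : g →ₗ[ℝ] Matrix n n ℝ}

theorem conj_smul_rhoC (c : ℂ) (X : g) :
    (starRingEnd ℂ).mapMatrix (c • rhoC ρ X) = (starRingEnd ℂ) c • rhoC ρ X := by
  ext i j
  simp [rhoC]

theorem conj_list_prod_exp {N : ℕ} {c : Fin N → ℂ} (hc : ∀ k, (starRingEnd ℂ) (c k) = c k)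
    (X : Fin N → g) :
    (starRingEnd ℂ).mapMatrix (List.ofFn fun k => exp (c k • rhoC ρ (X k))).prod =
      (List.ofFn fun k => exp (c k • rhoC ρ (X k))).prod := by
  rw [map_list_prod, List.map_ofFn]
  congr 2
  funext k
  rw [Function.comp_apply, conj_exp, conj_smul_rhoC, hc]

theorem isUnit_list_prod_exp {N : ℕ} (X : Fin N → Matrix n n ℂ) :
    IsUnit (List.ofFn fun k => exp (X k)).prod := by
  refine List.prod_isUnit ?_
  simp only [List.mem_ofFn, forall_exists_index, forall_apply_eq_imp_iff]
  exact fun k => Matrix.isUnit_exp _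

/-- The coefficients of a principal logarithm of a real matrix in independent commuting
elements are real. -/
theorem IsPrincipalLog.im_eq_zero (hρ : IsFaithfulRep ρ) {K : Type*} [Fintype K] {Z : K → g}
    (hZ : ∀ i j, ⁅Z i, Z j⁆ = 0) (hli : LinearIndependent ℝ Z) {c : K → ℂ}
    (hlog : IsPrincipalLog (∑ i, c i • rhoC ρ (Z i)))
    (hreal : (starRingEnd ℂ).mapMatrix (exp (∑ i, c i • rhoC ρ (Z i))) =
      exp (∑ i, c i • rhoC ρ (Z i))) (i : K) : (c i).im = 0 := by
  have hconj : (starRingEnd ℂ).mapMatrix (∑ i, c i • rhoC ρ (Z i)) =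
      ∑ i, (starRingEnd ℂ) (c i) • rhoC ρ (Z i) := by
    simp only [map_sum, conj_smul_rhoC]
  -- The matrix and its complex conjugate are commuting principal logarithms of the same real
  -- matrix, so they coincide. The imaginary parts of the coefficients then give a real linear
  -- relation among the `Z i`.
  have h1 := hlog.eq_of_exp_eq hlog.conj (by
    rw [hconj]
    exact Commute.sum_left _ _ _ fun i _ => Commute.sum_right _ _ _ fun j _ =>
      ((commute_rhoC hρ (hZ i j)).smul_left _).smul_right _) (by rw [← conj_exp, hreal])
  rw [hconj] at h1
  refine Fintype.linearIndependent_iff.1 hli (fun i => (c i).im) (hρ.injective ?_) i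
  rw [map_zero]
  ext a a'
  have h2 := congrArg Complex.im (congrFun (congrFun h1 a) a')
  simp only [Matrix.sum_apply, Matrix.smul_apply, smul_eq_mul, Complex.im_sum, rhoC,
    Matrix.map_apply, Complex.im_mul_ofReal, Complex.conj_im, neg_mul, Finset.sum_neg_distrib] at h2
  simp only [map_sum, map_smul, Matrix.sum_apply, Matrix.smul_apply, smul_eq_mul,
    Matrix.zero_apply]
  linarith

end PrincipalLog

/-! ### Complex conjugation of smooth functions. -/

section Conjugation

variable {EM : Type*} [NormedAddCommGroup EM] [NormedSpace ℝ EM] {HM : Type*} [TopologicalSpace HM]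
  {I : ModelWithCorners ℝ EM HM} {M : Type*} [TopologicalSpace M] [ChartedSpace HM M]

/-- Complex conjugation of smooth functions. -/
def conjHom : SmoothC I M →ₐ[ℝ] SmoothC I M where
  toFun f := ⟨fun m => (starRingEnd ℂ) (f m), (Complex.conjCLE : ℂ →L[ℝ] ℂ).contMDiff.comp f.contMDiff⟩
  map_one' := by ext m; exact map_one (starRingEnd ℂ)
  map_mul' f f' := by ext m; exact map_mul (starRingEnd ℂ) _ _
  map_zero' := by ext m; exact map_zero (starRingEnd ℂ)
  map_add' f f' := by ext m; exact map_add (starRingEnd ℂ) _ _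
  commutes' r := by ext m; exact Complex.conj_ofReal r

theorem conjHom_conjHom (f : SmoothC I M) : conjHom (conjHom f) = f := by
  ext m
  exact Complex.conj_conj (f m)

theorem conjHom_ofRealFun (f : SmoothR I M) : conjHom (ofRealFun f) = ofRealFun f := by
  ext m
  exact Complex.conj_ofReal (f m)

end Conjugation

theorem conj_eq_of_sq {a : ℂ} {x : ℝ} (hx : 0 ≤ x) (h : a ^ 2 = x) : (starRingEnd ℂ) a = a := by
  rw [Complex.conj_eq_iff_im]
  have h1 := congrArg Complex.re h
  have h2 := congrArg Complex.im h
  rw [sq, Complex.mul_re, Complex.ofReal_re] at h1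
  rw [sq, Complex.mul_im, Complex.ofReal_im] at h2
  by_contra hne
  have h3 : a.re = 0 := by
    have : a.re * a.im = 0 := by linarith
    exact (mul_eq_zero.1 this).resolve_right hne
  rw [h3] at h1
  have := mul_self_pos.2 hne
  linarith

/-! ### Signs in the normalisation of the simple charges. -/

section Normalisation

open LieAlgebra.IsKilling

variable {g : Type*} [LieRing g] [LieAlgebra ℝ g] [Module.Finite ℝ g] [IsKilling ℝ g]
  {H : LieSubalgebra ℝ g} [H.IsCartanSubalgebra] [LieModule.IsTriangularizable ℝ H g]

/-- On the split Cartan subalgebra the Killing form is a sum of squares of real root values. -/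
theorem symm_d_nonneg (α : H.root) : 0 ≤ symm_d α := by
  have h := congrArg (fun B => B (dualVec α) (dualVec α))
    (LieAlgebra.IsKilling.restrict_killingForm_eq_sum (K := ℝ) (L := g) (H := H))
  simp only [LinearMap.sum_apply] at h
  refine div_nonneg ?_ two_pos.le
  refine le_of_le_of_eq ?_ h.symm
  exact Finset.sum_nonneg fun β _ => mul_self_nonneg (LieModule.Weight.toLinear ℝ H g β (dualVec α))

theorem sin_mul_div_nonneg {γ x : ℝ} (hx : 0 ≤ x) (h : |γ * x| ≤ Real.pi) :
    0 ≤ 4 * Real.sin (γ * x) / γ := by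
  obtain ⟨h1, h2⟩ := abs_le.1 h
  rcases le_total 0 γ with hγ | hγ
  · exact div_nonneg (mul_nonneg (by norm_num)
      (Real.sin_nonneg_of_nonneg_of_le_pi (mul_nonneg hγ hx) h2)) hγ
  · exact div_nonneg_of_nonpos (mul_nonpos_of_nonneg_of_nonpos (by norm_num)
      (Real.sin_nonpos_of_nonpos_of_neg_pi_le (mul_nonpos_of_nonpos_of_nonneg hγ hx) h1)) hγ

theorem linearIndependent_weightElt (b : (rootSystem H).Base) :
    LinearIndependent ℝ fun i : b.support => (weightElt b i : g) := by
  classical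
  rw [Fintype.linearIndependent_iff]
  intro c hc i
  have h := congrArg (killingForm ℝ g (simpleCoroot b i : g)) hc
  simp only [map_sum, map_smul, killing_coroot_weightElt, smul_eq_mul, map_zero] at h
  simpa using h

end Normalisation

/-! ### The factorisation of a Sklyanin matrix -/

section SklyaninFactors

open LieAlgebra.IsKilling

variable {EM : Type*} [NormedAddCommGroup EM] [NormedSpace ℝ EM] {HM : Type*} [TopologicalSpace HM]
  {I : ModelWithCorners ℝ EM HM} {M : Type*} [TopologicalSpace M] [ChartedSpace HM M]
  {g : Type*} [LieRing g] [LieAlgebra ℝ g] [Module.Finite ℝ g] [IsKilling ℝ g]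
  {H : LieSubalgebra ℝ g} [H.IsCartanSubalgebra] [LieModule.IsTriangularizable ℝ H g]
  {b : (rootSystem H).Base} {E : H.root → g}
  {n : Type*} [Fintype n] [DecidableEq n] {ρ : g →ₗ[ℝ] Matrix n n ℝ}
  {γ : ℝ} {U : Matrix n n (SmoothR I M)} {N : ℕ} {β : Fin N ≃ PosRoot b} {A : H.root → ℂ}
  {QH : b.support → SmoothC I M} {QE : H.root → SmoothC I M} {D Mp Mm : Matrix n n (SmoothC I M)}

/-- The coefficient `s i γ A_α` of a charge in the exponents. -/
def chargeCoeff (γ s : ℝ) (A : H.root → ℂ) (α : H.root) : ℂ :=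
  (s : ℂ) * Complex.I * (γ : ℂ) * A α

theorem chargeCoeff_ne_zero {s : ℝ} (hγ : γ ≠ 0) (hs : s ≠ 0) (hA : ∀ α, A α ≠ 0) (α : H.root) :
    chargeCoeff γ s A α ≠ 0 :=
  mul_ne_zero (mul_ne_zero (mul_ne_zero (Complex.ofReal_ne_zero.2 hs) Complex.I_ne_zero)
    (Complex.ofReal_ne_zero.2 hγ)) (hA α)

theorem conj_eq_neg_of_conjHom_eq {s : ℝ} (hγ : γ ≠ 0) (hs : s ≠ 0) (hA : ∀ α, A α ≠ 0)
    {α : H.root} (hreal : (starRingEnd ℂ) (A α) = A α) {f : SmoothC I M}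
    (h : conjHom (chargeCoeff γ s A α • f) = chargeCoeff γ s A α • f) (m : M) :
    (starRingEnd ℂ) (f m) = -f m := by
  have h1 : (starRingEnd ℂ) (chargeCoeff γ s A α * f m) = chargeCoeff γ s A α * f m :=
    congrArg (fun k : SmoothC I M => k m) h
  refine mul_left_cancel₀ (chargeCoeff_ne_zero hγ hs hA α) ?_
  simp only [chargeCoeff, map_mul, Complex.conj_I, Complex.conj_ofReal, hreal] at h1 ⊢
  linear_combination -h1

theorem exists_isFactorisation [DecidableEq b.support] (P : PoissonBracket ℂ (SmoothC I M))
    (hE : IsCartanWeyl E) (hρ : IsFaithfulRep ρ)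
    (hD : ∀ m : M, D.map (fun f => f m) =
      NormedSpace.exp (cartanExponent b ρ γ (fun i => QH i m)))
    (hMp : ∀ m : M, Mp.map (fun f => f m) =
      orderedProduct ρ γ 1 (fun k => A (β k).1) (fun k => QE (β k).1 m) (fun k => E (β k).1))
    (hMm : ∀ m : M, Mm.map (fun f => f m) =
      orderedProduct ρ γ (-1) (fun k => A (negRoot (β k).1)) (fun k => QE (negRoot (β k).1) m)
        (fun k => E (negRoot (β k).1))) :
    ∃ (xm : Fin N → (Matrix n n (SmoothC I M))ˣ) (xd : b.support → (Matrix n n (SmoothC I M))ˣ)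
      (xp : Fin N → (Matrix n n (SmoothC I M))ˣ) (m d p : (Matrix n n (SmoothC I M))ˣ),
      Mm = m.val ∧ D = d.val ∧ Mp = p.val ∧
      IsFactorisation P ρ E β
        (fun k => chargeCoeff γ (-1) A (negRoot (β k).1) • QE (negRoot (β k).1))
        (fun i => (Complex.I * (γ : ℂ)) • QH i)
        (fun k => chargeCoeff γ 1 A (β k).1 • QE (β k).1) xm xd xp m d p := by
  obtain ⟨xp, p, hp, Fp⟩ := exists_isTriangularProduct P hρ (hE.isTriangular β)
    (fun k => chargeCoeff γ 1 A (β k).1) (fun k => QE (β k).1) hMp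
  obtain ⟨xm, m, hm, Fm⟩ := exists_isTriangularProduct P hρ (hE.isTriangular_neg β)
    (fun k => chargeCoeff γ (-1) A (negRoot (β k).1)) (fun k => QE (negRoot (β k).1)) hMm
  obtain ⟨xd, d, hd, Fd⟩ := exists_isTorusProduct P hρ
    (fun i => coe_mem_gr b (weightElt b i)) hE.lie_eq_zero_of_mem_gr_zero
    (y := fun i => (simpleCoroot b i : g)) (killing_coroot_weightElt b) (Complex.I * (γ : ℂ)) QH hD
  exact ⟨xm, xd, xp, m, d, p, hm, hd, hp, hE, Fp, Fm, Fd⟩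

theorem map_ofRealFun_eq
    (hU : ∀ m : M, (U.map (fun f => f m)).map ((↑) : ℝ → ℂ) =
      Mm.map (fun f => f m) * D.map (fun f => f m) * Mp.map (fun f => f m)) :
    U.map ofRealFun = Mm * D * Mp := by
  refine matrix_ext_evalAt fun m => ?_
  rw [Matrix.map_mul, Matrix.map_mul]
  exact hU m

theorem mapUnits_conjHom_eq {u : (Matrix n n (SmoothC I M))ˣ} (hU : U.map ofRealFun = u.val) :
    mapUnits conjHom u = u := by
  refine Units.ext ?_
  rw [coe_mapUnits, ← hU]
  ext1 i j
  exact conjHom_ofRealFun _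

/-- The charges with real normalisation are imaginary. -/
theorem IsFactorisation.conj_charge [DecidableEq b.support] {P : PoissonBracket ℂ (SmoothC I M)}
    {xp xm : Fin N → (Matrix n n (SmoothC I M))ˣ} {xd : b.support → (Matrix n n (SmoothC I M))ˣ}
    {m d p : (Matrix n n (SmoothC I M))ˣ}
    (F : IsFactorisation P ρ E β
        (fun k => chargeCoeff γ (-1) A (negRoot (β k).1) • QE (negRoot (β k).1))
        (fun i => (Complex.I * (γ : ℂ)) • QH i)
        (fun k => chargeCoeff γ 1 A (β k).1 • QE (β k).1) xm xd xp m d p)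
    (hγ : γ ≠ 0) (hA : ∀ α, A α ≠ 0) (hU : U.map ofRealFun = (m * d * p).val)
    {α : H.root} (hα : (starRingEnd ℂ) (A α) = A α) (x : M) :
    (starRingEnd ℂ) (QE α x) = -QE α x := by
  have hu := mapUnits_conjHom_eq hU
  rcases isPos_or_neg (b := b) α with h | h
  · have h1 := (F.map_exponent conjHom conjHom_conjHom hu (β.symm ⟨α, h⟩)).2
    rw [Equiv.apply_symm_apply] at h1
    exact conj_eq_neg_of_conjHom_eq hγ one_ne_zero hA hα h1 x
  · have h1 := (F.map_exponent conjHom conjHom_conjHom hu (β.symm ⟨negRoot α, h⟩)).1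
    rw [Equiv.apply_symm_apply, negRoot_negRoot] at h1
    exact conj_eq_neg_of_conjHom_eq hγ (neg_ne_zero.2 one_ne_zero) hA hα h1 x

/-- In a factorisation of a real matrix with real triangular factors the diagonal factor is
real. -/
theorem conj_eq_of_mul_eq {u : Matrix n n ℝ} {m d p : Matrix n n ℂ} (hm : IsUnit m)
    (hp : IsUnit p) (hm' : (starRingEnd ℂ).mapMatrix m = m)
    (hp' : (starRingEnd ℂ).mapMatrix p = p) (h : u.map ((↑) : ℝ → ℂ) = m * d * p) :
    (starRingEnd ℂ).mapMatrix d = d := by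
  have hu : (starRingEnd ℂ).mapMatrix (u.map ((↑) : ℝ → ℂ)) = u.map ((↑) : ℝ → ℂ) := by
    ext i j
    exact Complex.conj_ofReal _
  rw [h, map_mul, map_mul, hm', hp'] at hu
  exact hm.mul_left_cancel (hp.mul_right_cancel hu)

/-- The Cartan charges are imaginary if the exponent of `D` is a principal logarithm. -/
theorem conj_cartan_charge [DecidableEq b.support] (hE : IsCartanWeyl E) (hρ : IsFaithfulRep ρ)
    (hγ : γ ≠ 0) {c : b.support → ℂ} {a a' : Fin N → ℂ} {X X' : Fin N → g} {u : Matrix n n ℝ}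
    {m p : Matrix n n ℂ}
    (ha : ∀ k, (starRingEnd ℂ) (a k) = a k) (ha' : ∀ k, (starRingEnd ℂ) (a' k) = a' k)
    (hm : m = (List.ofFn fun k => NormedSpace.exp (a k • rhoC ρ (X k))).prod)
    (hp : p = (List.ofFn fun k => NormedSpace.exp (a' k • rhoC ρ (X' k))).prod)
    (h : u.map ((↑) : ℝ → ℂ) = m * NormedSpace.exp (cartanExponent b ρ γ c) * p)
    (hlog : IsPrincipalLog (cartanExponent b ρ γ c)) (i : b.support) :
    (starRingEnd ℂ) (c i) = -c i := by
  subst hm hp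
  -- The triangular factors are real because their exponents are, so the exponential of the Cartan
  -- exponent is real. Its coefficients `i γ c` are then real, and `c` is imaginary.
  have h1 := conj_eq_of_mul_eq (isUnit_list_prod_exp _) (isUnit_list_prod_exp _)
    (conj_list_prod_exp ha X) (conj_list_prod_exp ha' X') h
  have h2 := IsPrincipalLog.im_eq_zero hρ (fun i j => hE.lie_eq_zero_of_mem_gr_zero
    _ (coe_mem_gr b (weightElt b i)) _ (coe_mem_gr b (weightElt b j)))
    (linearIndependent_weightElt b) hlog h1 i
  have h3 : (c i).re = 0 := by
    rw [mul_assoc, Complex.I_mul_im, Complex.re_ofReal_mul] at h2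
    exact (mul_eq_zero.1 h2).resolve_left hγ
  apply Complex.ext <;> simp [h3]

end SklyaninFactors

end SklyaninCharges

end

/-! ### The main theorem. -/

open SklyaninCharges in
theorem mainTheorem7
    -- the Poisson manifold `M`
    {EM : Type*} [NormedAddCommGroup EM] [NormedSpace ℝ EM] {HM : Type*} [TopologicalSpace HM]
    (I : ModelWithCorners ℝ EM HM) (M : Type*) [TopologicalSpace M] [ChartedSpace HM M]
    [IsManifold I ∞ M] (P : PoissonBracket ℝ (SmoothR I M))
    -- the split semisimple Lie algebra `g`, with its root system, simple roots and root vectors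
    {g : Type*} [LieRing g] [LieAlgebra ℝ g] [Module.Finite ℝ g] [LieAlgebra.IsKilling ℝ g]
    (H : LieSubalgebra ℝ g) [H.IsCartanSubalgebra] [LieModule.IsTriangularizable ℝ H g]
    (b : (LieAlgebra.IsKilling.rootSystem H).Base) (E : H.root → g) (hE : IsCartanWeyl E)
    -- the linear Lie group `G`
    {n : Type*} [Fintype n] [DecidableEq n] (ρ : g →ₗ[ℝ] Matrix n n ℝ) (hρ : IsFaithfulRep ρ)
    (G : Subgroup (Matrix.GeneralLinearGroup n ℝ)) (hG : HasLieAlgebra ρ G)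
    -- the smooth map `U : M → G`, which satisfies the Sklyanin bracket
    (γ : ℝ) (hγ : γ ≠ 0) (U : Matrix n n (SmoothR I M))
    (hUG : ∀ m : M, ∃ x ∈ G, (x : Matrix n n ℝ) = U.map (fun f => f m))
    (hSklyanin : tensorBracket P U U =
      γ • ((rMatrix b ρ E).map (algebraMap ℝ (SmoothR I M)) * (inFirst U * inSecond U) -
        (inFirst U * inSecond U) * (rMatrix b ρ E).map (algebraMap ℝ (SmoothR I M))))
    -- the decomposition `U = M⁻ D M⁺` and the charges
    {N : ℕ} (β : Fin N ≃ PosRoot b) (hβ : IsNormalOrder b β)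
    (A : H.root → ℂ) (hA : ∀ α, A α ≠ 0)
    (QH : b.support → SmoothC I M) (QE : H.root → SmoothC I M)
    (D Mp Mm : Matrix n n (SmoothC I M))
    (hU : ∀ m : M, (U.map (fun f => f m)).map ((↑) : ℝ → ℂ) =
      Mm.map (fun f => f m) * D.map (fun f => f m) * Mp.map (fun f => f m))
    (hD : ∀ m : M, D.map (fun f => f m) =
      NormedSpace.exp (cartanExponent b ρ γ (fun i => QH i m)))
    (hMp : ∀ m : M, Mp.map (fun f => f m) =
      orderedProduct ρ γ 1 (fun k => A (β k).1) (fun k => QE (β k).1 m) (fun k => E (β k).1))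
    (hMm : ∀ m : M, Mm.map (fun f => f m) =
      orderedProduct ρ γ (-1) (fun k => A (negRoot (β k).1)) (fun k => QE (negRoot (β k).1) m)
        (fun k => E (negRoot (β k).1))) :
    let Pc := P.complexify
    let toC : ℝ → SmoothC I M := fun r => algebraMap ℂ (SmoothC I M) (r : ℂ)
    let R₁₂ := (rMatrix b ρ E).map toC
    let H₁₂ := (cartanTensor b ρ).map toC
    let e : b.support → SmoothC I M := fun i => QE (simpleRoot b i)
    let f : b.support → SmoothC I M := fun i => QE (negRoot (simpleRoot b i))
    let posCharges : Set (SmoothC I M) := {x | ∃ α : PosRoot b, x = QE α.1}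
    let negCharges : Set (SmoothC I M) := {x | ∃ α : PosRoot b, x = QE (negRoot α.1)}
    -- the brackets of `D`, `M⁺` and `M⁻`
    (tensorBracket Pc D D = 0 ∧
      tensorBracket Pc D Mp =
        (γ : ℂ) • (inFirst D * (H₁₂ * inSecond Mp - inSecond Mp * H₁₂)) ∧
      tensorBracket Pc D Mm =
        -(γ : ℂ) • (inFirst D * (H₁₂ * inSecond Mm - inSecond Mm * H₁₂)) ∧
      tensorBracket Pc Mp Mm = 0 ∧
      tensorBracket Pc Mp Mp =
        (γ : ℂ) • (R₁₂ * (inFirst Mp * inSecond Mp) - (inFirst Mp * inSecond Mp) * R₁₂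
          - inFirst Mp * H₁₂ * inSecond Mp + inSecond Mp * H₁₂ * inFirst Mp) ∧
      tensorBracket Pc Mm Mm =
        (γ : ℂ) • (R₁₂ * (inFirst Mm * inSecond Mm) - (inFirst Mm * inSecond Mm) * R₁₂
          + inFirst Mm * H₁₂ * inSecond Mm - inSecond Mm * H₁₂ * inFirst Mm)) ∧
    -- the nilpotent charges span `U_q(n_+)` and `U_q(n_-)`, which Poisson commute
    SpansUqNilpotent b Pc γ e (Pc.generated posCharges) ∧
    SpansUqNilpotent b Pc (-γ) f (Pc.generated negCharges) ∧
    (∀ x ∈ Pc.generated posCharges, ∀ y ∈ Pc.generated negCharges, Pc.br x y = 0) ∧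
    -- the brackets with the Cartan charges, and the Borel algebras
    (∀ i j, Pc.br (QH i) (QH j) = 0) ∧
    (∀ (i : b.support) (α : PosRoot b),
      Complex.I • Pc.br (QH i) (QE α.1) =
        ((rootVec α.1 (simpleCoroot b i) : ℝ) : ℂ) • QE α.1 ∧
      Complex.I • Pc.br (QH i) (QE (negRoot α.1)) =
        ((rootVec α.1 (simpleCoroot b i) : ℝ) : ℂ) • QE (negRoot α.1)) ∧
    SpansUqBorel b Pc γ 1 QH e (Pc.generated (Set.range QH ∪ posCharges)) ∧
    SpansUqBorel b Pc (-γ) (-1) (fun i => -QH i) f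
      (Pc.generated (Set.range QH ∪ negCharges)) ∧
    Pc.generated (Set.range QH ∪ Set.range e ∪ Set.range f) =
      Pc.generated (Set.range QH ∪ Set.range QE) ∧
    -- the reality conditions
    ‖Complex.exp (-(Complex.I * (γ : ℂ)))‖ = 1 ∧
    ((∀ m : M, IsPrincipalLog (cartanExponent b ρ γ (fun i => QH i m))) →
      ∀ i m, (starRingEnd ℂ) (QH i m) = -QH i m) ∧
    (∀ α : H.root, (starRingEnd ℂ) (A α) = A α → ∀ m, (starRingEnd ℂ) (QE α m) = -QE α m) ∧
    (∀ i : b.support, |γ * symm_d (simpleRoot b i)| ≤ Real.pi →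
      ∀ α : H.root, α = simpleRoot b i ∨ α = negRoot (simpleRoot b i) →
        A α ^ 2 = ((4 * Real.sin (γ * symm_d (simpleRoot b i)) / γ : ℝ) : ℂ) →
          ∀ m, (starRingEnd ℂ) (QE α m) = -QE α m) := by
  classical
  obtain ⟨xm, xd, xp, m, d, p, hm, hd, hp, F⟩ :=
    exists_isFactorisation P.complexify hE hρ hD hMp hMm
  have hUC : U.map ofRealFun = (m * d * p).val := by
    rw [map_ofRealFun_eq hU, hm, hd, hp, Units.val_mul, Units.val_mul]
  have hS := tensorBracket_complexify P hSklyanin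
  rw [rMatrix_map, hUC] at hS
  have hκ := chargeCoeff_ne_zero hγ one_ne_zero hA
  have hκ' := chargeCoeff_ne_zero hγ (neg_ne_zero.2 one_ne_zero) hA
  have hd0 : Complex.I * (γ : ℂ) ≠ 0 :=
    mul_ne_zero Complex.I_ne_zero (Complex.ofReal_ne_zero.2 hγ)
  -- The factor `iγ` of the Cartan charges in `D`, divided by the constant `γ` of the bracket, is
  -- the `i` in front of their brackets.
  have hcd : Complex.I * (γ : ℂ) * (γ : ℂ)⁻¹ = Complex.I :=
    mul_inv_cancel_right₀ (Complex.ofReal_ne_zero.2 hγ) _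
  have hreal := fun (α : H.root) (hα : (starRingEnd ℂ) (A α) = A α) (x : M) =>
    F.conj_charge hγ hA hUC hα x
  -- The full exponents `±iγ A Q` are real without any condition on the constants `A`. The statement
  -- on the Cartan charges therefore needs no normalisation.
  have hexp := F.map_exponent conjHom conjHom_conjHom (mapUnits_conjHom_eq hUC)
  have hbr := F.tensorBracket_eq hS
  intro Pc toC R₁₂ H₁₂ e f posCharges negCharges
  have hR : R₁₂ = degTensor (rep (SmoothC I M) ρ) (basisLeft b E) (basisRight b E) (basisDeg b)
      wSign := rMatrix_map b ρ E
  have hH : H₁₂ = degTensor (rep (SmoothC I M) ρ) (basisLeft b E) (basisRight b E) (basisDeg b)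
      wCartan := cartanTensor_map b ρ E
  refine ⟨?_, F.spansUqNilpotent_plus hκ hγ hS, F.spansUqNilpotent_minus hκ' hγ hS,
    PoissonBracket.br_eq_zero_of_generated Pc ?_, F.br_cartan hd0 hS, fun i α => ⟨?_, ?_⟩,
    F.spansUqBorel_plus hκ hd0 hγ hS hcd, F.spansUqBorel_minus hκ' hd0 hγ hS hcd,
    F.generated_simple_charges hκ hκ' hγ hS, ?_, ?_, hreal, ?_⟩
  · rw [hR, hH, hm, hd, hp]
    refine ⟨?_, hbr 1 2, ?_, ?_, hbr 2 2, hbr 0 0⟩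
    · simpa [brackets] using hbr 1 1
    · exact (hbr 1 0).trans (by simp [brackets])
    · simpa [brackets] using hbr 2 0
  · rintro _ ⟨α, rfl⟩ _ ⟨α', rfl⟩
    exact F.br_charge_charge hκ hκ' hS α α'
  · have h := F.br_cartan_charge hκ hγ hS i α
    rwa [hcd] at h
  · have h := F.br_cartan_charge_neg hκ' hγ hS i α
    rwa [hcd] at h
  · simp [Complex.norm_exp]
  · intro hlog i x
    refine conj_cartan_charge hE hρ hγ (fun k => ?_) (fun k => ?_) (hMm x) (hMp x)
      (by rw [hU x, hD x]) (hlog x) i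
    · exact congrArg (fun k : SmoothC I M => k x) (hexp k).1
    · exact congrArg (fun k : SmoothC I M => k x) (hexp k).2
  · intro i hi α _ hα
    -- The bound on `γ d_i` makes `sin(γ d_i)/γ` non-negative, so a square root of `4 sin(γ d_i)/γ`
    -- is real.
    exact hreal α (conj_eq_of_sq (sin_mul_div_nonneg (symm_d_nonneg _) hi) hα)
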